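/- Let $A$ and $B$ be (associative, unital, not necessarily commutative) rings, $U$ a $(B,A)$-bimodule and $T=\begin{pmatrix}A&0\\U&B\end{pmatrix}$ the triangular matrix ring. All modules are left modules. For a ring $R$ and an $R$-module $C$, let ${\rm Add}_R(C)$ be the class of $R$-modules isomorphic to direct summands of direct sums of copies of $C$. A sequence $\mathbf X$ is called ${\rm Hom}_R(-,{\rm Add}_R(C))$-exact if ${\rm Hom}_R(\mathbf X,F)$ is exact for every $F\in{\rm Add}_R(C)$. * $C$ is *w-tilting* if ${\rm Ext}^i_R(C,C^{(I)})=0$ for every set $I$ and every $i\ge 1$, and there is a ${\rm Hom}_R(-,{\rm Add}_R(C))$-exact exact sequence $0\to R\to A^0\to A^1\to\cdots$ with all $A^i\in{\rm Add}_R(C)$. * An $R$-module $M$ is *$G_C$-projective* ($M\in G_CP(R)$) if there is a ${\rm Hom}_R(-,{\rm Add}_R(C))$-exact exact sequence $\cdots\to P_1\to P_0\to A^0\to A^1\to\cdots$ with all $P_i$ projective, all $A^i\in{\rm Add}_R(C)$ and $M\cong{\rm Im}(P_0\to A^0)$. * $G_C\text{-pd}(M)\in\mathbb N\cup\{\infty\}$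 is the least $n\ge 0$ for which there is an exact sequence $0\to G_n\to\cdots\to G_0\to M\to 0$ with all $G_i\in G_CP(R)$, and $\infty$ if there is none; $G_C\text{-PD}(R)=\sup\{G_C\text{-pd}(M) : M \text{ an } R\text{-module}\}$. Let $C_1$ be an $A$-module and $C_2$ a $B$-module, and let $C=\mathbf p(C_1,C_2)=\begin{pmatrix}C_1\\(U\otimes_AC_1)\oplus C_2\end{pmatrix}$, the $T$-module on which $\begin{pmatrix}a&0\\u&b\end{pmatrix}$ acts by $(x,(t,y))\mapsto(ax,(u\otimes x+bt,\,by))$. The bimodule $U$ is *$C$-compatible* if (a) $U\otimes_A\mathbf X_1$ is exact for every exact sequence of $A$-modules $\mathbf X_1:\cdots\to P_1\to P_0\to A^0\to A^1\to\cdots$ with all $P_i$ projective and all $A^i\in{\rm Add}_A(C_1)$; (b) ${\rm Hom}_B(\mathbf X_2,U\otimes_AX_1)$ is exact for every $X_1\in{\rm Add}_A(C_1)$ and every ${\rm Hom}_B(-,{\rm Add}_B(C_2))$-exact exact sequence of $B$-modules $\mathbf X_2:\cdots\to Q_1\to Q_0\to D^0\to D^1\to\cdots$ with all $Q_i$ projective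 and all $D^i\in{\rm Add}_B(C_2)$. Put $SG_{C_2}\text{-PD}(B)=\sup\{G_{C_2}\text{-pd}(U\otimes_AG) : G\in G_{C_1}P(A)\}$. **Theorem.** If $C=\mathbf p(C_1,C_2)$ is w-tilting (over $T$) and $U$ is $C$-compatible, then, in $\mathbb N\cup\{\infty\}$, $$\max\{G_{C_1}\text{-PD}(A),\,G_{C_2}\text{-PD}(B)\}\le G_C\text{-PD}(T)\le\max\{G_{C_1}\text{-PD}(A)+SG_{C_2}\text{-PD}(B)+1,\;G_{C_2}\text{-PD}(B)\}.$$ -/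

import Mathlib

open scoped TensorProduct

universe u

namespace RelGor

section Ring

variable (R : Type u) [Ring R]

/-- `M ∈ Add_R(C)`: `M` is isomorphic to a direct summand of a direct sum `C^(I)` of copies
of `C`. -/
def IsAdd (C M : Type u) [AddCommGroup C] [Module R C] [AddCommGroup M] [Module R M] : Prop :=
  ∃ (I : Type u) (N : ModuleCat.{u} R), Nonempty ((M × N) ≃ₗ[R] (I →₀ C))

/-- A two-sided infinite sequence of `R`-modules and `R`-linear maps
`⋯ → X (-1) → X 0 → X 1 → ⋯`. -/
structure LinSeq where
  /-- the modules -/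
  X : ℤ → ModuleCat.{u} R
  /-- the maps -/
  d : ∀ n : ℤ, X n →ₗ[R] X (n + 1)

variable {R}

/-- The sequence is exact at every place. -/
def LinSeq.IsExact (S : LinSeq R) : Prop :=
  ∀ n : ℤ, Function.Exact (S.d n) (S.d (n + 1))

/-- The sequence `Hom_R(S, F)` is exact at every place. -/
def LinSeq.IsHomExact (S : LinSeq R) (F : Type u) [AddCommGroup F] [Module R F] : Prop :=
  ∀ n : ℤ, Function.Exact
    (fun h : S.X (n + 1 + 1) →ₗ[R] F => h ∘ₗ S.d (n + 1))
    (fun g : S.X (n + 1) →ₗ[R] F => g ∘ₗ S.d n)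

/-- The sequence is `Hom_R(-, Add_R(C))`-exact. -/
def LinSeq.IsHomAddExact (S : LinSeq R) (C : Type u) [AddCommGroup C] [Module R C] : Prop :=
  ∀ F : ModuleCat.{u} R, IsAdd R C F → S.IsHomExact F

/-- The sequence has the form `⋯ → P₁ → P₀ → A⁰ → A¹ → ⋯` with all `Pᵢ` projective and all
`Aⁱ ∈ Add_R(C)`; here `Pᵢ` sits in degree `-1 - i` and `Aⁱ` in degree `i`. -/
def LinSeq.IsProjAdd (S : LinSeq R) (C : Type u) [AddCommGroup C] [Module R C] : Prop :=
  (∀ n : ℤ, n < 0 → Module.Projective R (S.X n)) ∧ (∀ n : ℤ, 0 ≤ n → IsAdd R C (S.X n))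

variable (R)

/-- `M` is `G_C`-projective: there is a `Hom_R(-, Add_R(C))`-exact exact sequence
`⋯ → P₁ → P₀ → A⁰ → A¹ → ⋯` with `Pᵢ` projective, `Aⁱ ∈ Add_R(C)` and `M ≅ Im(P₀ → A⁰)`. -/
def IsGProj (C M : Type u) [AddCommGroup C] [Module R C] [AddCommGroup M] [Module R M] : Prop :=
  ∃ S : LinSeq R, S.IsProjAdd C ∧ S.IsExact ∧ S.IsHomAddExact C ∧
    Nonempty (M ≃ₗ[R] LinearMap.range (S.d (-1)))

/-- `C` is weakly Wakamatsu tilting (w-tilting):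
(1) `Ext_R^i(C, C^(I)) = 0` for every set `I` and every `i ≥ 1`;
(2) there is a `Hom_R(-, Add_R(C))`-exact exact sequence `0 → R → A⁰ → A¹ → ⋯` with all
`Aⁱ ∈ Add_R(C)`. -/
structure IsWTilting (C : Type u) [AddCommGroup C] [Module R C] : Prop where
  ext_eq_zero : ∀ (I : Type u) (i : ℕ), 1 ≤ i →
    Subsingleton (CategoryTheory.Abelian.Ext.{u} (ModuleCat.of R C) (ModuleCat.of R (I →₀ C)) i)
  exists_coresolution : ∃ (A : ℕ → ModuleCat.{u} R) (ε : R →ₗ[R] A 0)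
    (d : ∀ n : ℕ, A n →ₗ[R] A (n + 1)),
    (∀ n, IsAdd R C (A n)) ∧
    (Function.Injective ε ∧ Function.Exact ε (d 0) ∧
      ∀ n, Function.Exact (d n) (d (n + 1))) ∧
    ∀ F : ModuleCat.{u} R, IsAdd R C F →
      Function.Surjective (fun h : A 0 →ₗ[R] F => h ∘ₗ ε) ∧
      Function.Exact (fun h : A 1 →ₗ[R] F => h ∘ₗ d 0) (fun g : A 0 →ₗ[R] F => g ∘ₗ ε) ∧
      ∀ n, Function.Exact (fun h : A (n + 1 + 1) →ₗ[R] F => h ∘ₗ d (n + 1))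
        (fun g : A (n + 1) →ₗ[R] F => g ∘ₗ d n)

/-- `G_C-pd(M) ≤ n`: there is an exact sequence `0 → G_n → ⋯ → G_0 → M → 0` with all `G_i`
being `G_C`-projective (the sequence is continued by zero modules in degrees `> n`). -/
def GpdLE (C M : Type u) [AddCommGroup C] [Module R C] [AddCommGroup M] [Module R M]
    (n : ℕ) : Prop :=
  ∃ (G : ℕ → ModuleCat.{u} R) (d : ∀ i : ℕ, G (i + 1) →ₗ[R] G i) (ε : G 0 →ₗ[R] M),
    Function.Surjective ε ∧ Function.Exact (d 0) ε ∧
    (∀ i, Function.Exact (d (i + 1)) (d i)) ∧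
    (∀ i, i ≤ n → IsGProj R C (G i)) ∧ (∀ i, n < i → Subsingleton (G i))

/-- The `G_C`-projective dimension of `M`, equal to `⊤` if no finite resolution exists. -/
noncomputable def gpd (C M : Type u) [AddCommGroup C] [Module R C]
    [AddCommGroup M] [Module R M] : ℕ∞ :=
  ⨅ (n : ℕ) (_ : GpdLE R C M n), (n : ℕ∞)

/-- The left `G_C`-projective global dimension `G_C-PD(R)`. -/
noncomputable def gPD (C : Type u) [AddCommGroup C] [Module R C] : ℕ∞ :=
  ⨆ M : ModuleCat.{u} R, gpd R C M

end Ring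

section Tensor

/-! ### Tensor product over a noncommutative ring

A `(B, A)`-bimodule is an abelian group `U` with `[Module B U] [Module Aᵐᵒᵖ U]` and
`[SMulCommClass B Aᵐᵒᵖ U]`; the right action is `u * a = MulOpposite.op a • u`. -/

variable (A B U M : Type u) [Ring A] [Ring B]
  [AddCommGroup U] [Module B U] [Module Aᵐᵒᵖ U] [AddCommGroup M] [Module A M]

/-- The `B`-submodule of `U ⊗_ℤ M` generated by the elements `u a ⊗ m - u ⊗ a m`. Since `U` is a
bimodule, it is also the subgroup generated by these elements. -/
def balRel : Submodule B (U ⊗[ℤ] M) :=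
  Submodule.span B
    {t | ∃ (u : U) (a : A) (m : M), t = (MulOpposite.op a • u) ⊗ₜ[ℤ] m - u ⊗ₜ[ℤ] (a • m)}

/-- The left `B`-module `U ⊗_A M`, for a `(B, A)`-bimodule `U` and a left `A`-module `M`. -/
abbrev BTensor : Type u := (U ⊗[ℤ] M) ⧸ balRel A B U M

variable {U M}

/-- The element `u ⊗ m` of `U ⊗_A M`. -/
def btmul (u : U) (m : M) : BTensor A B U M := (balRel A B U M).mkQ (u ⊗ₜ[ℤ] m)

theorem btmul_add_left (u v : U) (m : M) :
    btmul A B (u + v) m = btmul A B u m + btmul A B v m := by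
  simp [btmul, TensorProduct.add_tmul]

theorem btmul_add_right (u : U) (m n : M) :
    btmul A B u (m + n) = btmul A B u m + btmul A B u n := by
  simp [btmul, TensorProduct.tmul_add]

theorem btmul_zero_left (m : M) : btmul A B (0 : U) m = 0 := by simp [btmul]

theorem btmul_zero_right (u : U) : btmul A B u (0 : M) = 0 := by simp [btmul]

theorem btmul_smul_left (b : B) (u : U) (m : M) :
    btmul A B (b • u) m = b • btmul A B u m := by
  rw [btmul, btmul, ← map_smul, TensorProduct.smul_tmul']

theorem btmul_op_smul (a : A) (u : U) (m : M) :
    btmul A B (MulOpposite.op a • u) m = btmul A B u (a • m) := by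
  rw [btmul, btmul, ← sub_eq_zero, ← map_sub, Submodule.mkQ_apply,
    Submodule.Quotient.mk_eq_zero]
  exact Submodule.subset_span ⟨u, a, m, rfl⟩

variable (U)

/-- The `B`-linear map `1_U ⊗ f : U ⊗_A M → U ⊗_A N` induced by an `A`-linear map `f`. -/
def bmap {N : Type u} [AddCommGroup N] [Module A N] (f : M →ₗ[A] N) :
    BTensor A B U M →ₗ[B] BTensor A B U N :=
  (balRel A B U M).mapQ (balRel A B U N)
    (TensorProduct.AlgebraTensorModule.map (LinearMap.id : U →ₗ[B] U)
      (f.toAddMonoidHom.toIntLinearMap)) (by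
    rw [balRel, Submodule.span_le]
    rintro _ ⟨u, a, m, rfl⟩
    refine Submodule.subset_span ⟨u, a, f m, ?_⟩
    simp)

theorem bmap_btmul {N : Type u} [AddCommGroup N] [Module A N] (f : M →ₗ[A] N) (u : U) (m : M) :
    bmap A B U f (btmul A B u m) = btmul A B u (f m) := by
  simp [bmap, btmul]

end Tensor

/-- The triangular matrix ring `T = (A 0; U B)` for a `(B, A)`-bimodule `U`. The element with
entries `a`, `u`, `b` is the matrix with rows `(a, 0)` and `(u, b)`. -/
@[ext]
structure TriMat (A B U : Type u) where
  /-- upper left entry -/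
  a : A
  /-- lower left entry -/
  u : U
  /-- lower right entry -/
  b : B

namespace TriMat

variable {A B U : Type u} [Ring A] [Ring B] [AddCommGroup U]

instance : Zero (TriMat A B U) := ⟨⟨0, 0, 0⟩⟩
instance : One (TriMat A B U) := ⟨⟨1, 0, 1⟩⟩
instance : Add (TriMat A B U) := ⟨fun s t => ⟨s.a + t.a, s.u + t.u, s.b + t.b⟩⟩
instance : Neg (TriMat A B U) := ⟨fun s => ⟨-s.a, -s.u, -s.b⟩⟩
@[simp] theorem zero_a : (0 : TriMat A B U).a = 0 := rfl
@[simp] theorem zero_u : (0 : TriMat A B U).u = 0 := rfl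
@[simp] theorem zero_b : (0 : TriMat A B U).b = 0 := rfl
@[simp] theorem one_a : (1 : TriMat A B U).a = 1 := rfl
@[simp] theorem one_u : (1 : TriMat A B U).u = 0 := rfl
@[simp] theorem one_b : (1 : TriMat A B U).b = 1 := rfl
@[simp] theorem add_a (s t : TriMat A B U) : (s + t).a = s.a + t.a := rfl
@[simp] theorem add_u (s t : TriMat A B U) : (s + t).u = s.u + t.u := rfl
@[simp] theorem add_b (s t : TriMat A B U) : (s + t).b = s.b + t.b := rfl
@[simp] theorem neg_a (s : TriMat A B U) : (-s).a = -s.a := rfl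
@[simp] theorem neg_u (s : TriMat A B U) : (-s).u = -s.u := rfl
@[simp] theorem neg_b (s : TriMat A B U) : (-s).b = -s.b := rfl

variable [Module B U] [Module Aᵐᵒᵖ U]

instance : Mul (TriMat A B U) :=
  ⟨fun s t => ⟨s.a * t.a, MulOpposite.op t.a • s.u + s.b • t.u, s.b * t.b⟩⟩

@[simp] theorem mul_a (s t : TriMat A B U) : (s * t).a = s.a * t.a := rfl
@[simp] theorem mul_u (s t : TriMat A B U) :
    (s * t).u = MulOpposite.op t.a • s.u + s.b • t.u := rfl
@[simp] theorem mul_b (s t : TriMat A B U) : (s * t).b = s.b * t.b := rfl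

instance [SMulCommClass B Aᵐᵒᵖ U] : Ring (TriMat A B U) where
  add_assoc s t r := by ext <;> simp [add_assoc]
  zero_add s := by ext <;> simp
  add_zero s := by ext <;> simp
  add_comm s t := by ext <;> simp [add_comm]
  neg_add_cancel s := by ext <;> simp
  nsmul := nsmulRec
  zsmul := zsmulRec
  mul_assoc s t r := by
    ext <;> simp [mul_assoc, mul_smul, smul_add, add_assoc, smul_comm]
  one_mul s := by ext <;> simp
  mul_one s := by ext <;> simp
  zero_mul s := by ext <;> simp
  mul_zero s := by ext <;> simp
  left_distrib s t r := by
    ext <;> simp [mul_add, add_smul, smul_add]; abel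
  right_distrib s t r := by
    ext <;> simp [add_mul, add_smul, smul_add]; abel

end TriMat

section Triple

variable {A B U M₁ M₂ : Type u} [Ring A] [Ring B]
  [AddCommGroup U] [Module B U] [Module Aᵐᵒᵖ U] [SMulCommClass B Aᵐᵒᵖ U]
  [AddCommGroup M₁] [Module A M₁] [AddCommGroup M₂] [Module B M₂]

/-- The underlying group `M₁ × M₂` of the left `T`-module given by a triple `(M₁, M₂, φ)` with
`φ : U ⊗_A M₁ → M₂` a `B`-linear map. -/
def OfTriple (_φ : BTensor A B U M₁ →ₗ[B] M₂) : Type u := M₁ × M₂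

variable (φ : BTensor A B U M₁ →ₗ[B] M₂)

instance : AddCommGroup (OfTriple φ) := inferInstanceAs (AddCommGroup (M₁ × M₂))

/-- The action of `T`: the matrix with rows `(a, 0)` and `(u, b)` sends the column `(x, y)` to
the column `(a x, φ (u ⊗ x) + b y)`. -/
instance : Module (TriMat A B U) (OfTriple φ) where
  smul t z := ((t.a • z.1, φ (btmul A B t.u z.1) + t.b • z.2) : M₁ × M₂)
  one_smul z := by
    change (((1 : A) • z.1, φ (btmul A B (0 : U) z.1) + (1 : B) • z.2) : M₁ × M₂) = z
    rw [btmul_zero_left]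
    simp only [one_smul, map_zero, zero_add]
    rfl
  mul_smul s t z := by
    change (((s.a * t.a) • z.1,
        φ (btmul A B (MulOpposite.op t.a • s.u + s.b • t.u) z.1) + (s.b * t.b) • z.2) : M₁ × M₂)
      = (s.a • t.a • z.1, φ (btmul A B s.u (t.a • z.1))
          + s.b • (φ (btmul A B t.u z.1) + t.b • z.2))
    rw [btmul_add_left, btmul_op_smul, btmul_smul_left, map_add, map_smul, smul_add, mul_smul,
      mul_smul, add_assoc]
  smul_zero t := by
    change ((t.a • (0 : M₁), φ (btmul A B t.u (0 : M₁)) + t.b • (0 : M₂)) : M₁ × M₂) = 0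
    rw [btmul_zero_right]
    simp
  smul_add t z w := by
    change ((t.a • (z.1 + w.1), φ (btmul A B t.u (z.1 + w.1)) + t.b • (z.2 + w.2)) : M₁ × M₂)
      = (t.a • z.1 + t.a • w.1, (φ (btmul A B t.u z.1) + t.b • z.2)
          + (φ (btmul A B t.u w.1) + t.b • w.2))
    rw [btmul_add_right, map_add, smul_add, smul_add, add_add_add_comm]
  add_smul s t z := by
    change (((s.a + t.a) • z.1, φ (btmul A B (s.u + t.u) z.1) + (s.b + t.b) • z.2) : M₁ × M₂)
      = (s.a • z.1 + t.a • z.1, (φ (btmul A B s.u z.1) + s.b • z.2)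
          + (φ (btmul A B t.u z.1) + t.b • z.2))
    rw [btmul_add_left, map_add, add_smul, add_smul, add_add_add_comm]
  zero_smul z := by
    change (((0 : A) • z.1, φ (btmul A B (0 : U) z.1) + (0 : B) • z.2) : M₁ × M₂) = 0
    rw [btmul_zero_left]
    simp

variable (A B U M₁ M₂)

/-- The left `T`-module `p(M₁, M₂)` given by the triple `(M₁, (U ⊗_A M₁) ⊕ M₂)` with the
canonical injection `U ⊗_A M₁ → (U ⊗_A M₁) ⊕ M₂`. -/
abbrev pMod : Type u := OfTriple (LinearMap.inl B (BTensor A B U M₁) M₂)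

/-- `U` is `C`-compatible, for `C = p(C₁, C₂)`. -/
structure IsCompatible (C₁ C₂ : Type u) [AddCommGroup C₁] [Module A C₁]
    [AddCommGroup C₂] [Module B C₂] : Prop where
  /-- `U ⊗_A S` is exact for every exact sequence `S : ⋯ → P₁ → P₀ → A⁰ → A¹ → ⋯` of left
  `A`-modules with `Pᵢ` projective and `Aⁱ ∈ Add_A(C₁)`. -/
  tensor_exact : ∀ S : LinSeq A, S.IsProjAdd C₁ → S.IsExact →
    ∀ n : ℤ, Function.Exact (bmap A B U (S.d n)) (bmap A B U (S.d (n + 1)))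
  /-- `Hom_B(S, U ⊗_A X₁)` is exact for every `X₁ ∈ Add_A(C₁)` and every
  `Hom_B(-, Add_B(C₂))`-exact exact sequence `S : ⋯ → P₁ → P₀ → A⁰ → A¹ → ⋯` of left
  `B`-modules with `Pᵢ` projective and `Aⁱ ∈ Add_B(C₂)`. -/
  hom_exact : ∀ S : LinSeq B, S.IsProjAdd C₂ → S.IsExact → S.IsHomAddExact C₂ →
    ∀ X₁ : ModuleCat.{u} A, IsAdd A C₁ X₁ → S.IsHomExact (BTensor A B U X₁)

/-- `SG_{C₂}-PD(B)`, the supremum of `G_{C₂}-pd(U ⊗_A G)` over all `G_{C₁}`-projective left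
`A`-modules `G`. -/
noncomputable def sgPD (C₁ C₂ : Type u) [AddCommGroup C₁] [Module A C₁]
    [AddCommGroup C₂] [Module B C₂] : ℕ∞ :=
  ⨆ (G : ModuleCat.{u} A) (_ : IsGProj A C₁ G), gpd B C₂ (BTensor A B U G)

end Triple

end RelGor

/-! The first half concerns one ring. `IsGProj` is equivalent to two independent conditions: `Perp`
(positive Ext into Add(C) vanishes) and `Cores` (there is a Hom(-, Add(C))-exact coresolution by
Add(C)), see `IsGProj.perp`, `IsGProj.cores` and `isGProj_of_perp_of_cores`. Closure properties can
then be checked condition by condition. When C is w-tilting, projectives are G_C-projective and the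
class is closed under kernels of epimorphisms (`IsWTilting.isGProj_ker`). Hence dimension may be
tested on any projective syzygy (`DimLE`, `DimLE.ker`) and obeys the usual estimates in short exact
sequences (`DimLE.mid`, `DimLE.right`). Since w-tilting is assumed only over T, these tools are used
only there; over A and B the argument works with explicit resolutions `GpdLE`.

The second half moves between rings. A T-module M amounts to e₁M, e₂M and a structure map U ⊗ e₁M →
e₂M with cokernel Cok M. Three adjunctions do the work: Hom(p(X,Y), M) = Hom(X, e₁M) × Hom(Y, e₂M),
Hom(M, (X,0)) = Hom(e₁M, X), and Hom(M, p(0,Y)) = Hom(Cok M, Y). With compatibility they show that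
p(G₁,G₂) is G_C-projective when G₁ and G₂ are relatively G-projective (`IsCompatible.isGProj_pMod`),
and that e₁ and Cok carry G_C-projectives back (`IsCompatible.isGProj_fst`,
`IsCompatible.isGProj_cok`).

Lower bound: e₁ is exact and e₁ p(X,0) = X; the modules p(0,N) have projective syzygies of the same
form, with Cok p(0,N) = N. Upper bound: in 0 → (0,e₂M) → M → (e₁M,0) → 0 the left term has dimension
at most that of e₂M over B. For G-projective G the sequence 0 → (0,U⊗G) → p(G,0) → (G,0) → 0 costs
SG-PD(B) + 1, and resolving e₁M by such G adds G-PD(A). -/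

namespace RelGor

/-! ### Short exact sequences -/

section ShortExact

variable {R : Type u} [Ring R] {X Y Z W F : Type u}
  [AddCommGroup X] [Module R X] [AddCommGroup Y] [Module R Y] [AddCommGroup Z] [Module R Z]
  [AddCommGroup W] [Module R W] [AddCommGroup F] [Module R F]

/-- The sequence `0 → X → Y → Z → 0` is exact. -/
structure IsSES (i : X →ₗ[R] Y) (p : Y →ₗ[R] Z) : Prop where
  inj : Function.Injective i
  exact : Function.Exact i p
  surj : Function.Surjective p

theorem exists_desc {p : Y →ₗ[R] Z} (hp : Function.Surjective p) (g : Y →ₗ[R] F)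
    (hg : ∀ y, p y = 0 → g y = 0) : ∃ h : Z →ₗ[R] F, h ∘ₗ p = g := by
  refine ⟨(LinearMap.ker p).liftQ g (fun y hy => hg y hy) ∘ₗ
    (p.quotKerEquivOfSurjective hp).symm.toLinearMap, ?_⟩
  ext y
  have : (p.quotKerEquivOfSurjective hp).symm (p y) = Submodule.Quotient.mk y := by
    rw [LinearEquiv.symm_apply_eq]; rfl
  simp only [LinearMap.comp_apply, LinearEquiv.coe_coe, this]
  exact Submodule.liftQ_apply _ _ _

theorem exists_lift {i : X →ₗ[R] Y} (hi : Function.Injective i) (g : W →ₗ[R] Y)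
    (hg : ∀ w, ∃ x, i x = g w) : ∃ h : W →ₗ[R] X, i ∘ₗ h = g := by
  refine ⟨(LinearEquiv.ofInjective i hi).symm.toLinearMap ∘ₗ
    g.codRestrict (LinearMap.range i) (fun w => hg w), ?_⟩
  ext w
  have := congrArg Subtype.val ((LinearEquiv.ofInjective i hi).apply_symm_apply
    (g.codRestrict (LinearMap.range i) (fun w => hg w) w))
  exact this

theorem IsSES.desc {i : X →ₗ[R] Y} {p : Y →ₗ[R] Z} (h : IsSES i p) (g : Y →ₗ[R] F)
    (hg : g ∘ₗ i = 0) : ∃ k : Z →ₗ[R] F, k ∘ₗ p = g := by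
  refine exists_desc h.surj g fun y hy => ?_
  obtain ⟨x, rfl⟩ := (h.exact y).1 hy
  exact LinearMap.congr_fun hg x

theorem IsSES.comp_eq_zero {i : X →ₗ[R] Y} {p : Y →ₗ[R] Z} (h : IsSES i p) : p ∘ₗ i = 0 :=
  h.exact.linearMap_comp_eq_zero

theorem IsSES.apply_apply {i : X →ₗ[R] Y} {p : Y →ₗ[R] Z} (h : IsSES i p) (x : X) :
    p (i x) = 0 := h.exact.apply_apply_eq_zero x

theorem isSES_ker {p : Y →ₗ[R] Z} (hp : Function.Surjective p) :
    IsSES (LinearMap.ker p).subtype p :=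
  ⟨Subtype.val_injective, fun y => by simp, hp⟩

theorem isSES_mkQ {i : X →ₗ[R] Y} (hi : Function.Injective i) :
    IsSES i (LinearMap.range i).mkQ :=
  ⟨hi, fun y => by simp, Submodule.mkQ_surjective _⟩

theorem isSES_prod : IsSES (LinearMap.inl R X Y) (LinearMap.snd R X Y) :=
  ⟨LinearMap.inl_injective, Function.Exact.inl_snd, LinearMap.snd_surjective⟩

theorem IsSES.finsupp (I : Type u) {i : X →ₗ[R] Y} {p : Y →ₗ[R] Z} (h : IsSES i p) :
    IsSES (Finsupp.mapRange.linearMap (α := I) i) (Finsupp.mapRange.linearMap (α := I) p) := by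
  refine ⟨Finsupp.mapRange_injective _ (map_zero i) h.inj, fun y => ⟨fun hy => ?_, ?_⟩,
    Finsupp.mapRange_surjective _ (map_zero p) h.surj⟩
  · have h1 : ∀ a, ∃ x, i x = y a := fun a =>
      (h.exact (y a)).1 (by simpa using DFunLike.congr_fun hy a)
    choose x hx using h1
    refine ⟨Finsupp.onFinset y.support x fun a ha => ?_, ?_⟩
    · rw [Finsupp.mem_support_iff]
      intro h0
      exact ha (h.inj (by rw [hx, h0, map_zero]))
    · ext a; simp [hx]
  · rintro ⟨x, rfl⟩
    ext a; simp [h.apply_apply]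

theorem IsSES.congr_left {i : X →ₗ[R] Y} {p : Y →ₗ[R] Z} (h : IsSES i p) (e : W ≃ₗ[R] X) :
    IsSES (i ∘ₗ e.toLinearMap) p := by
  refine ⟨h.inj.comp e.injective, fun y => (h.exact y).trans ⟨?_, ?_⟩, h.surj⟩
  · rintro ⟨x, rfl⟩; exact ⟨e.symm x, by simp⟩
  · rintro ⟨x, rfl⟩; exact ⟨e x, by simp⟩

theorem IsSES.congr_right {i : X →ₗ[R] Y} {p : Y →ₗ[R] Z} (h : IsSES i p) (e : Z ≃ₗ[R] W) :
    IsSES i (e.toLinearMap ∘ₗ p) :=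
  ⟨h.inj, fun y => by simpa using h.exact y, e.surjective.comp h.surj⟩

/-- A diagonal form of the nine lemma: a middle object embedded by `(a, b)`. -/
theorem IsSES.cokernel_extension {M E N A₁ A₂ M' N' : Type u}
    [AddCommGroup M] [Module R M] [AddCommGroup E] [Module R E] [AddCommGroup N] [Module R N]
    [AddCommGroup A₁] [Module R A₁] [AddCommGroup A₂] [Module R A₂]
    [AddCommGroup M'] [Module R M'] [AddCommGroup N'] [Module R N']
    {i : M →ₗ[R] E} {p : E →ₗ[R] N} (h : IsSES i p)
    {j₁ : M →ₗ[R] A₁} {q₁ : A₁ →ₗ[R] M'} (h₁ : IsSES j₁ q₁)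
    {j₂ : N →ₗ[R] A₂} {q₂ : A₂ →ₗ[R] N'} (h₂ : IsSES j₂ q₂)
    (e : E →ₗ[R] A₁) (he : e ∘ₗ i = j₁) :
    ∃ (E' : ModuleCat.{u} R) (q : A₁ × A₂ →ₗ[R] E') (i' : M' →ₗ[R] E') (p' : E' →ₗ[R] N'),
      IsSES (e.prod (j₂ ∘ₗ p)) q ∧ IsSES i' p' ∧
      i' ∘ₗ q₁ = q ∘ₗ LinearMap.inl R A₁ A₂ ∧ p' ∘ₗ q = q₂ ∘ₗ LinearMap.snd R A₁ A₂ := by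
  have hei : ∀ m, e (i m) = j₁ m := LinearMap.congr_fun he
  have hinj : Function.Injective (e.prod (j₂ ∘ₗ p)) := by
    rw [injective_iff_map_eq_zero]
    intro x hx
    have hx1 : e x = 0 := congrArg Prod.fst hx
    have hx2 : j₂ (p x) = 0 := congrArg Prod.snd hx
    have := (injective_iff_map_eq_zero _).1 h₂.inj _ hx2
    obtain ⟨m, rfl⟩ := (h.exact x).1 this
    rw [hei] at hx1
    rw [(injective_iff_map_eq_zero _).1 h₁.inj _ hx1, map_zero]
  set q := (LinearMap.range (e.prod (j₂ ∘ₗ p))).mkQ with hq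
  have hses : IsSES (e.prod (j₂ ∘ₗ p)) q := isSES_mkQ hinj
  obtain ⟨i', hi'⟩ := h₁.desc (q ∘ₗ LinearMap.inl R A₁ A₂) (by
    ext m
    have : ((j₁ m, 0) : A₁ × A₂) = e.prod (j₂ ∘ₗ p) (i m) := by
      simp [hei, h.apply_apply]
    simpa [this] using hses.apply_apply (i m))
  obtain ⟨p', hp'⟩ := hses.desc (q₂ ∘ₗ LinearMap.snd R A₁ A₂) (by
    ext x
    simp [h₂.apply_apply])
  have hi1 : ∀ a, i' (q₁ a) = q (a, 0) := LinearMap.congr_fun hi'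
  have hp1 : ∀ a, p' (q a) = q₂ a.2 := LinearMap.congr_fun hp'
  refine ⟨ModuleCat.of R _, q, i', p', hses, ⟨?_, ?_, ?_⟩, hi', hp'⟩
  · rw [injective_iff_map_eq_zero]
    intro m' hm'
    obtain ⟨a, rfl⟩ := h₁.surj m'
    rw [hi1] at hm'
    obtain ⟨x, hx⟩ := (hses.exact _).1 hm'
    have hx1 : e x = a := congrArg Prod.fst hx
    have hx2 : j₂ (p x) = 0 := congrArg Prod.snd hx
    have := (injective_iff_map_eq_zero _).1 h₂.inj _ hx2
    obtain ⟨m, rfl⟩ := (h.exact x).1 this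
    rw [← hx1, hei, h₁.apply_apply]
  · intro y
    obtain ⟨⟨a, b⟩, rfl⟩ := hses.surj y
    rw [hp1]
    constructor
    · intro hb
      obtain ⟨n, rfl⟩ := (h₂.exact _).1 hb
      obtain ⟨x, rfl⟩ := h.surj n
      refine ⟨q₁ (a - e x), ?_⟩
      rw [hi1, ← sub_eq_zero, ← map_sub]
      have : ((a - e x, 0) - (a, j₂ (p x)) : A₁ × A₂) = e.prod (j₂ ∘ₗ p) (-x) := by
        simp
      rw [this, hses.apply_apply]
    · rintro ⟨m', hm'⟩
      obtain ⟨c, rfl⟩ := h₁.surj m'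
      rw [hi1] at hm'
      have := congrArg p' hm'
      rw [hp1, hp1] at this
      simpa using this.symm
  · intro n'
    obtain ⟨b, rfl⟩ := h₂.surj n'
    exact ⟨q (0, b), by rw [hp1]⟩

end ShortExact

/-! ### The class Add(C) -/

section Add

variable {R : Type u} [Ring R] {C M N : Type u} [AddCommGroup C] [Module R C]
  [AddCommGroup M] [Module R M] [AddCommGroup N] [Module R N]

/-- Retracts pass through any functor, whereas complements are awkward to carry along; the
complement is recovered as the kernel of the retraction. -/
theorem isAdd_iff_retract : IsAdd R C M ↔
    ∃ (I : Type u) (i : M →ₗ[R] (I →₀ C)) (r : (I →₀ C) →ₗ[R] M), r ∘ₗ i = LinearMap.id := by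
  constructor
  · rintro ⟨I, N, ⟨e⟩⟩
    refine ⟨I, e.toLinearMap ∘ₗ LinearMap.inl R M N,
      LinearMap.fst R M N ∘ₗ e.symm.toLinearMap, ?_⟩
    ext x; simp
  · rintro ⟨I, i, r, h⟩
    have h' : ∀ x, r (i x) = x := LinearMap.congr_fun h
    refine ⟨I, ModuleCat.of R (LinearMap.ker r), ⟨LinearEquiv.ofBijective
      (i.coprod (LinearMap.ker r).subtype) ⟨?_, ?_⟩⟩⟩
    · rw [injective_iff_map_eq_zero]
      rintro ⟨x, ⟨k, hk⟩⟩ hx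
      have hx' : i x + k = 0 := hx
      have : x = 0 := by
        have := congrArg r hx'
        rwa [map_add, h', LinearMap.mem_ker.1 hk, add_zero, map_zero] at this
      subst this
      have : k = 0 := by simpa using hx'
      subst this; rfl
    · intro y
      refine ⟨(r y, ⟨y - i (r y), by simp [h']⟩), ?_⟩
      simp

theorem IsAdd.retract (h : IsAdd R C M) (i : N →ₗ[R] M) (r : M →ₗ[R] N)
    (hr : r ∘ₗ i = LinearMap.id) : IsAdd R C N := by
  obtain ⟨I, j, s, hs⟩ := isAdd_iff_retract.1 h
  refine isAdd_iff_retract.2 ⟨I, j ∘ₗ i, r ∘ₗ s, ?_⟩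
  calc (r ∘ₗ s) ∘ₗ j ∘ₗ i = r ∘ₗ (s ∘ₗ j) ∘ₗ i := rfl
    _ = LinearMap.id := by rw [hs, LinearMap.id_comp, hr]

theorem IsAdd.congr (h : IsAdd R C M) (e : M ≃ₗ[R] N) : IsAdd R C N :=
  h.retract e.symm.toLinearMap e.toLinearMap (by ext; simp)

theorem isAdd_finsupp_self (I : Type u) : IsAdd R C (I →₀ C) :=
  isAdd_iff_retract.2 ⟨I, LinearMap.id, LinearMap.id, rfl⟩

theorem isAdd_self : IsAdd R C C :=
  (isAdd_finsupp_self (R := R) (C := C) PUnit).congr (Finsupp.uniqueLinearEquiv R C PUnit.unit)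

theorem isAdd_of_subsingleton [Subsingleton M] : IsAdd R C M :=
  isAdd_self.retract (0 : M →ₗ[R] C) 0 (by ext; exact Subsingleton.elim _ _)

theorem IsAdd.finsupp (h : IsAdd R C M) (I : Type u) : IsAdd R C (I →₀ M) := by
  obtain ⟨J, j, s, hs⟩ := isAdd_iff_retract.1 h
  refine ((isAdd_finsupp_self (R := R) (C := C) (I × J)).congr
    (Finsupp.curryLinearEquiv R)).retract
    (Finsupp.mapRange.linearMap j) (Finsupp.mapRange.linearMap s) ?_
  rw [← Finsupp.mapRange.linearMap_comp, hs, Finsupp.mapRange.linearMap_id]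

theorem IsAdd.prod (h : IsAdd R C M) (h' : IsAdd R C N) : IsAdd R C (M × N) := by
  obtain ⟨I, i, r, hr⟩ := isAdd_iff_retract.1 h
  obtain ⟨J, j, s, hs⟩ := isAdd_iff_retract.1 h'
  refine ((isAdd_finsupp_self (R := R) (C := C) (I ⊕ J)).congr
    (Finsupp.sumFinsuppLEquivProdFinsupp R)).retract
    (i.prodMap j) (r.prodMap s) ?_
  rw [LinearMap.prodMap_comp, hr, hs, LinearMap.prodMap_id]

end Add

/-! ### Vanishing of Ext -/

section ExtVanishing

open CategoryTheory Abelian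

/-- `Ext_R^i(M, F) = 0`. -/
abbrev ExtZero (R : Type u) [Ring R] (M F : Type u) [AddCommGroup M] [Module R M]
    [AddCommGroup F] [Module R F] (i : ℕ) : Prop :=
  Subsingleton (Ext.{u} (ModuleCat.of R M) (ModuleCat.of R F) i)

variable {R : Type u} [Ring R] {X Y Z F : Type u}
  [AddCommGroup X] [Module R X] [AddCommGroup Y] [Module R Y] [AddCommGroup Z] [Module R Z]
  [AddCommGroup F] [Module R F]

theorem IsSES.exists_shortExact {i : X →ₗ[R] Y} {p : Y →ₗ[R] Z} (h : IsSES i p) :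
    ∃ w : ModuleCat.ofHom i ≫ ModuleCat.ofHom p = 0,
      (ShortComplex.mk (ModuleCat.ofHom i) (ModuleCat.ofHom p) w).ShortExact := by
  have w : ModuleCat.ofHom i ≫ ModuleCat.ofHom p = 0 := by
    rw [← ModuleCat.ofHom_comp, h.comp_eq_zero]; rfl
  refine ⟨w, ?_⟩
  have : Mono (ModuleCat.ofHom i) := (ModuleCat.mono_iff_injective _).2 h.inj
  have : Epi (ModuleCat.ofHom p) := (ModuleCat.epi_iff_surjective _).2 h.surj
  refine ShortComplex.ShortExact.mk ?_
  exact (ShortComplex.ShortExact.moduleCat_exact_iff_function_exact _).2 h.exact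

theorem ExtZero.right {i : X →ₗ[R] Y} {p : Y →ₗ[R] Z} (h : IsSES i p) {n : ℕ}
    (hX : ExtZero R X F n) (hY : ExtZero R Y F (n + 1)) : ExtZero R Z F (n + 1) := by
  obtain ⟨w, hS⟩ := h.exists_shortExact
  refine subsingleton_of_forall_eq 0 fun x => ?_
  obtain ⟨y, hy⟩ := Ext.contravariant_sequence_exact₃ hS (ModuleCat.of R F) x
    (Subsingleton.elim (α := Ext (ModuleCat.of R Y) (ModuleCat.of R F) (n + 1)) _ _)
    (add_comm 1 n)
  rw [← hy, Subsingleton.elim (α := Ext (ModuleCat.of R X) (ModuleCat.of R F) n) y 0,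
    Ext.comp_zero]

theorem ExtZero.left {i : X →ₗ[R] Y} {p : Y →ₗ[R] Z} (h : IsSES i p) {n : ℕ}
    (hY : ExtZero R Y F n) (hZ : ExtZero R Z F (n + 1)) : ExtZero R X F n := by
  obtain ⟨w, hS⟩ := h.exists_shortExact
  refine subsingleton_of_forall_eq 0 fun x => ?_
  obtain ⟨y, hy⟩ := Ext.contravariant_sequence_exact₁ hS (ModuleCat.of R F) x (add_comm 1 n)
    (Subsingleton.elim (α := Ext (ModuleCat.of R Z) (ModuleCat.of R F) (n + 1)) _ _)
  rw [← hy, Subsingleton.elim (α := Ext (ModuleCat.of R Y) (ModuleCat.of R F) n) y 0,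
    Ext.comp_zero]

theorem ExtZero.mid {i : X →ₗ[R] Y} {p : Y →ₗ[R] Z} (h : IsSES i p) {n : ℕ}
    (hX : ExtZero R X F n) (hZ : ExtZero R Z F n) : ExtZero R Y F n := by
  obtain ⟨w, hS⟩ := h.exists_shortExact
  refine subsingleton_of_forall_eq 0 fun x => ?_
  obtain ⟨y, hy⟩ := Ext.contravariant_sequence_exact₂ hS (ModuleCat.of R F) x
    (Subsingleton.elim (α := Ext (ModuleCat.of R X) (ModuleCat.of R F) n) _ _)
  rw [← hy, Subsingleton.elim (α := Ext (ModuleCat.of R Z) (ModuleCat.of R F) n) y 0,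
    Ext.comp_zero]

/-- Every class is the connecting image of some map on X. That map factors through i, and the
connecting homomorphism kills such maps. -/
theorem ExtZero.of_extend {i : X →ₗ[R] Y} {p : Y →ₗ[R] Z} (h : IsSES i p)
    (hXY : ∀ g : X →ₗ[R] F, ∃ k : Y →ₗ[R] F, k ∘ₗ i = g) (hY : ExtZero R Y F 1) :
    ExtZero R Z F 1 := by
  obtain ⟨w, hS⟩ := h.exists_shortExact
  refine subsingleton_of_forall_eq 0 fun x => ?_
  obtain ⟨y, hy⟩ := Ext.contravariant_sequence_exact₃ hS (ModuleCat.of R F) x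
    (Subsingleton.elim (α := Ext (ModuleCat.of R Y) (ModuleCat.of R F) 1) _ _)
    (add_zero 1)
  obtain ⟨g, rfl⟩ := Ext.addEquiv₀.symm.surjective y
  obtain ⟨k, hk⟩ := hXY g.hom
  have : g = ModuleCat.ofHom i ≫ ModuleCat.ofHom k := by
    rw [← ModuleCat.ofHom_comp, hk]; rfl
  rw [← hy, this, Ext.addEquiv₀_symm_apply, ← Ext.mk₀_comp_mk₀]
  exact hS.extClass_comp_assoc _

theorem ExtZero.extend {i : X →ₗ[R] Y} {p : Y →ₗ[R] Z} (h : IsSES i p)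
    (hZ : ExtZero R Z F 1) (g : X →ₗ[R] F) : ∃ k : Y →ₗ[R] F, k ∘ₗ i = g := by
  obtain ⟨w, hS⟩ := h.exists_shortExact
  obtain ⟨y, hy⟩ := Ext.contravariant_sequence_exact₁ hS (ModuleCat.of R F)
    (Ext.mk₀ (ModuleCat.ofHom g)) (add_zero 1)
    (Subsingleton.elim (α := Ext (ModuleCat.of R Z) (ModuleCat.of R F) 1) _ _)
  obtain ⟨k, rfl⟩ := Ext.addEquiv₀.symm.surjective y
  rw [Ext.addEquiv₀_symm_apply, Ext.mk₀_comp_mk₀] at hy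
  have := (Ext.mk₀_bijective _ _).1 hy
  exact ⟨k.hom, congrArg ModuleCat.Hom.hom this⟩

theorem extZero_of_projective [Module.Projective R X] (n : ℕ) : ExtZero R X F (n + 1) := by
  have : Projective (ModuleCat.of R X) :=
    (IsProjective.iff_projective (R := R) (P := X)).1 inferInstance
  exact Ext.subsingleton_of_projective _ _ _

theorem ExtZero.retract_right {n : ℕ} (h : ExtZero R X Y n) (i : F →ₗ[R] Y) (r : Y →ₗ[R] F)
    (hr : r ∘ₗ i = LinearMap.id) : ExtZero R X F n := by
  refine subsingleton_of_forall_eq 0 fun x => ?_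
  have h1 : ModuleCat.ofHom i ≫ ModuleCat.ofHom r = 𝟙 (ModuleCat.of R F) := by
    rw [← ModuleCat.ofHom_comp, hr]; rfl
  have h2 : (x.comp (Ext.mk₀ (ModuleCat.ofHom i)) (add_zero n)).comp
      (Ext.mk₀ (ModuleCat.ofHom r)) (add_zero n) = x := by
    rw [Ext.comp_assoc_of_third_deg_zero, Ext.mk₀_comp_mk₀, h1, Ext.comp_mk₀_id]
  rw [← h2, Subsingleton.elim (x.comp (Ext.mk₀ (ModuleCat.ofHom i)) (add_zero n)) 0,
    Ext.zero_comp]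

theorem ExtZero.retract_left {n : ℕ} (h : ExtZero R Y F n) (i : X →ₗ[R] Y) (r : Y →ₗ[R] X)
    (hr : r ∘ₗ i = LinearMap.id) : ExtZero R X F n := by
  refine subsingleton_of_forall_eq 0 fun x => ?_
  have h1 : ModuleCat.ofHom i ≫ ModuleCat.ofHom r = 𝟙 (ModuleCat.of R X) := by
    rw [← ModuleCat.ofHom_comp, hr]; rfl
  have h2 : (Ext.mk₀ (ModuleCat.ofHom i)).comp
      ((Ext.mk₀ (ModuleCat.ofHom r)).comp x (zero_add n)) (zero_add n) = x := by
    rw [Ext.mk₀_comp_mk₀_assoc, h1, Ext.mk₀_id_comp]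
  rw [← h2, Subsingleton.elim ((Ext.mk₀ (ModuleCat.ofHom r)).comp x (zero_add n)) 0,
    Ext.comp_zero]

theorem exists_free_cover (R : Type u) [Ring R] (M : Type u) [AddCommGroup M] [Module R M] :
    ∃ (P : ModuleCat.{u} R) (f : P →ₗ[R] M), Module.Free R P ∧ Function.Surjective f :=
  ⟨ModuleCat.of R (M →₀ R), Finsupp.linearCombination R id,
    inferInstanceAs (Module.Free R (M →₀ R)),
    Finsupp.linearCombination_id_surjective R M⟩

/-- In degree one, maps out of a direct sum of syzygies extend summand by summand; higher degrees
follow by dimension shifting along direct sums of a free cover. -/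
theorem ExtZero.finsupp (I : Type u) (n : ℕ) : ∀ (M : Type u) [AddCommGroup M] [Module R M],
    (∀ k ≤ n, ExtZero R M F (k + 1)) → ExtZero R (I →₀ M) F (n + 1) := by
  induction n with
  | zero =>
    intro M _ _ h
    obtain ⟨P, f, hP, hf⟩ := exists_free_cover R M
    have hs := isSES_ker hf
    refine ExtZero.of_extend (hs.finsupp I) (fun g => ?_)
      (extZero_of_projective (X := I →₀ P) 0)
    have := fun a => (h 0 le_rfl).extend hs (g ∘ₗ Finsupp.lsingle a)
    choose k hk using this
    refine ⟨Finsupp.lsum ℕ k, ?_⟩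
    ext a x
    have := LinearMap.congr_fun (hk a) x
    simpa using this
  | succ n ih =>
    intro M _ _ h
    obtain ⟨P, f, hP, hf⟩ := exists_free_cover R M
    have : Module.Projective R P := Module.Projective.of_free
    have hs := isSES_ker hf
    refine ExtZero.right (hs.finsupp I) (ih (LinearMap.ker f) fun k hk => ?_)
      (extZero_of_projective (X := I →₀ P) _)
    exact ExtZero.left hs (extZero_of_projective (X := P) _) (h (k + 1) (by omega))

end ExtVanishing

/-! ### The two halves of G_C-projectivity: Ext-orthogonality and coresolutions -/

section Classes

variable {R : Type u} [Ring R]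

/-- Every map from `X` to a module in `Add_R(C)` extends along `i`. -/
def ExtendsAdd (C : Type u) [AddCommGroup C] [Module R C] {X Y : Type u}
    [AddCommGroup X] [Module R X] [AddCommGroup Y] [Module R Y] (i : X →ₗ[R] Y) : Prop :=
  ∀ F : ModuleCat.{u} R, IsAdd R C F → ∀ g : X →ₗ[R] F, ∃ k : Y →ₗ[R] F, k ∘ₗ i = g

variable (R)

/-- `Ext_R^i(M, F) = 0` for all `i ≥ 1` and `F ∈ Add_R(C)`. -/
def Perp (C M : Type u) [AddCommGroup C] [Module R C] [AddCommGroup M] [Module R M] : Prop :=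
  ∀ F : ModuleCat.{u} R, IsAdd R C F → ∀ n : ℕ, ExtZero R M F (n + 1)

variable {R}

/-- `M` is the first term of a `Hom_R(-, Add_R(C))`-exact sequence `0 → M → A → N → 0` with
`A ∈ Add_R(C)` and `N` in the class `K`. -/
def HasAddStep (C : Type u) [AddCommGroup C] [Module R C] (K : ModuleCat.{u} R → Prop)
    (M : Type u) [AddCommGroup M] [Module R M] : Prop :=
  ∃ (A N : ModuleCat.{u} R) (i : M →ₗ[R] A) (p : A →ₗ[R] N),
    IsAdd R C A ∧ IsSES i p ∧ ExtendsAdd C i ∧ K N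

variable (R)

/-- `M` has a `Hom_R(-, Add_R(C))`-exact coresolution by modules in `Add_R(C)`; the class of
these modules is the largest one all of whose members satisfy `HasAddStep`. -/
def Cores (C M : Type u) [AddCommGroup C] [Module R C] [AddCommGroup M] [Module R M] : Prop :=
  ∃ K : ModuleCat.{u} R → Prop, K (ModuleCat.of R M) ∧ ∀ X, K X → HasAddStep C K X

variable {R} {C : Type u} [AddCommGroup C] [Module R C]

section

variable {X Y Z : Type u} [AddCommGroup X] [Module R X] [AddCommGroup Y] [Module R Y]
  [AddCommGroup Z] [Module R Z]

theorem ExtendsAdd.comp {i : X →ₗ[R] Y} {j : Y →ₗ[R] Z} (hj : ExtendsAdd C j)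
    (hi : ExtendsAdd C i) : ExtendsAdd C (j ∘ₗ i) := fun F hF g => by
  obtain ⟨k, rfl⟩ := hi F hF g
  obtain ⟨l, rfl⟩ := hj F hF k
  exact ⟨l, rfl⟩

theorem ExtendsAdd.congr_left {i : X →ₗ[R] Y} (hi : ExtendsAdd C i) (e : Z ≃ₗ[R] X) :
    ExtendsAdd C (i ∘ₗ e.toLinearMap) := fun F hF g => by
  obtain ⟨k, hk⟩ := hi F hF (g ∘ₗ e.symm.toLinearMap)
  refine ⟨k, ?_⟩
  rw [← LinearMap.comp_assoc, hk]
  ext x; simp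

theorem extendsAdd_of_retract {i : X →ₗ[R] Y} (r : Y →ₗ[R] X) (hr : r ∘ₗ i = LinearMap.id) :
    ExtendsAdd C i := fun F _ g => ⟨g ∘ₗ r, by rw [LinearMap.comp_assoc, hr, LinearMap.comp_id]⟩

theorem ExtendsAdd.finsupp {i : X →ₗ[R] Y} (hi : ExtendsAdd C i) (I : Type u) :
    ExtendsAdd C (Finsupp.mapRange.linearMap (α := I) i) := fun F hF g => by
  have := fun a => hi F hF (g ∘ₗ Finsupp.lsingle a)
  choose k hk using this
  refine ⟨Finsupp.lsum ℕ k, ?_⟩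
  ext a x
  have := LinearMap.congr_fun (hk a) x
  simpa using this

theorem Perp.extendsAdd {i : X →ₗ[R] Y} {p : Y →ₗ[R] Z} (hZ : Perp R C Z) (h : IsSES i p) :
    ExtendsAdd C i := fun F hF g => (hZ F hF 0).extend h g

theorem Perp.mid {i : X →ₗ[R] Y} {p : Y →ₗ[R] Z} (h : IsSES i p) (hX : Perp R C X)
    (hZ : Perp R C Z) : Perp R C Y := fun F hF n => ExtZero.mid h (hX F hF n) (hZ F hF n)

theorem Perp.left {i : X →ₗ[R] Y} {p : Y →ₗ[R] Z} (h : IsSES i p) (hY : Perp R C Y)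
    (hZ : Perp R C Z) : Perp R C X := fun F hF n => ExtZero.left h (hY F hF n) (hZ F hF (n + 1))

/-- Degrees at least two shift to X; only degree one needs the extension property of i. -/
theorem Perp.right {i : X →ₗ[R] Y} {p : Y →ₗ[R] Z} (h : IsSES i p) (hX : Perp R C X)
    (hY : Perp R C Y) (hi : ExtendsAdd C i) : Perp R C Z := fun F hF n => by
  cases n with
  | zero => exact ExtZero.of_extend h (hi F hF) (hY F hF 0)
  | succ n => exact ExtZero.right h (hX F hF n) (hY F hF (n + 1))

theorem Perp.congr (h : Perp R C X) (e : X ≃ₗ[R] Y) : Perp R C Y := fun F hF n =>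
  (h F hF n).retract_left e.symm.toLinearMap e.toLinearMap (by ext; simp)

theorem perp_of_projective [Module.Projective R X] : Perp R C X :=
  fun _ _ n => extZero_of_projective n

theorem HasAddStep.mono {K L : ModuleCat.{u} R → Prop} (hKL : ∀ X, K X → L X)
    (h : HasAddStep C K X) : HasAddStep C L X := by
  obtain ⟨A, N, i, p, hA, hs, hi, hN⟩ := h
  exact ⟨A, N, i, p, hA, hs, hi, hKL _ hN⟩

theorem HasAddStep.congr {K : ModuleCat.{u} R → Prop} (h : HasAddStep C K X) (e : Y ≃ₗ[R] X) :
    HasAddStep C K Y := by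
  obtain ⟨A, N, i, p, hA, hs, hi, hN⟩ := h
  exact ⟨A, N, i ∘ₗ e.toLinearMap, p, hA, hs.congr_left e, hi.congr_left e, hN⟩

theorem Cores.hasAddStep (h : Cores R C X) : HasAddStep C (fun N : ModuleCat.{u} R => Cores R C N) X := by
  obtain ⟨K, hX, hK⟩ := h
  exact (hK _ hX).mono fun N hN => ⟨K, hN, hK⟩

/-- Together with `Cores.hasAddStep` this makes `Cores` a fixed point of `HasAddStep`: modules one
step away from `Cores` again form an admissible class. -/
theorem HasAddStep.cores (h : HasAddStep C (fun N : ModuleCat.{u} R => Cores R C N) X) : Cores R C X :=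
  ⟨fun X : ModuleCat.{u} R => HasAddStep C (fun N : ModuleCat.{u} R => Cores R C N) X, h, fun _ hY => hY.mono fun _ => Cores.hasAddStep⟩

theorem Cores.congr (h : Cores R C X) (e : Y ≃ₗ[R] X) : Cores R C Y :=
  (h.hasAddStep.congr e).cores

/-- The class of `Hom_R(-, Add_R(C))`-exact extensions of modules having coresolutions. -/
def CoresExtension (C : Type u) [AddCommGroup C] [Module R C] (E : ModuleCat.{u} R) : Prop :=
  ∃ (M N : ModuleCat.{u} R) (i : M →ₗ[R] E) (p : E →ₗ[R] N),
    IsSES i p ∧ ExtendsAdd C i ∧ Cores R C M ∧ Cores R C N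

theorem CoresExtension.hasAddStep {E : ModuleCat.{u} R} (h : CoresExtension C E) :
    HasAddStep C (CoresExtension (R := R) C) E := by
  obtain ⟨M, N, i, p, hs, hi, hM, hN⟩ := h
  obtain ⟨A₁, M', j₁, q₁, hA₁, hs₁, hj₁, hM'⟩ := hM.hasAddStep
  obtain ⟨A₂, N', j₂, q₂, hA₂, hs₂, hj₂, hN'⟩ := hN.hasAddStep
  obtain ⟨e, he⟩ := hi A₁ hA₁ j₁
  obtain ⟨E', q, i', p', hq, hs', hi', hp'⟩ := hs.cokernel_extension hs₁ hs₂ e he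
  have hiE : ∀ m, e (i m) = j₁ m := LinearMap.congr_fun he
  refine ⟨ModuleCat.of R (A₁ × A₂), E', e.prod (j₂ ∘ₗ p), q, hA₁.prod hA₂, hq, ?_,
    ModuleCat.of R M', ModuleCat.of R N', i', p', hs', ?_, hM', hN'⟩
  · intro F hF g
    -- The restriction of `g` to M is extended over A₁; the remaining error vanishes on M, so it
    -- descends to N and extends over A₂.
    obtain ⟨k, hk⟩ := hj₁ F hF (g ∘ₗ i)
    obtain ⟨l, hl⟩ := hs.desc (g - k ∘ₗ e) (by
      rw [LinearMap.sub_comp, LinearMap.comp_assoc, he, hk, sub_self])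
    obtain ⟨m, hm⟩ := hj₂ F hF l
    refine ⟨k.coprod m, ?_⟩
    ext x
    have h1 := LinearMap.congr_fun hl x
    have h2 := LinearMap.congr_fun hm (p x)
    simp only [LinearMap.comp_apply, LinearMap.sub_apply] at h1 h2
    simp [h2, h1]
  · intro F hF g
    have hk : ∀ m, (g ∘ₗ q₁) (j₁ m) = 0 := fun m => by simp [hs₁.apply_apply]
    obtain ⟨l, hl⟩ := hs.desc (g ∘ₗ q₁ ∘ₗ e) (by
      ext m; simpa [hiE] using hk m)
    obtain ⟨m, hm⟩ := hj₂ F hF l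
    -- The component `-m` cancels `g ∘ₗ q₁ ∘ₗ e` on the embedded copy of E, so the map descends to
    -- the cokernel E'.
    obtain ⟨n, hn⟩ := hq.desc ((g ∘ₗ q₁).coprod (-m)) (by
      ext x
      have h1 := LinearMap.congr_fun hl x
      have h2 := LinearMap.congr_fun hm (p x)
      simp only [LinearMap.comp_apply] at h1 h2
      simp [h2, h1])
    refine ⟨n, ?_⟩
    ext y
    obtain ⟨a, rfl⟩ := hs₁.surj y
    have h1 := LinearMap.congr_fun hi' a
    have h2 := LinearMap.congr_fun hn (a, 0)
    simp only [LinearMap.comp_apply, LinearMap.inl_apply] at h1 h2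
    rw [LinearMap.comp_apply, h1, h2]
    simp [LinearMap.coprod_apply]

/-- A dual horseshoe lemma, proved coinductively: one step on an extension leaves an extension of
the two cokernels, again Hom(-, Add(C))-exact. -/
theorem Cores.extension {i : X →ₗ[R] Y} {p : Y →ₗ[R] Z} (h : IsSES i p) (hi : ExtendsAdd C i)
    (hX : Cores R C X) (hZ : Cores R C Z) : Cores R C Y :=
  ⟨CoresExtension (R := R) C, ⟨ModuleCat.of R X, ModuleCat.of R Z, i, p, h, hi, hX, hZ⟩,
    fun _ hE => hE.hasAddStep⟩

theorem cores_of_isAdd (h : IsAdd R C X) : Cores R C X := by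
  refine ⟨fun M : ModuleCat.{u} R => IsAdd R C M, h, fun M hM => ⟨M, ModuleCat.of R PUnit, LinearMap.id, 0, hM,
    ⟨Function.injective_id, fun y => by simp, fun y => ⟨0, Subsingleton.elim _ _⟩⟩,
    extendsAdd_of_retract LinearMap.id rfl, isAdd_of_subsingleton (M := PUnit)⟩⟩

theorem Cores.prod (hX : Cores R C X) (hY : Cores R C Y) : Cores R C (X × Y) :=
  Cores.extension isSES_prod (extendsAdd_of_retract (LinearMap.fst R X Y) (by ext; simp)) hX hY

theorem Cores.finsupp (h : Cores R C X) (I : Type u) : Cores R C (I →₀ X) := by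
  refine ⟨fun N => ∃ M : ModuleCat.{u} R, Cores R C M ∧ Nonempty (N ≃ₗ[R] (I →₀ M)),
    ⟨ModuleCat.of R X, h, ⟨LinearEquiv.refl R (I →₀ X)⟩⟩, ?_⟩
  rintro N ⟨M, hM, ⟨e⟩⟩
  obtain ⟨A, L, i, p, hA, hs, hi, hL⟩ := hM.hasAddStep
  refine HasAddStep.congr (X := I →₀ M) ?_ e
  exact ⟨ModuleCat.of R (I →₀ A), ModuleCat.of R (I →₀ L), Finsupp.mapRange.linearMap i,
    Finsupp.mapRange.linearMap p, hA.finsupp I, hs.finsupp I, hi.finsupp I, L, hL,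
    ⟨LinearEquiv.refl R (I →₀ L)⟩⟩

/-- For submodules embedded in a common module with cokernel, the comparison sequence
`0 → Y → A/X → A/(X ⊕ Y) → 0`. -/
theorem IsSES.quotient_step {A L M' : Type u} [AddCommGroup A] [Module R A] [AddCommGroup L]
    [Module R L] [AddCommGroup M'] [Module R M'] {i : X × Y →ₗ[R] A} {p : A →ₗ[R] L}
    (h : IsSES i p) {q : A →ₗ[R] M'} (hq : IsSES (i ∘ₗ LinearMap.inl R X Y) q)
    (hi : ExtendsAdd C i) :
    ∃ p' : M' →ₗ[R] L, IsSES (q ∘ₗ i ∘ₗ LinearMap.inr R X Y) p' ∧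
      ExtendsAdd C (q ∘ₗ i ∘ₗ LinearMap.inr R X Y) := by
  obtain ⟨p', hp'⟩ := hq.desc p (by rw [← LinearMap.comp_assoc, h.comp_eq_zero]; rfl)
  have hp1 : ∀ a, p' (q a) = p a := LinearMap.congr_fun hp'
  refine ⟨p', ⟨?_, ?_, ?_⟩, ?_⟩
  · rw [injective_iff_map_eq_zero]
    intro y hy
    obtain ⟨x, hx⟩ := (hq.exact _).1 hy
    have := h.inj (show i (x, 0) = i (0, y) from hx)
    exact (congrArg Prod.snd this).symm
  · intro m
    obtain ⟨a, rfl⟩ := hq.surj m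
    rw [hp1, h.exact a]
    constructor
    · rintro ⟨⟨x, y⟩, rfl⟩
      refine ⟨y, ?_⟩
      have : ((x, y) : X × Y) = (x, 0) + (0, y) := by simp
      rw [this, map_add, map_add]
      have := hq.apply_apply x
      simp only [LinearMap.comp_apply, LinearMap.inl_apply] at this
      simp [this]
    · rintro ⟨y, hy⟩
      have : q (a - i (0, y)) = 0 := by
        rw [map_sub, sub_eq_zero]; exact hy.symm
      obtain ⟨x, hx⟩ := (hq.exact _).1 this
      refine ⟨(x, y), ?_⟩
      have h2 : ((x, y) : X × Y) = (x, 0) + (0, y) := by simp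
      rw [h2, map_add]
      exact (sub_eq_iff_eq_add.1 hx.symm).symm
  · intro l
    obtain ⟨a, rfl⟩ := h.surj l
    exact ⟨q a, hp1 a⟩
  · intro F hF g
    obtain ⟨k, hk⟩ := hi F hF (g ∘ₗ LinearMap.snd R X Y)
    have hk1 : ∀ z, k (i z) = g z.2 := LinearMap.congr_fun hk
    obtain ⟨l, hl⟩ := hq.desc k (by ext x; simp [hk1])
    have hl1 : ∀ a, l (q a) = k a := LinearMap.congr_fun hl
    exact ⟨l, by ext y; simp [hl1, hk1]⟩

theorem IsSES.prodMap {X' Y' Z' : Type u} [AddCommGroup X'] [Module R X']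
    [AddCommGroup Y'] [Module R Y'] [AddCommGroup Z'] [Module R Z']
    {i : X →ₗ[R] Y} {p : Y →ₗ[R] Z} {i' : X' →ₗ[R] Y'} {p' : Y' →ₗ[R] Z'}
    (h : IsSES i p) (h' : IsSES i' p') : IsSES (i.prodMap i') (p.prodMap p') := by
  refine ⟨h.inj.prodMap h'.inj, fun y => ?_, h.surj.prodMap h'.surj⟩
  have := h.exact y.1
  have := h'.exact y.2
  simp_all [Prod.ext_iff, Set.mem_range]

theorem ExtendsAdd.prodMap {X' Y' : Type u} [AddCommGroup X'] [Module R X']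
    [AddCommGroup Y'] [Module R Y'] {i : X →ₗ[R] Y} {i' : X' →ₗ[R] Y'}
    (h : ExtendsAdd C i) (h' : ExtendsAdd C i') : ExtendsAdd C (i.prodMap i') := fun F hF g => by
  obtain ⟨k, hk⟩ := h F hF (g ∘ₗ LinearMap.inl R X X')
  obtain ⟨l, hl⟩ := h' F hF (g ∘ₗ LinearMap.inr R X X')
  have hk1 : ∀ z, k (i z) = g (z, 0) := LinearMap.congr_fun hk
  have hl1 : ∀ z, l (i' z) = g (0, z) := LinearMap.congr_fun hl
  exact ⟨k.coprod l, by ext z <;> simp [hk1, hl1]⟩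

/-- The class of direct summands of modules in `Cores` is itself admissible. Given 0 → M ⊕ N → A → L
→ 0, embed M in A; the cokernel A/M is a summand of A/M ⊕ A/N, which is an extension of L ⊕ L by N ⊕
M and so lies in `Cores`. -/
theorem Cores.of_prod (h : Cores R C (X × Y)) : Cores R C X := by
  refine ⟨fun M => ∃ N : ModuleCat.{u} R, Cores R C (M × N), ⟨ModuleCat.of R Y, h⟩, ?_⟩
  rintro M ⟨N, hMN⟩
  have hNM : Cores R C (N × M) := hMN.congr (LinearEquiv.prodComm R N M)
  obtain ⟨A, L, i, p, hA, hs, hi, hL⟩ := hMN.hasAddStep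
  have hs' := hs.congr_left (LinearEquiv.prodComm R N M)
  have hi' := hi.congr_left (LinearEquiv.prodComm R N M)
  set i₂ := i ∘ₗ (LinearEquiv.prodComm R N M).toLinearMap
  have hq := isSES_mkQ (i := i ∘ₗ LinearMap.inl R M N) (hs.inj.comp (LinearMap.inl_injective (R := R) (M := M) (M₂ := N)))
  have hq' := isSES_mkQ (i := i₂ ∘ₗ LinearMap.inl R N M) (hs'.inj.comp (LinearMap.inl_injective (R := R) (M := N) (M₂ := M)))
  obtain ⟨p₁, hp₁, he₁⟩ := IsSES.quotient_step hs hq hi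
  obtain ⟨p₂, hp₂, he₂⟩ := IsSES.quotient_step hs' hq' hi'
  refine ⟨A, ModuleCat.of R (A ⧸ LinearMap.range (i ∘ₗ LinearMap.inl R M N)), i ∘ₗ LinearMap.inl R M N, _, hA, hq,
    hi.comp (extendsAdd_of_retract (LinearMap.fst R M N) (by ext; simp)),
    ModuleCat.of R (A ⧸ LinearMap.range (i₂ ∘ₗ LinearMap.inl R N M)), ?_⟩
  exact Cores.extension (hp₁.prodMap hp₂) (he₁.prodMap he₂) hNM (hL.prod hL)

end

end Classes

/-! ### G_C-projective modules and their closure properties -/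

section GProj

variable {R : Type u} [Ring R] {C : Type u} [AddCommGroup C] [Module R C]
  {X Y Z : Type u} [AddCommGroup X] [Module R X] [AddCommGroup Y] [Module R Y]
  [AddCommGroup Z] [Module R Z]

theorem LinSeq.isSES_range {S : LinSeq R} (hS : S.IsExact) (m : ℤ) :
    IsSES (LinearMap.range (S.d m)).subtype (S.d (m + 1)).rangeRestrict :=
  ⟨Subtype.val_injective, fun y => by
    simpa [Subtype.ext_iff] using hS m y, LinearMap.surjective_rangeRestrict _⟩

/-- A map on an image pulls back to a cocycle of the Hom sequence; writing it as a coboundary gives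
the extension. -/
theorem LinSeq.extendsAdd_range {S : LinSeq R} (hS : S.IsExact) (hH : S.IsHomAddExact C) (m : ℤ) :
    ExtendsAdd C (LinearMap.range (S.d (m + 1))).subtype := fun F hF g => by
  obtain ⟨k, hk⟩ := (hH F hF m (g ∘ₗ (S.d (m + 1)).rangeRestrict)).1 (by
    ext x
    have : (S.d (m + 1)).rangeRestrict (S.d m x) = 0 :=
      Subtype.ext ((hS m).apply_apply_eq_zero x)
    simp [this])
  refine ⟨k, ?_⟩
  ext ⟨_, ⟨x, rfl⟩⟩
  exact LinearMap.congr_fun hk x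

theorem IsGProj.cores (h : IsGProj R C X) : Cores R C X := by
  obtain ⟨S, hP, hS, hH, he⟩ := h
  have key : ∀ k : ℤ, k = -1 → Nonempty (X ≃ₗ[R] LinearMap.range (S.d k)) := by
    rintro _ rfl; exact he
  -- Images are indexed by `m + 1` because the extension property uses exactness one place further
  -- left; `-2` gives the image isomorphic to X.
  refine ⟨fun M => ∃ m : ℤ, -1 ≤ m + 1 ∧ Nonempty (M ≃ₗ[R] LinearMap.range (S.d (m + 1))),
    ⟨-2, by norm_num, key _ (by norm_num)⟩, ?_⟩
  rintro M ⟨m, hm, ⟨e⟩⟩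
  refine HasAddStep.congr ?_ e
  exact ⟨S.X (m + 1 + 1), ModuleCat.of R (LinearMap.range (S.d (m + 1 + 1))), _, _,
    hP.2 _ (by omega), S.isSES_range hS (m + 1), S.extendsAdd_range hS hH m,
    m + 1, by omega, ⟨LinearEquiv.refl R (LinearMap.range (S.d (m + 1 + 1)))⟩⟩

/-- Ext shifts to the left through the projective terms until degree one, where the extension
property applies. -/
theorem LinSeq.extZero_range {S : LinSeq R} (hP : S.IsProjAdd C) (hS : S.IsExact)
    (hH : S.IsHomAddExact C) (F : ModuleCat.{u} R) (hF : IsAdd R C F) (n : ℕ) :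
    ∀ m : ℤ, m + 1 + 1 < 0 → ExtZero R (LinearMap.range (S.d (m + 1 + 1))) F (n + 1) := by
  induction n with
  | zero =>
    intro m hm
    have := hP.1 _ hm
    exact ExtZero.of_extend (S.isSES_range hS (m + 1)) (S.extendsAdd_range hS hH m F hF)
      (extZero_of_projective (X := S.X (m + 1 + 1)) 0)
  | succ n ih =>
    intro m hm
    have := hP.1 _ hm
    obtain ⟨l, rfl⟩ : ∃ l, m = l + 1 := ⟨m - 1, by ring⟩
    exact ExtZero.right (S.isSES_range hS (l + 1 + 1)) (ih l (by omega))
      (extZero_of_projective (X := S.X (l + 1 + 1 + 1)) _)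

theorem IsGProj.perp (h : IsGProj R C X) : Perp R C X := by
  obtain ⟨S, hP, hS, hH, he⟩ := h
  have key : ∀ k : ℤ, k = -1 → Nonempty (X ≃ₗ[R] LinearMap.range (S.d k)) := by
    rintro _ rfl; exact he
  obtain ⟨e⟩ := key (-3 + 1 + 1) (by norm_num)
  intro F hF n
  exact (S.extZero_range hP hS hH F hF n (-3) (by norm_num)).retract_left
    e.toLinearMap e.symm.toLinearMap (by ext; simp)

/-- The canonical free cover of a module. -/
noncomputable def freeCover (M : ModuleCat.{u} R) : ModuleCat.of R (M →₀ R) →ₗ[R] M :=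
  Finsupp.linearCombination R (id : M → M)

/-- The `n`-th syzygy of `M` in its canonical free resolution. -/
noncomputable def syzygy (M : ModuleCat.{u} R) : ℕ → ModuleCat.{u} R
  | 0 => M
  | n + 1 => ModuleCat.of R (LinearMap.ker (freeCover (syzygy M n)))

/-- The inclusion of a syzygy in the previous free module. -/
noncomputable def syzygyIncl (M : ModuleCat.{u} R) (n : ℕ) :
    syzygy M (n + 1) →ₗ[R] ModuleCat.of R (syzygy M n →₀ R) :=
  (LinearMap.ker (freeCover (syzygy M n))).subtype

theorem syzygy_isSES (M : ModuleCat.{u} R) (n : ℕ) :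
    IsSES (syzygyIncl M n) (freeCover (syzygy M n)) :=
  isSES_ker (Finsupp.linearCombination_id_surjective R _)

theorem Perp.syzygy {M : ModuleCat.{u} R} (h : Perp R C M) (n : ℕ) :
    Perp R C (syzygy M n) := by
  induction n with
  | zero => exact h
  | succ n ih =>
    exact Perp.left (syzygy_isSES M n)
      (perp_of_projective (X := RelGor.syzygy M n →₀ R)) ih

theorem Cores.exists_sequence (h : Cores R C X) :
    ∃ (A N : ℕ → ModuleCat.{u} R) (i : ∀ n, N n →ₗ[R] A n) (p : ∀ n, A n →ₗ[R] N (n + 1)),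
      Nonempty (X ≃ₗ[R] N 0) ∧ ∀ n, IsAdd R C (A n) ∧ IsSES (i n) (p n) ∧ ExtendsAdd C (i n) := by
  have h' := fun M : {M : ModuleCat.{u} R // Cores R C M} => M.2.hasAddStep
  choose A N i p hA hs hi hN using h'
  let N' : ℕ → {M : ModuleCat.{u} R // Cores R C M} := fun n =>
    Nat.rec ⟨ModuleCat.of R X, h⟩ (fun _ M => ⟨N M, hN M⟩) n
  exact ⟨fun n => A (N' n), fun n => (N' n).1, fun n => i (N' n), fun n => p (N' n),
    ⟨LinearEquiv.refl R X⟩, fun n => ⟨hA _, hs _, hi _⟩⟩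

/-- The sequence obtained by splicing short exact sequences `0 → K n → X n → K (n + 1) → 0`. -/
def LinSeq.splice (K X : ℤ → ModuleCat.{u} R) (i : ∀ n, K n →ₗ[R] X n)
    (p : ∀ n, X n →ₗ[R] K (n + 1)) : LinSeq R where
  X := X
  d n := i (n + 1) ∘ₗ p n

section Splice

variable {K X : ℤ → ModuleCat.{u} R} {i : ∀ n, K n →ₗ[R] X n} {p : ∀ n, X n →ₗ[R] K (n + 1)}

theorem LinSeq.splice_isExact (h : ∀ n, IsSES (i n) (p n)) : (LinSeq.splice K X i p).IsExact := by
  intro n y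
  change i (n + 1 + 1) (p (n + 1) y) = 0 ↔ ∃ x, i (n + 1) (p n x) = y
  rw [(injective_iff_map_eq_zero' _).1 (h (n + 1 + 1)).inj, (h (n + 1)).exact y]
  constructor
  · rintro ⟨k, rfl⟩
    obtain ⟨x, rfl⟩ := (h n).surj k
    exact ⟨x, rfl⟩
  · rintro ⟨x, rfl⟩
    exact ⟨p n x, rfl⟩

theorem LinSeq.splice_isHomAddExact (h : ∀ n, IsSES (i n) (p n)) (hi : ∀ n, ExtendsAdd C (i n)) :
    (LinSeq.splice K X i p).IsHomAddExact C := by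
  intro F hF n g
  change g ∘ₗ i (n + 1) ∘ₗ p n = 0 ↔ ∃ l, l ∘ₗ i (n + 1 + 1) ∘ₗ p (n + 1) = g
  constructor
  · intro hg
    obtain ⟨k, rfl⟩ := (h (n + 1)).desc g (by
      ext x
      obtain ⟨y, rfl⟩ := (h n).surj x
      exact LinearMap.congr_fun hg y)
    obtain ⟨l, rfl⟩ := hi (n + 1 + 1) F hF k
    exact ⟨l, rfl⟩
  · rintro ⟨l, rfl⟩
    ext x
    change l (i _ (p (n + 1) (i (n + 1) (p n x)))) = 0
    rw [(h (n + 1)).apply_apply, map_zero, map_zero]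

theorem LinSeq.splice_range (h : ∀ n, IsSES (i n) (p n)) (n : ℤ) :
    Nonempty (K (n + 1) ≃ₗ[R] LinearMap.range ((LinSeq.splice K X i p).d n)) := by
  have : LinearMap.range ((LinSeq.splice K X i p).d n) = LinearMap.range (i (n + 1)) := by
    change LinearMap.range (i (n + 1) ∘ₗ p n) = _
    rw [LinearMap.range_comp, LinearMap.range_eq_top.2 (h n).surj, Submodule.map_top]
  rw [this]
  exact ⟨LinearEquiv.ofInjective _ (h (n + 1)).inj⟩

end Splice

/-- A free resolution is spliced to the coresolution. Syzygies of a `Perp` module are `Perp`, which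
makes the left half Hom(-, Add(C))-exact. -/
theorem isGProj_of_perp_of_cores (hp : Perp R C X) (hc : Cores R C X) : IsGProj R C X := by
  obtain ⟨A, N, i, p, ⟨e⟩, hN⟩ := hc.exists_sequence
  let M := ModuleCat.of R X
  have hM := fun n => Perp.syzygy (M := M) hp n
  -- `K n` is the kernel in degree `n`: `negSucc n` is degree `-(n + 1)`, hence the syzygy `n + 1`.
  -- At degree `-1` the cover of X is followed by `e` to land in `N 0`.
  let K : ℤ → ModuleCat.{u} R := fun
    | .ofNat n => N n
    | .negSucc n => syzygy M (n + 1)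
  let Y : ℤ → ModuleCat.{u} R := fun
    | .ofNat n => A n
    | .negSucc n => ModuleCat.of R (syzygy M n →₀ R)
  let j : ∀ n, K n →ₗ[R] Y n := fun
    | .ofNat n => i n
    | .negSucc n => syzygyIncl M n
  let q : ∀ n, Y n →ₗ[R] K (n + 1) := fun
    | .ofNat n => p n
    | .negSucc 0 => e.toLinearMap ∘ₗ freeCover M
    | .negSucc (n + 1) => freeCover (syzygy M (n + 1))
  have hs : ∀ n, IsSES (j n) (q n) := fun
    | .ofNat n => (hN n).2.1
    | .negSucc 0 => (syzygy_isSES M 0).congr_right e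
    | .negSucc (n + 1) => syzygy_isSES M (n + 1)
  have hj : ∀ n, ExtendsAdd C (j n) := fun
    | .ofNat n => (hN n).2.2
    | .negSucc n => (hM n).extendsAdd (syzygy_isSES M n)
  obtain ⟨e'⟩ := LinSeq.splice_range hs (-1)
  refine ⟨LinSeq.splice K Y j q, ⟨?_, ?_⟩, LinSeq.splice_isExact hs,
    LinSeq.splice_isHomAddExact hs hj, ⟨e.trans e'⟩⟩
  · rintro (n | n) hn
    · exact absurd hn (by simp)
    · exact inferInstanceAs (Module.Projective R (syzygy M n →₀ R))
  · rintro (n | n) hn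
    · exact (hN n).1
    · exact absurd hn (by simp)

theorem IsGProj.congr (h : IsGProj R C X) (e : X ≃ₗ[R] Y) : IsGProj R C Y :=
  isGProj_of_perp_of_cores (h.perp.congr e) (h.cores.congr e.symm)

theorem isGProj_of_subsingleton [Subsingleton X] : IsGProj R C X := by
  have : Module.Projective R X := Module.Projective.of_free
  exact isGProj_of_perp_of_cores perp_of_projective (cores_of_isAdd isAdd_of_subsingleton)

theorem IsGProj.mid {i : X →ₗ[R] Y} {p : Y →ₗ[R] Z} (h : IsSES i p) (hX : IsGProj R C X)
    (hZ : IsGProj R C Z) : IsGProj R C Y :=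
  isGProj_of_perp_of_cores (hX.perp.mid h hZ.perp)
    (Cores.extension h (hZ.perp.extendsAdd h) hX.cores hZ.cores)

theorem IsWTilting.perp_of_isAdd (hC : IsWTilting R C) (hX : IsAdd R C X) : Perp R C X := by
  intro F hF n
  obtain ⟨I, i, r, hr⟩ := isAdd_iff_retract.1 hF
  obtain ⟨J, j, s, hs⟩ := isAdd_iff_retract.1 hX
  have h1 : ExtZero R (J →₀ C) (I →₀ C) (n + 1) :=
    ExtZero.finsupp J n C fun k _ => hC.ext_eq_zero I (k + 1) (by omega)
  exact (h1.retract_left j s hs).retract_right i r hr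

/-- The kernels of the coresolution form an admissible class, with R identified with the kernel of
`d 0`. -/
theorem IsWTilting.cores_ring (hC : IsWTilting R C) : Cores R C R := by
  obtain ⟨A, ε, d, hA, ⟨hε, hε0, hd⟩, hF⟩ := hC.exists_coresolution
  have hker : ∀ n (x : A n), d (n + 1) (d n x) = 0 := fun n => (hd n).apply_apply_eq_zero
  let e : R ≃ₗ[R] LinearMap.ker (d 0) := LinearEquiv.ofBijective
    (ε.codRestrict (LinearMap.ker (d 0)) hε0.apply_apply_eq_zero)
    ⟨fun x y h => hε (congrArg Subtype.val h), fun ⟨y, hy⟩ => by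
      obtain ⟨x, rfl⟩ := (hε0 y).1 hy
      exact ⟨x, rfl⟩⟩
  refine ⟨fun M => ∃ n, Nonempty (M ≃ₗ[R] LinearMap.ker (d n)), ⟨0, ⟨e⟩⟩, ?_⟩
  rintro M ⟨n, ⟨f⟩⟩
  refine HasAddStep.congr ?_ f
  refine ⟨A n, ModuleCat.of R (LinearMap.ker (d (n + 1))), (LinearMap.ker (d n)).subtype,
    (d n).codRestrict (LinearMap.ker (d (n + 1))) (hker n), hA n,
    ⟨Subtype.val_injective, fun y => ?_, fun ⟨y, hy⟩ => ?_⟩, ?_,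
    n + 1, ⟨LinearEquiv.refl R (LinearMap.ker (d (n + 1)))⟩⟩
  · refine ⟨fun hy => ⟨⟨y, congrArg Subtype.val hy⟩, rfl⟩, ?_⟩
    rintro ⟨⟨y, hy⟩, rfl⟩
    exact Subtype.ext hy
  · obtain ⟨x, rfl⟩ := (hd n y).1 hy
    exact ⟨x, rfl⟩
  · intro F hFA g
    obtain ⟨h0, h1, h2⟩ := hF F hFA
    rcases n with _ | n
    · obtain ⟨k, hk⟩ := h0 (g ∘ₗ e.toLinearMap)
      refine ⟨k, ?_⟩
      ext x
      obtain ⟨y, rfl⟩ := e.surjective x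
      exact LinearMap.congr_fun hk y
    -- The kernel of `d (n + 1)` is the image of `d n`, so `g` pulls back to a cocycle on `A n`. The
    -- preceding map is `ε` when `n = 0`, hence the case split.
    · have key : ∃ k : A (n + 1) →ₗ[R] F, k ∘ₗ d n =
          g ∘ₗ (d n).codRestrict (LinearMap.ker (d (n + 1))) (hker n) := by
        rcases n with _ | n
        · refine (h1 _).1 ?_
          ext
          have : (d 0).codRestrict (LinearMap.ker (d 1)) (hker 0) (ε 1) = 0 :=
            Subtype.ext (hε0.apply_apply_eq_zero _)
          simp [this]
        · refine (h2 n _).1 ?_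
          ext x
          have : (d (n + 1)).codRestrict (LinearMap.ker (d (n + 1 + 1))) (hker _) (d n x) = 0 :=
            Subtype.ext (hker n x)
          simp [this]
      obtain ⟨k, hk⟩ := key
      refine ⟨k, ?_⟩
      ext ⟨y, hy⟩
      obtain ⟨x, rfl⟩ := (hd n y).1 hy
      exact LinearMap.congr_fun hk x

/-- Coresolving R coresolves every free module, and `Cores` passes to direct summands. -/
theorem IsWTilting.isGProj_of_projective (hC : IsWTilting R C) [Module.Projective R X] :
    IsGProj R C X := by
  refine isGProj_of_perp_of_cores perp_of_projective ?_
  obtain ⟨s, hs⟩ := (Finsupp.linearCombination R (id : X → X)).exists_rightInverse_of_surjective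
    (LinearMap.range_eq_top.2 (Finsupp.linearCombination_id_surjective R X))
  have h := isAdd_iff_retract (C := R).2 ⟨X, s, _, hs⟩
  obtain ⟨I, N, ⟨e⟩⟩ := h
  exact ((hC.cores_ring.finsupp I).congr e).of_prod

/-- Embed Y in A ∈ Add(C) with cokernel N. Then A/X is an extension of N by Z, and N is `Perp`
because w-tilting makes A so; thus A/X lies in `Cores` and X is one step away from it. -/
theorem IsWTilting.isGProj_ker (hC : IsWTilting R C) {i : X →ₗ[R] Y} {p : Y →ₗ[R] Z}
    (h : IsSES i p) (hY : IsGProj R C Y) (hZ : IsGProj R C Z) : IsGProj R C X := by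
  refine isGProj_of_perp_of_cores (hY.perp.left h hZ.perp) ?_
  obtain ⟨A, N, j, q, hA, hs, hj, hN⟩ := hY.cores.hasAddStep
  have hNp : Perp R C N := hY.perp.right hs (hC.perp_of_isAdd hA) hj
  have hij := isSES_mkQ (i := j ∘ₗ i) (hs.inj.comp h.inj)
  set r := (LinearMap.range (j ∘ₗ i)).mkQ
  obtain ⟨l, hl⟩ := h.desc (r ∘ₗ j) hij.comp_eq_zero
  obtain ⟨m, hm⟩ := hij.desc q (by rw [← LinearMap.comp_assoc, hs.comp_eq_zero]; rfl)
  have hl1 : ∀ y, l (p y) = r (j y) := LinearMap.congr_fun hl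
  have hm1 : ∀ a, m (r a) = q a := LinearMap.congr_fun hm
  have hlm : IsSES l m := by
    refine ⟨?_, ?_, ?_⟩
    · rw [injective_iff_map_eq_zero]
      intro z hz
      obtain ⟨y, rfl⟩ := h.surj z
      rw [hl1] at hz
      obtain ⟨x, hx⟩ := (hij.exact _).1 hz
      rw [← hs.inj hx, h.apply_apply]
    · intro t
      obtain ⟨a, rfl⟩ := hij.surj t
      rw [hm1]
      constructor
      · intro ha
        obtain ⟨y, rfl⟩ := (hs.exact _).1 ha
        exact ⟨p y, hl1 y⟩
      · rintro ⟨z, hz⟩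
        obtain ⟨y, rfl⟩ := h.surj z
        rw [hl1] at hz
        have := congrArg m hz
        rwa [hm1, hm1, hs.apply_apply, eq_comm] at this
    · intro n
      obtain ⟨a, rfl⟩ := hs.surj n
      exact ⟨r a, hm1 a⟩
  refine HasAddStep.cores ⟨A, ModuleCat.of R (A ⧸ LinearMap.range (j ∘ₗ i)), j ∘ₗ i, r, hA, hij,
    hj.comp (hZ.perp.extendsAdd h), ?_⟩
  exact Cores.extension hlm (hNp.extendsAdd hlm) hZ.cores hN

end GProj

/-! ### G_C-projective dimension through projective syzygies -/

section Dimension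

/-- Some `n`-th syzygy of `M`, formed with projective modules, is `G_C`-projective. -/
def DimLE (R : Type u) [Ring R] (C : Type u) [AddCommGroup C] [Module R C] :
    ℕ → ∀ (M : Type u) [AddCommGroup M] [Module R M], Prop
  | 0, M, _, _ => IsGProj R C M
  | n + 1, M, _, _ => ∃ (K P : ModuleCat.{u} R) (i : K →ₗ[R] P) (p : P →ₗ[R] M),
      Module.Projective R P ∧ IsSES i p ∧ DimLE R C n K

variable {R : Type u} [Ring R] {C : Type u} [AddCommGroup C] [Module R C]
  {X Y Z : Type u} [AddCommGroup X] [Module R X] [AddCommGroup Y] [Module R Y]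
  [AddCommGroup Z] [Module R Z]

/-- Lifting Q to Y is the only choice made, so P need not be projective. -/
theorem IsSES.horseshoe {i : X →ₗ[R] Y} {p : Y →ₗ[R] Z} (h : IsSES i p)
    {K P L Q : Type u} [AddCommGroup K] [Module R K] [AddCommGroup P] [Module R P]
    [AddCommGroup L] [Module R L] [AddCommGroup Q] [Module R Q] [Module.Projective R Q]
    {j : K →ₗ[R] P} {q : P →ₗ[R] X} (hX : IsSES j q)
    {k : L →ₗ[R] Q} {r : Q →ₗ[R] Z} (hZ : IsSES k r) :
    ∃ (N : ModuleCat.{u} R) (a : K →ₗ[R] N) (b : N →ₗ[R] L) (c : N →ₗ[R] P × Q)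
      (d : P × Q →ₗ[R] Y), IsSES a b ∧ IsSES c d := by
  obtain ⟨s, hs⟩ := Module.projective_lifting_property p r h.surj
  have hs1 : ∀ x, p (s x) = r x := LinearMap.congr_fun hs
  set d : P × Q →ₗ[R] Y := (i ∘ₗ q).coprod s with hd
  have hd1 : ∀ x y, d (x, y) = i (q x) + s y := fun x y => by simp [hd]
  have hdsurj : Function.Surjective d := fun y => by
    obtain ⟨z, hz⟩ := hZ.surj (p y)
    obtain ⟨x, hx⟩ := (h.exact (y - s z)).1 (by rw [map_sub, hs1, hz, sub_self])
    obtain ⟨w, rfl⟩ := hX.surj x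
    exact ⟨(w, z), by rw [hd1, hx]; abel⟩
  have hker : ∀ n : LinearMap.ker d, r n.1.2 = 0 := fun n => by
    have := congrArg p (show i (q n.1.1) + s n.1.2 = 0 by rw [← hd1]; exact n.2)
    rwa [map_add, h.apply_apply, zero_add, hs1, map_zero] at this
  obtain ⟨b, hb⟩ := exists_lift hZ.inj (LinearMap.snd R P Q ∘ₗ (LinearMap.ker d).subtype)
    (fun n => (hZ.exact _).1 (hker n))
  have hb1 : ∀ n : LinearMap.ker d, k (b n) = n.1.2 := LinearMap.congr_fun hb
  refine ⟨ModuleCat.of R (LinearMap.ker d),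
    (LinearMap.inl R P Q ∘ₗ j).codRestrict (LinearMap.ker d)
      (fun x => by simp [hd, hX.apply_apply]), b, _, d, ⟨?_, ?_, ?_⟩, isSES_ker hdsurj⟩
  · intro x y hxy
    exact hX.inj (congrArg (fun n => n.1.1) hxy)
  · intro n
    rw [← (injective_iff_map_eq_zero' _).1 hZ.inj, hb1]
    constructor
    · intro hn
      have h0 : i (q n.1.1) = 0 := by
        have := hd1 n.1.1 n.1.2
        rw [hn, map_zero, add_zero] at this
        rw [← this, ← hn]
        exact n.2
      obtain ⟨x, hx⟩ := (hX.exact _).1 ((injective_iff_map_eq_zero _).1 h.inj _ h0)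
      exact ⟨x, Subtype.ext (Prod.ext hx hn.symm)⟩
    · rintro ⟨x, rfl⟩
      rfl
  · intro l
    obtain ⟨x, hx⟩ := (h.exact (s (k l))).1 (by rw [hs1, hZ.apply_apply])
    obtain ⟨w, rfl⟩ := hX.surj x
    refine ⟨⟨(-w, k l), ?_⟩, hZ.inj ?_⟩
    · rw [LinearMap.mem_ker, hd1, map_neg, map_neg, hx, neg_add_cancel]
    · rw [hb1]

/-- On the kernel of p ∘ q the map q lands in X, with kernel K. This turns a syzygy of Y into a
syzygy of Z. -/
theorem IsSES.ker_comp {i : X →ₗ[R] Y} {p : Y →ₗ[R] Z} (h : IsSES i p)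
    {K P : Type u} [AddCommGroup K] [Module R K] [AddCommGroup P] [Module R P]
    {j : K →ₗ[R] P} {q : P →ₗ[R] Y} (hY : IsSES j q) :
    ∃ (N : ModuleCat.{u} R) (a : K →ₗ[R] N) (b : N →ₗ[R] X) (c : N →ₗ[R] P),
      IsSES a b ∧ IsSES c (p ∘ₗ q) := by
  obtain ⟨b, hb⟩ := exists_lift h.inj (q ∘ₗ (LinearMap.ker (p ∘ₗ q)).subtype)
    (fun n => (h.exact _).1 n.2)
  have hb1 : ∀ n : LinearMap.ker (p ∘ₗ q), i (b n) = q n.1 := LinearMap.congr_fun hb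
  refine ⟨ModuleCat.of R (LinearMap.ker (p ∘ₗ q)),
    j.codRestrict (LinearMap.ker (p ∘ₗ q)) (fun x => by simp [hY.apply_apply]), b, _,
    ⟨fun x y hxy => hY.inj (congrArg Subtype.val hxy), fun n => ?_, fun x => ?_⟩,
    isSES_ker (h.surj.comp hY.surj)⟩
  · rw [← (injective_iff_map_eq_zero' _).1 h.inj, hb1, hY.exact n.1]
    constructor
    · rintro ⟨x, hx⟩
      exact ⟨x, Subtype.ext hx⟩
    · rintro ⟨x, rfl⟩
      exact ⟨x, rfl⟩
  · obtain ⟨w, hw⟩ := hY.surj (i x)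
    refine ⟨⟨w, ?_⟩, h.inj ?_⟩
    · simp [hw, h.apply_apply]
    · rw [hb1, hw]

theorem DimLE.congr {n : ℕ} (h : DimLE R C n X) (e : X ≃ₗ[R] Y) : DimLE R C n Y := by
  cases n with
  | zero => exact IsGProj.congr h e
  | succ n =>
    obtain ⟨K, P, i, p, hP, hs, hK⟩ := h
    exact ⟨K, P, i, e.toLinearMap ∘ₗ p, hP, hs.congr_right e, hK⟩

theorem DimLE.mid {n : ℕ} : ∀ {X Y Z : Type u} [AddCommGroup X] [Module R X] [AddCommGroup Y]
    [Module R Y] [AddCommGroup Z] [Module R Z] {i : X →ₗ[R] Y} {p : Y →ₗ[R] Z}, IsSES i p →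
    DimLE R C n X → DimLE R C n Z → DimLE R C n Y := by
  induction n with
  | zero => intro X Y Z _ _ _ _ _ _ i p h hX hZ; exact IsGProj.mid h hX hZ
  | succ n ih =>
    intro X Y Z _ _ _ _ _ _ i p h hX hZ
    obtain ⟨K, P, j, q, hP, hs, hK⟩ := hX
    obtain ⟨L, Q, k, r, hQ, ht, hL⟩ := hZ
    obtain ⟨N, a, b, c, d, hab, hcd⟩ := h.horseshoe hs ht
    exact ⟨N, ModuleCat.of R (P × Q), c, d, inferInstanceAs (Module.Projective R (P × Q)), hcd,
      ih hab hK hL⟩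

/-- A syzygy of Z is an extension of X by a syzygy of Y; both ends have dimension at most n. -/
theorem DimLE.right {n : ℕ} {i : X →ₗ[R] Y} {p : Y →ₗ[R] Z} (h : IsSES i p)
    (hX : DimLE R C n X) (hY : DimLE R C (n + 1) Y) : DimLE R C (n + 1) Z := by
  obtain ⟨K, P, j, q, hP, hs, hK⟩ := hY
  obtain ⟨N, a, b, c, hab, hc⟩ := h.ker_comp hs
  exact ⟨N, P, c, _, hP, hc, DimLE.mid hab hK hX⟩

theorem DimLE.succ (hC : IsWTilting R C) {n : ℕ} : ∀ {X : Type u} [AddCommGroup X] [Module R X],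
    DimLE R C n X → DimLE R C (n + 1) X := by
  induction n with
  | zero =>
    intro X _ _ h
    obtain ⟨P, f, hP, hf⟩ := exists_free_cover R X
    have hPp : Module.Projective R P := Module.Projective.of_free
    have hs := isSES_ker hf
    exact ⟨ModuleCat.of R (LinearMap.ker f), P, _, f, hPp, hs,
      hC.isGProj_ker hs (hC.isGProj_of_projective (X := P)) h⟩
  | succ n ih =>
    intro X _ _ h
    obtain ⟨K, P, i, p, hP, hs, hK⟩ := h
    exact ⟨K, P, i, p, hP, hs, ih hK⟩

theorem DimLE.mono (hC : IsWTilting R C) {m n : ℕ} (hmn : m ≤ n) (h : DimLE R C m X) :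
    DimLE R C n X := by
  induction hmn with
  | refl => exact h
  | step _ ih => exact ih.succ hC

/-- Independence of the chosen syzygy, by Schanuel's pullback E of Y and P over Z: E is an extension
of Y by the given syzygy and of P by X. -/
theorem DimLE.ker (hC : IsWTilting R C) {n : ℕ} {i : X →ₗ[R] Y} {p : Y →ₗ[R] Z} (h : IsSES i p)
    [Module.Projective R Y] (hZ : DimLE R C (n + 1) Z) : DimLE R C n X := by
  obtain ⟨K, P, j, q, hP, hs, hK⟩ := hZ
  -- the pullback of `p` and `q`
  let E := LinearMap.ker (p.coprod (-q))
  have hE : ∀ e : E, p e.1.1 = q e.1.2 := fun e => by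
    have : p e.1.1 + -(q e.1.2) = 0 := e.2
    exact add_neg_eq_zero.1 this
  have hEY : IsSES ((LinearMap.inr R Y P ∘ₗ j).codRestrict E
      (fun x => by simp [E, hs.apply_apply])) (LinearMap.fst R Y P ∘ₗ E.subtype) := by
    refine ⟨fun x y hxy => hs.inj (congrArg (fun e : E => e.1.2) hxy), fun e => ⟨fun he => ?_, ?_⟩,
      fun y => ?_⟩
    · have he' : e.1.1 = 0 := he
      have h0 := hE e
      rw [he', map_zero] at h0
      obtain ⟨x, hx⟩ := (hs.exact _).1 h0.symm
      exact ⟨x, Subtype.ext (Prod.ext he'.symm hx)⟩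
    · rintro ⟨x, rfl⟩
      rfl
    · obtain ⟨w, hw⟩ := hs.surj (p y)
      exact ⟨⟨(y, w), by simp [E, hw]⟩, rfl⟩
  have hEP : IsSES ((LinearMap.inl R Y P ∘ₗ i).codRestrict E
      (fun x => by simp [E, h.apply_apply])) (LinearMap.snd R Y P ∘ₗ E.subtype) := by
    refine ⟨fun x y hxy => h.inj (congrArg (fun e : E => e.1.1) hxy), fun e => ⟨fun he => ?_, ?_⟩,
      fun y => ?_⟩
    · have he' : e.1.2 = 0 := he
      have h0 := hE e
      rw [he', map_zero] at h0
      obtain ⟨x, hx⟩ := (h.exact _).1 h0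
      exact ⟨x, Subtype.ext (Prod.ext hx he'.symm)⟩
    · rintro ⟨x, rfl⟩
      rfl
    · obtain ⟨w, hw⟩ := h.surj (q y)
      exact ⟨⟨(w, y), by simp [E, hw]⟩, rfl⟩
  have hproj : ∀ (m : ℕ) (W : Type u) [AddCommGroup W] [Module R W] [Module.Projective R W],
      DimLE R C m W := fun m W _ _ _ =>
    DimLE.mono hC (Nat.zero_le m) (show DimLE R C 0 W from hC.isGProj_of_projective)
  have hdE : DimLE R C n E := DimLE.mid hEY hK (hproj n Y)
  cases n with
  | zero => exact hC.isGProj_ker hEP hdE hC.isGProj_of_projective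
  | succ n =>
    -- split the epimorphism onto `P`
    obtain ⟨s, hsec⟩ := Module.projective_lifting_property
      (LinearMap.snd R Y P ∘ₗ E.subtype) LinearMap.id hEP.surj
    have hsec1 : ∀ x, (s x).1.2 = x := LinearMap.congr_fun hsec
    obtain ⟨r, hr⟩ := exists_lift hEP.inj
      (LinearMap.id - s ∘ₗ LinearMap.snd R Y P ∘ₗ E.subtype) (fun e => (hEP.exact _).1 (by
        change e.1.2 - (s e.1.2).1.2 = 0
        rw [hsec1, sub_self]))
    have hr1 : ∀ e : E, _ = e - s e.1.2 := LinearMap.congr_fun hr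
    -- The splitting also presents X as the quotient of E by P, so the cokernel estimate bounds its
    -- dimension.
    have hPX : IsSES s r := by
      refine ⟨fun x y hxy => ?_, fun e => ?_, fun x => ?_⟩
      · rw [← hsec1 x, ← hsec1 y, hxy]
      · rw [← (injective_iff_map_eq_zero' _).1 hEP.inj]
        constructor
        · intro he
          exact ⟨e.1.2, (sub_eq_zero.1 ((hr1 e).symm.trans he)).symm⟩
        · rintro ⟨x, rfl⟩
          refine (hr1 (s x)).trans ?_
          rw [hsec1, sub_self]
      · refine ⟨_, hEP.inj ((hr1 (((LinearMap.inl R Y P ∘ₗ i).codRestrict E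
          (fun x => by simp [E, h.apply_apply])) x)).trans ?_)⟩
        have : s (0 : P) = 0 := map_zero s
        exact (congrArg _ this).trans (sub_zero _)
    exact DimLE.right hPX (hproj n P) hdE

theorem gpdLE_zero (h : IsGProj R C X) : GpdLE R C X 0 := by
  refine ⟨fun | 0 => ModuleCat.of R X | _ + 1 => ModuleCat.of R PUnit, fun _ => 0, LinearMap.id,
    Function.surjective_id, ?_, ?_, ?_, ?_⟩
  · intro x
    simp [eq_comm]
  · intro i x
    exact ⟨fun _ => ⟨0, Subsingleton.elim (α := PUnit) _ _⟩, fun _ => rfl⟩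
  · intro i hi
    obtain rfl : i = 0 := by omega
    exact h
  · rintro (_ | i) hi
    · omega
    · exact inferInstanceAs (Subsingleton PUnit)

theorem GpdLE.isGProj (h : GpdLE R C X 0) : IsGProj R C X := by
  obtain ⟨G, d, ε, hε, h0, hd, hG, hz⟩ := h
  refine (hG 0 le_rfl).congr (LinearEquiv.ofBijective ε ⟨?_, hε⟩)
  rw [injective_iff_map_eq_zero]
  intro x hx
  obtain ⟨y, rfl⟩ := (h0 x).1 hx
  have := hz 1 (by omega)
  rw [Subsingleton.elim y 0, map_zero]

theorem GpdLE.cons {n : ℕ} {i : X →ₗ[R] Y} {p : Y →ₗ[R] Z} (h : IsSES i p)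
    (hX : GpdLE R C X n) (hY : IsGProj R C Y) : GpdLE R C Z (n + 1) := by
  obtain ⟨G, d, ε, hε, h0, hd, hG, hz⟩ := hX
  refine ⟨fun | 0 => ModuleCat.of R Y | k + 1 => G k, fun | 0 => i ∘ₗ ε | k + 1 => d k, p,
    h.surj, ?_, ?_, ?_, ?_⟩
  · intro y
    rw [h.exact y]
    constructor
    · rintro ⟨x, rfl⟩
      obtain ⟨g, rfl⟩ := hε x
      exact ⟨g, rfl⟩
    · rintro ⟨g, rfl⟩
      exact ⟨ε g, rfl⟩
  · rintro (_ | k)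
    · intro x
      exact ((injective_iff_map_eq_zero' _).1 h.inj (ε x)).trans (h0 x)
    · exact hd k
  · rintro (_ | k) hk
    · exact hY
    · exact hG k (by omega)
  · rintro (_ | k) hk
    · omega
    · exact hz k (by omega)

theorem GpdLE.uncons {n : ℕ} (h : GpdLE R C X (n + 1)) :
    ∃ (K G : ModuleCat.{u} R) (i : K →ₗ[R] G) (p : G →ₗ[R] X),
      IsSES i p ∧ IsGProj R C G ∧ GpdLE R C K n := by
  obtain ⟨G, d, ε, hε, h0, hd, hG, hz⟩ := h
  refine ⟨ModuleCat.of R (LinearMap.ker ε), G 0, _, ε, isSES_ker hε, hG 0 (Nat.zero_le _),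
    fun k => G (k + 1), fun k => d (k + 1),
    (d 0).codRestrict (LinearMap.ker ε) h0.apply_apply_eq_zero, ?_, ?_, fun k => hd (k + 1),
    fun k hk => hG _ (by omega), fun k hk => hz _ (by omega)⟩
  · rintro ⟨x, hx⟩
    obtain ⟨y, rfl⟩ := (h0 x).1 hx
    exact ⟨y, rfl⟩
  · intro x
    rw [← hd 0 x]
    exact Subtype.ext_iff

theorem GpdLE.congr {n : ℕ} (h : GpdLE R C X n) (e : X ≃ₗ[R] Y) : GpdLE R C Y n := by
  obtain ⟨G, d, ε, hε, h0, hd, hG, hz⟩ := h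
  refine ⟨G, d, e.toLinearMap ∘ₗ ε, e.surjective.comp hε, fun x => ?_, hd, hG, hz⟩
  rw [← h0 x]
  simp

theorem DimLE.gpdLE (hC : IsWTilting R C) {n : ℕ} : ∀ {X : Type u} [AddCommGroup X]
    [Module R X], DimLE R C n X → GpdLE R C X n := by
  induction n with
  | zero => intro X _ _ h; exact gpdLE_zero h
  | succ n ih =>
    intro X _ _ h
    obtain ⟨K, P, i, p, hP, hs, hK⟩ := h
    exact GpdLE.cons hs (ih hK) hC.isGProj_of_projective

theorem GpdLE.dimLE (hC : IsWTilting R C) {n : ℕ} : ∀ {X : Type u} [AddCommGroup X]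
    [Module R X], GpdLE R C X n → DimLE R C n X := by
  induction n with
  | zero => intro X _ _ h; exact h.isGProj
  | succ n ih =>
    intro X _ _ h
    obtain ⟨K, G, i, p, hs, hG, hK⟩ := h.uncons
    exact DimLE.right hs (ih hK) (DimLE.mono hC (Nat.zero_le _) (show DimLE R C 0 G from hG))

theorem gpd_le_of_gpdLE {n : ℕ} (h : GpdLE R C X n) : gpd R C X ≤ n := iInf₂_le n h

/-- If no resolution had length at most n, the infimum would be at least n + 1. -/
theorem exists_gpdLE_of_gpd_le {n : ℕ} (h : gpd R C X ≤ n) : ∃ m ≤ n, GpdLE R C X m := by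
  by_contra! hcon
  have : ((n + 1 : ℕ) : ℕ∞) ≤ gpd R C X := le_iInf₂ fun m hm => by
    by_contra! hlt
    have : m < n + 1 := by exact_mod_cast hlt
    exact hcon m (by omega) hm
  have := this.trans h
  have : n + 1 ≤ n := by exact_mod_cast this
  omega

end Dimension

/-! ### The functor U ⊗_A - -/

section BTensorLemmas

variable {A B U X Y Z : Type u} [Ring A] [Ring B]
  [AddCommGroup U] [Module B U] [Module Aᵐᵒᵖ U] [AddCommGroup X] [Module A X]
  [AddCommGroup Y] [Module A Y] [AddCommGroup Z] [Module A Z]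
  {N : Type u} [AddCommGroup N] [Module B N]

/-- The `B`-linear map on `U ⊗_A X` given by a balanced biadditive map. -/
def blift (f : U →+ X →+ N) (hB : ∀ (b : B) u x, f (b • u) x = b • f u x)
    (hA : ∀ (a : A) u x, f (MulOpposite.op a • u) x = f u (a • x)) : BTensor A B U X →ₗ[B] N :=
  (balRel A B U X).liftQ (TensorProduct.AlgebraTensorModule.lift
    { toFun := fun u => (f u).toIntLinearMap
      map_add' := fun u v => by ext x; simp
      map_smul' := fun b u => by ext x; simp [hB] }) (by
    rw [balRel, Submodule.span_le]
    rintro _ ⟨u, a, m, rfl⟩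
    simp [hA])

@[simp] theorem blift_btmul (f : U →+ X →+ N) (hB : ∀ (b : B) u x, f (b • u) x = b • f u x)
    (hA : ∀ (a : A) u x, f (MulOpposite.op a • u) x = f u (a • x)) (u : U) (x : X) :
    blift f hB hA (btmul A B u x) = f u x := by
  simp [blift, btmul]

theorem btensor_induction {P : BTensor A B U X → Prop} (zero : P 0)
    (add : ∀ s t, P s → P t → P (s + t)) (tmul : ∀ u x, P (btmul A B u x)) (t) : P t := by
  obtain ⟨t, rfl⟩ := Submodule.mkQ_surjective _ t
  induction t with
  | zero => simpa using zero
  | tmul u x => exact tmul u x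
  | add s t hs ht => rw [map_add]; exact add _ _ hs ht

theorem btensor_ext {f g : BTensor A B U X →ₗ[B] N}
    (h : ∀ u x, f (btmul A B u x) = g (btmul A B u x)) : f = g := by
  refine LinearMap.ext fun t => ?_
  induction t using btensor_induction with
  | zero => simp
  | tmul u x => exact h u x
  | add s t hs ht => rw [map_add, map_add, hs, ht]

theorem bmap_comp (f : X →ₗ[A] Y) (g : Y →ₗ[A] Z) :
    bmap A B U (g ∘ₗ f) = bmap A B U g ∘ₗ bmap A B U f :=
  btensor_ext fun u x => by simp [bmap_btmul]

theorem bmap_bmap (f : X →ₗ[A] Y) (g : Y →ₗ[A] Z) (t : BTensor A B U X) :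
    bmap A B U g (bmap A B U f t) = bmap A B U (g ∘ₗ f) t := by
  rw [bmap_comp]; rfl

theorem bmap_id : bmap A B U (LinearMap.id : X →ₗ[A] X) = LinearMap.id :=
  btensor_ext fun u x => by simp [bmap_btmul]

theorem bmap_zero : bmap A B U (0 : X →ₗ[A] Y) = 0 :=
  btensor_ext fun u x => by simp [bmap_btmul, btmul_zero_right]

theorem bmap_surjective {f : X →ₗ[A] Y} (hf : Function.Surjective f) :
    Function.Surjective (bmap A B U f) := by
  intro t
  induction t using btensor_induction with
  | zero => exact ⟨0, map_zero _⟩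
  | tmul u y =>
    obtain ⟨x, rfl⟩ := hf y
    exact ⟨btmul A B u x, bmap_btmul A B U f u x⟩
  | add s t hs ht =>
    obtain ⟨s, rfl⟩ := hs
    obtain ⟨t, rfl⟩ := ht
    exact ⟨s + t, map_add _ _ _⟩

/-- An element killed in U ⊗ Z lifts to U ⊗ Y by right exactness, there comes from U ⊗ X, and X → Y
→ M is zero. -/
theorem bmap_injective_of_exact {X Y Z M : Type u} [AddCommGroup X] [Module A X]
    [AddCommGroup Y] [Module A Y] [AddCommGroup Z] [Module A Z] [AddCommGroup M] [Module A M]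
    {f : X →ₗ[A] Y} {p : Y →ₗ[A] M} {i : M →ₗ[A] Z} (hp : Function.Surjective p)
    (hi : Function.Injective i) (hf : Function.Exact f (i ∘ₗ p))
    (hU : Function.Exact (bmap A B U f) (bmap A B U (i ∘ₗ p))) :
    Function.Injective (bmap A B U i) := by
  rw [injective_iff_map_eq_zero]
  intro t ht
  obtain ⟨t, rfl⟩ := bmap_surjective (B := B) (U := U) hp t
  rw [bmap_bmap] at ht
  obtain ⟨s, rfl⟩ := (hU t).1 ht
  have : p ∘ₗ f = 0 := by
    ext x
    exact (injective_iff_map_eq_zero i).1 hi _ (hf.apply_apply_eq_zero x)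
  rw [bmap_bmap, this, bmap_zero, LinearMap.zero_apply]

/-- `U ⊗_A -` applied to an isomorphism. -/
def bmapEquiv (e : X ≃ₗ[A] Y) : BTensor A B U X ≃ₗ[B] BTensor A B U Y :=
  LinearEquiv.ofLinearMap (bmap A B U e.toLinearMap) (bmap A B U e.symm.toLinearMap)
    (by rw [← bmap_comp, LinearEquiv.comp_symm, bmap_id])
    (by rw [← bmap_comp, LinearEquiv.symm_comp, bmap_id])

instance [Subsingleton X] : Subsingleton (BTensor A B U X) := by
  refine subsingleton_of_forall_eq 0 fun t => ?_
  induction t using btensor_induction with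
  | zero => rfl
  | tmul u x => rw [Subsingleton.elim x 0, btmul_zero_right]
  | add s t hs ht => rw [hs, ht, add_zero]

end BTensorLemmas

/-! ### Matrix entries in the triangular ring -/

namespace TriMat

variable {A B U : Type u} [Ring A] [Ring B] [AddCommGroup U]

/-- The matrix with upper left entry `a`. -/
def ofA (a : A) : TriMat A B U := ⟨a, 0, 0⟩

/-- The matrix with lower left entry `u`. -/
def ofU (u : U) : TriMat A B U := ⟨0, u, 0⟩

/-- The matrix with lower right entry `b`. -/
def ofB (b : B) : TriMat A B U := ⟨0, 0, b⟩

theorem eq_sum (t : TriMat A B U) : t = ofA t.a + ofU t.u + ofB t.b := by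
  ext <;> simp [ofA, ofU, ofB]

theorem ofA_add (a a' : A) : (ofA (a + a') : TriMat A B U) = ofA a + ofA a' := by
  ext <;> simp [ofA]

theorem ofB_add (b b' : B) : (ofB (b + b') : TriMat A B U) = ofB b + ofB b' := by
  ext <;> simp [ofB]

theorem ofU_add (u u' : U) : (ofU (u + u') : TriMat A B U) = ofU u + ofU u' := by
  ext <;> simp [ofU]

theorem ofA_one_add_ofB_one : (ofA 1 + ofB 1 : TriMat A B U) = 1 := by
  ext <;> simp [ofA, ofB]

variable [Module B U] [Module Aᵐᵒᵖ U]

theorem ofA_mul (a a' : A) : (ofA (a * a') : TriMat A B U) = ofA a * ofA a' := by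
  ext <;> simp [ofA]

theorem ofB_mul (b b' : B) : (ofB (b * b') : TriMat A B U) = ofB b * ofB b' := by
  ext <;> simp [ofB]

theorem ofU_mul_ofA (u : U) (a : A) :
    (ofU u * ofA a : TriMat A B U) = ofU (MulOpposite.op a • u) := by
  ext <;> simp [ofA, ofU]

theorem ofB_mul_ofU (b : B) (u : U) : (ofB b * ofU u : TriMat A B U) = ofU (b • u) := by
  ext <;> simp [ofB, ofU]

theorem ofB_mul_ofA (b : B) (a : A) : (ofB b * ofA a : TriMat A B U) = 0 := by
  ext <;> simp [ofB, ofA]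

theorem ofA_mul_ofB (b : B) (a : A) : (ofA a * ofB b : TriMat A B U) = 0 := by
  ext <;> simp [ofB, ofA]

theorem ofU_mul_ofB (u : U) (b : B) : (ofU u * ofB b : TriMat A B U) = 0 := by
  ext <;> simp [ofU, ofB]

end TriMat

open TriMat

/-! ### The components of a T-module and its structure map -/

section Components

variable (A B U : Type u) [Ring A] [Ring B]
  [AddCommGroup U] [Module B U] [Module Aᵐᵒᵖ U] [SMulCommClass B Aᵐᵒᵖ U]
  (M : Type u) [AddCommGroup M] [Module (TriMat A B U) M]

/-- The first component `e₁ M` of a module over the triangular matrix ring. -/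
def Fst : AddSubgroup M where
  carrier := {x | (ofA 1 : TriMat A B U) • x = x}
  zero_mem' := smul_zero _
  add_mem' {x y} hx hy := by
    change _ • (x + y) = x + y
    rw [smul_add, show _ • x = x from hx, show _ • y = y from hy]
  neg_mem' {x} hx := by
    change _ • (-x) = -x
    rw [smul_neg, show _ • x = x from hx]

/-- The second component `e₂ M` of a module over the triangular matrix ring. -/
def Snd : AddSubgroup M where
  carrier := {x | (ofB 1 : TriMat A B U) • x = x}
  zero_mem' := smul_zero _
  add_mem' {x y} hx hy := by
    change _ • (x + y) = x + y
    rw [smul_add, show _ • x = x from hx, show _ • y = y from hy]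
  neg_mem' {x} hx := by
    change _ • (-x) = -x
    rw [smul_neg, show _ • x = x from hx]

variable {A B U M}

theorem Fst.one_smul (x : Fst A B U M) : (ofA 1 : TriMat A B U) • (x : M) = x := x.2
theorem Snd.one_smul (x : Snd A B U M) : (ofB 1 : TriMat A B U) • (x : M) = x := x.2

theorem ofA_smul_mem (a : A) (x : M) : (ofA a : TriMat A B U) • x ∈ Fst A B U M := by
  change (ofA 1 : TriMat A B U) • (ofA a : TriMat A B U) • x = _
  rw [← mul_smul, ← ofA_mul, one_mul]

theorem ofB_smul_mem (b : B) (x : M) : (ofB b : TriMat A B U) • x ∈ Snd A B U M := by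
  change (ofB 1 : TriMat A B U) • (ofB b : TriMat A B U) • x = _
  rw [← mul_smul, ← ofB_mul, one_mul]

theorem ofU_smul_mem (u : U) (x : M) : (ofU u : TriMat A B U) • x ∈ Snd A B U M := by
  change (ofB 1 : TriMat A B U) • (ofU u : TriMat A B U) • x = _
  rw [← mul_smul, ofB_mul_ofU, _root_.one_smul]

theorem ofB_smul_fst (b : B) (x : Fst A B U M) : (ofB b : TriMat A B U) • (x : M) = 0 := by
  rw [← Fst.one_smul x, ← mul_smul, ofB_mul_ofA, zero_smul]

theorem ofA_smul_snd (a : A) (x : Snd A B U M) : (ofA a : TriMat A B U) • (x : M) = 0 := by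
  rw [← Snd.one_smul x, ← mul_smul, ofA_mul_ofB, zero_smul]

theorem ofU_smul_snd (u : U) (x : Snd A B U M) : (ofU u : TriMat A B U) • (x : M) = 0 := by
  rw [← Snd.one_smul x, ← mul_smul, ofU_mul_ofB, zero_smul]

instance : Module A (Fst A B U M) where
  smul a x := ⟨(ofA a : TriMat A B U) • (x : M), ofA_smul_mem a _⟩
  one_smul x := Subtype.ext x.2
  mul_smul a b x := Subtype.ext (by
    change (ofA (a * b) : TriMat A B U) • (x : M) = (ofA a : TriMat A B U) • _ • (x : M)
    rw [ofA_mul, mul_smul])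
  smul_zero a := Subtype.ext (smul_zero _)
  smul_add a x y := Subtype.ext (smul_add _ _ _)
  add_smul a b x := Subtype.ext (by
    change (ofA (a + b) : TriMat A B U) • (x : M) = (ofA a : TriMat A B U) • (x : M) + _ • (x : M)
    rw [ofA_add, add_smul])
  zero_smul x := Subtype.ext (zero_smul (TriMat A B U) (x : M))

instance : Module B (Snd A B U M) where
  smul a x := ⟨(ofB a : TriMat A B U) • (x : M), ofB_smul_mem a _⟩
  one_smul x := Subtype.ext x.2
  mul_smul a b x := Subtype.ext (by
    change (ofB (a * b) : TriMat A B U) • (x : M) = (ofB a : TriMat A B U) • _ • (x : M)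
    rw [ofB_mul, mul_smul])
  smul_zero a := Subtype.ext (smul_zero _)
  smul_add a x y := Subtype.ext (smul_add _ _ _)
  add_smul a b x := Subtype.ext (by
    change (ofB (a + b) : TriMat A B U) • (x : M) = (ofB a : TriMat A B U) • (x : M) + _ • (x : M)
    rw [ofB_add, add_smul])
  zero_smul x := Subtype.ext (zero_smul (TriMat A B U) (x : M))

theorem Fst.coe_smul (a : A) (x : Fst A B U M) :
    ((a • x : Fst A B U M) : M) = (ofA a : TriMat A B U) • (x : M) := rfl
theorem Snd.coe_smul (b : B) (x : Snd A B U M) :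
    ((b • x : Snd A B U M) : M) = (ofB b : TriMat A B U) • (x : M) := rfl

variable (A B U M)

/-- The projection `M → e₁ M`. -/
def fstPr : M →+ Fst A B U M where
  toFun x := ⟨(ofA 1 : TriMat A B U) • x, ofA_smul_mem 1 x⟩
  map_zero' := Subtype.ext (smul_zero _)
  map_add' x y := Subtype.ext (smul_add _ x y)

/-- The projection `M → e₂ M`. -/
def sndPr : M →+ Snd A B U M where
  toFun x := ⟨(ofB 1 : TriMat A B U) • x, ofB_smul_mem 1 x⟩
  map_zero' := Subtype.ext (smul_zero _)
  map_add' x y := Subtype.ext (smul_add _ x y)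

/-- The structure map `U ⊗_A e₁ M → e₂ M` of a module over the triangular matrix ring. -/
def act : BTensor A B U (Fst A B U M) →ₗ[B] Snd A B U M :=
  blift
    { toFun := fun u =>
        { toFun := fun x => ⟨(ofU u : TriMat A B U) • (x : M), ofU_smul_mem u _⟩
          map_zero' := Subtype.ext (smul_zero _)
          map_add' := fun x y => Subtype.ext (smul_add _ _ _) }
      map_zero' := by ext x; exact zero_smul (TriMat A B U) (x : M)
      map_add' := fun u v => by
        ext x
        change (ofU (u + v) : TriMat A B U) • (x : M)
          = (ofU u : TriMat A B U) • (x : M) + (ofU v : TriMat A B U) • (x : M)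
        rw [ofU_add, add_smul] }
    (fun b u x => Subtype.ext (by
      change (ofU (b • u) : TriMat A B U) • (x : M) = (ofB b : TriMat A B U) •
        (ofU u : TriMat A B U) • (x : M)
      rw [← mul_smul, ofB_mul_ofU]))
    (fun a u x => Subtype.ext (by
      change (ofU (MulOpposite.op a • u) : TriMat A B U) • (x : M) = (ofU u : TriMat A B U) •
        (ofA a : TriMat A B U) • (x : M)
      rw [← mul_smul, ofU_mul_ofA]))

variable {A B U M}

theorem act_btmul (u : U) (x : Fst A B U M) :
    (act A B U M (btmul A B u x) : M) = (ofU u : TriMat A B U) • (x : M) := by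
  rw [act, blift_btmul]; rfl

theorem fstPr_coe (x : M) : (fstPr A B U M x : M) = (ofA 1 : TriMat A B U) • x := rfl
theorem sndPr_coe (x : M) : (sndPr A B U M x : M) = (ofB 1 : TriMat A B U) • x := rfl

theorem fstPr_fst (x : Fst A B U M) : fstPr A B U M x = x := Subtype.ext x.2
theorem sndPr_snd (x : Snd A B U M) : sndPr A B U M x = x := Subtype.ext x.2
theorem fstPr_snd (x : Snd A B U M) : fstPr A B U M x = 0 := Subtype.ext (ofA_smul_snd 1 x)

theorem fstPr_add_sndPr (x : M) : (fstPr A B U M x : M) + sndPr A B U M x = x := by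
  rw [fstPr_coe, sndPr_coe, ← add_smul, ofA_one_add_ofB_one, one_smul]

theorem fstPr_smul (t : TriMat A B U) (x : M) :
    fstPr A B U M (t • x) = t.a • fstPr A B U M x := by
  refine Subtype.ext ?_
  rw [fstPr_coe, Fst.coe_smul, fstPr_coe, ← mul_smul, ← mul_smul]
  congr 1
  ext <;> simp [ofA]

theorem sndPr_smul (t : TriMat A B U) (x : M) :
    sndPr A B U M (t • x) =
      act A B U M (btmul A B t.u (fstPr A B U M x)) + t.b • sndPr A B U M x := by
  refine Subtype.ext ?_
  rw [AddSubgroup.coe_add, act_btmul, sndPr_coe, Snd.coe_smul, sndPr_coe, fstPr_coe, ← mul_smul,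
    ← mul_smul, ← mul_smul, ← add_smul]
  congr 1
  ext <;> simp [ofA, ofU, ofB]

theorem smul_fst_add_snd (t : TriMat A B U) (x : Fst A B U M) (y : Snd A B U M) :
    t • ((x : M) + y) = (t.a • x : Fst A B U M) +
      (act A B U M (btmul A B t.u x) + t.b • y : Snd A B U M) := by
  rw [AddSubgroup.coe_add, act_btmul, Fst.coe_smul, Snd.coe_smul]
  nth_rw 1 [eq_sum t]
  rw [smul_add, add_smul, add_smul, add_smul, add_smul, ofB_smul_fst, ofA_smul_snd, ofU_smul_snd]
  abel

end Components

/-! ### Exactness of e₁ and e₂; the cokernel functor -/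

section Functors

variable {A B U : Type u} [Ring A] [Ring B]
  [AddCommGroup U] [Module B U] [Module Aᵐᵒᵖ U] [SMulCommClass B Aᵐᵒᵖ U]
  {M N L : Type u} [AddCommGroup M] [Module (TriMat A B U) M] [AddCommGroup N]
  [Module (TriMat A B U) N] [AddCommGroup L] [Module (TriMat A B U) L]

/-- The map induced on first components. -/
def fstMap (f : M →ₗ[TriMat A B U] N) : Fst A B U M →ₗ[A] Fst A B U N where
  toFun x := ⟨f x, by
    change (ofA 1 : TriMat A B U) • f x = f x
    rw [← map_smul, Fst.one_smul]⟩
  map_add' x y := Subtype.ext (map_add f (x : M) y)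
  map_smul' a x := Subtype.ext (map_smul f (ofA a) (x : M))

/-- The map induced on second components. -/
def sndMap (f : M →ₗ[TriMat A B U] N) : Snd A B U M →ₗ[B] Snd A B U N where
  toFun x := ⟨f x, by
    change (ofB 1 : TriMat A B U) • f x = f x
    rw [← map_smul, Snd.one_smul]⟩
  map_add' x y := Subtype.ext (map_add f (x : M) y)
  map_smul' a x := Subtype.ext (map_smul f (ofB a) (x : M))

@[simp] theorem fstMap_coe (f : M →ₗ[TriMat A B U] N) (x : Fst A B U M) :
    (fstMap f x : N) = f x := rfl
@[simp] theorem sndMap_coe (f : M →ₗ[TriMat A B U] N) (x : Snd A B U M) :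
    (sndMap f x : N) = f x := rfl

theorem act_bmap_fstMap (f : M →ₗ[TriMat A B U] N) (t : BTensor A B U (Fst A B U M)) :
    act A B U N (bmap A B U (fstMap f) t) = sndMap f (act A B U M t) := by
  change (act A B U N ∘ₗ bmap A B U (fstMap f)) t = (sndMap f ∘ₗ act A B U M) t
  congr 1
  refine btensor_ext fun u x => Subtype.ext ?_
  simp [bmap_btmul, act_btmul]

theorem fstPr_apply (f : M →ₗ[TriMat A B U] N) (x : M) :
    fstPr A B U N (f x) = fstMap f (fstPr A B U M x) := Subtype.ext (map_smul f _ x).symm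
theorem sndPr_apply (f : M →ₗ[TriMat A B U] N) (x : M) :
    sndPr A B U N (f x) = sndMap f (sndPr A B U M x) := Subtype.ext (map_smul f _ x).symm

theorem fstMap_comp (f : M →ₗ[TriMat A B U] N) (g : N →ₗ[TriMat A B U] L) :
    fstMap (g ∘ₗ f) = fstMap g ∘ₗ fstMap f := rfl
theorem fstMap_id : fstMap (LinearMap.id : M →ₗ[TriMat A B U] M) = LinearMap.id := rfl

theorem triHom_ext {f g : M →ₗ[TriMat A B U] N} (h₁ : fstMap f = fstMap g)
    (h₂ : sndMap f = sndMap g) : f = g := by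
  ext x
  rw [← fstPr_add_sndPr (A := A) (B := B) (U := U) x, map_add, map_add]
  exact congrArg₂ (· + ·) (congrArg Subtype.val (LinearMap.congr_fun h₁ _))
    (congrArg Subtype.val (LinearMap.congr_fun h₂ _))

theorem fstMap_exact {f : M →ₗ[TriMat A B U] N} {g : N →ₗ[TriMat A B U] L}
    (h : Function.Exact f g) : Function.Exact (fstMap f) (fstMap g) := by
  intro y
  rw [← Subtype.val_inj, fstMap_coe]
  refine (h y).trans ⟨?_, ?_⟩
  · rintro ⟨x, hx⟩
    refine ⟨fstPr A B U M x, ?_⟩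
    rw [← fstPr_apply, hx, fstPr_fst]
  · rintro ⟨x, rfl⟩
    exact ⟨x, rfl⟩

theorem sndMap_exact {f : M →ₗ[TriMat A B U] N} {g : N →ₗ[TriMat A B U] L}
    (h : Function.Exact f g) : Function.Exact (sndMap f) (sndMap g) := by
  intro y
  rw [← Subtype.val_inj, sndMap_coe]
  refine (h y).trans ⟨?_, ?_⟩
  · rintro ⟨x, hx⟩
    refine ⟨sndPr A B U M x, ?_⟩
    rw [← sndPr_apply, hx, sndPr_snd]
  · rintro ⟨x, rfl⟩
    exact ⟨x, rfl⟩

theorem fstMap_surjective {f : M →ₗ[TriMat A B U] N} (h : Function.Surjective f) :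
    Function.Surjective (fstMap f) := fun y => by
  obtain ⟨x, hx⟩ := h y
  exact ⟨fstPr A B U M x, by rw [← fstPr_apply, hx, fstPr_fst]⟩

theorem sndMap_surjective {f : M →ₗ[TriMat A B U] N} (h : Function.Surjective f) :
    Function.Surjective (sndMap f) := fun y => by
  obtain ⟨x, hx⟩ := h y
  exact ⟨sndPr A B U M x, by rw [← sndPr_apply, hx, sndPr_snd]⟩

variable (A B U M) in
/-- The cokernel of the structure map `U ⊗_A e₁ M → e₂ M`. -/
abbrev Cok : Type u := Snd A B U M ⧸ LinearMap.range (act A B U M)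

/-- The map induced on cokernels of the structure maps. -/
def cokMap (f : M →ₗ[TriMat A B U] N) : Cok A B U M →ₗ[B] Cok A B U N :=
  (LinearMap.range (act A B U M)).mapQ (LinearMap.range (act A B U N)) (sndMap f) (by
    rintro _ ⟨t, rfl⟩
    exact ⟨_, act_bmap_fstMap f t⟩)

theorem cokMap_mk (f : M →ₗ[TriMat A B U] N) (y : Snd A B U M) :
    cokMap f (Submodule.Quotient.mk y) = Submodule.Quotient.mk (sndMap f y) := rfl

theorem cokMap_comp (f : M →ₗ[TriMat A B U] N) (g : N →ₗ[TriMat A B U] L) :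
    cokMap (g ∘ₗ f) = cokMap g ∘ₗ cokMap f := by
  ext; rfl

theorem cokMap_id : cokMap (LinearMap.id : M →ₗ[TriMat A B U] M) = LinearMap.id := by
  ext; rfl

theorem cokMap_surjective {f : M →ₗ[TriMat A B U] N} (h : Function.Surjective f) :
    Function.Surjective (cokMap f) := fun y => by
  obtain ⟨y, rfl⟩ := Submodule.Quotient.mk_surjective _ y
  obtain ⟨x, rfl⟩ := sndMap_surjective h y
  exact ⟨Submodule.Quotient.mk x, rfl⟩

end Functors

/-! ### Modules and maps given by triples -/

section Triples

variable {A B U : Type u} [Ring A] [Ring B]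
  [AddCommGroup U] [Module B U] [Module Aᵐᵒᵖ U] [SMulCommClass B Aᵐᵒᵖ U]
  {M₁ M₂ N₁ N₂ : Type u} [AddCommGroup M₁] [Module A M₁] [AddCommGroup M₂] [Module B M₂]
  [AddCommGroup N₁] [Module A N₁] [AddCommGroup N₂] [Module B N₂]
  {L : Type u} [AddCommGroup L] [Module (TriMat A B U) L]
  (φ : BTensor A B U M₁ →ₗ[B] M₂) (ψ : BTensor A B U N₁ →ₗ[B] N₂)

/-- The element `(x, y)` of the module given by a triple. -/
def OfTriple.mk (x : M₁) (y : M₂) : OfTriple φ := (x, y)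

variable {φ} in
theorem OfTriple.smul_def (t : TriMat A B U) (z : OfTriple φ) :
    t • z = OfTriple.mk φ (t.a • z.1) (φ (btmul A B t.u z.1) + t.b • z.2) := rfl

variable {φ} in
theorem OfTriple.smul_mk (t : TriMat A B U) (x : M₁) (y : M₂) :
    t • OfTriple.mk φ x y = OfTriple.mk φ (t.a • x) (φ (btmul A B t.u x) + t.b • y) := rfl

/-- The first component of the module given by a triple. -/
def fstTriple : M₁ ≃ₗ[A] Fst A B U (OfTriple φ) where
  toFun x := ⟨OfTriple.mk φ x 0, by
    change (ofA 1 : TriMat A B U) • _ = _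
    rw [OfTriple.smul_def]
    simp only [OfTriple.mk, ofA, btmul_zero_left, one_smul, map_zero, zero_smul, add_zero]
    rfl⟩
  invFun z := z.1.1
  map_add' x y := Subtype.ext (Prod.ext rfl (add_zero (0 : M₂)).symm)
  map_smul' a x := Subtype.ext (by
    change OfTriple.mk φ (a • x) 0 = (ofA a : TriMat A B U) • OfTriple.mk φ x 0
    rw [OfTriple.smul_mk]
    simp only [ofA, btmul_zero_left, map_zero, zero_smul, add_zero])
  left_inv x := rfl
  right_inv z := Subtype.ext (Prod.ext rfl (by
    have := congrArg Prod.snd (Fst.one_smul z)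
    rw [OfTriple.smul_def] at this
    simpa [OfTriple.mk, ofA, btmul_zero_left] using this))

/-- The second component of the module given by a triple. -/
def sndTriple : M₂ ≃ₗ[B] Snd A B U (OfTriple φ) where
  toFun y := ⟨OfTriple.mk φ 0 y, by
    change (ofB 1 : TriMat A B U) • _ = _
    rw [OfTriple.smul_def]
    simp only [OfTriple.mk, ofB, btmul_zero_left, one_smul, map_zero, zero_smul, zero_add]
    rfl⟩
  invFun z := z.1.2
  map_add' x y := Subtype.ext (Prod.ext (add_zero (0 : M₁)).symm rfl)
  map_smul' b x := Subtype.ext (by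
    change OfTriple.mk φ 0 (b • x) = (ofB b : TriMat A B U) • OfTriple.mk φ 0 x
    rw [OfTriple.smul_mk]
    simp only [ofB, btmul_zero_left, map_zero, smul_zero, zero_add])
  left_inv x := rfl
  right_inv z := Subtype.ext (Prod.ext (by
    have := congrArg Prod.fst (Snd.one_smul z)
    rw [OfTriple.smul_def] at this
    simpa [OfTriple.mk, ofB] using this) rfl)

theorem act_triple (t : BTensor A B U M₁) :
    act A B U (OfTriple φ) (bmap A B U (fstTriple φ).toLinearMap t) = sndTriple φ (φ t) := by
  change (act A B U (OfTriple φ) ∘ₗ bmap A B U (fstTriple φ).toLinearMap) t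
    = ((sndTriple φ).toLinearMap ∘ₗ φ) t
  congr 1
  refine btensor_ext fun u x => Subtype.ext ?_
  rw [LinearMap.comp_apply, bmap_btmul, act_btmul]
  change (ofU u : TriMat A B U) • OfTriple.mk φ x 0 = OfTriple.mk φ 0 _
  rw [OfTriple.smul_def]
  simp only [OfTriple.mk, ofU, zero_smul, add_zero]
  rfl

/-- A map from the module of a triple, given by its components. -/
def ofTri (f : M₁ →ₗ[A] Fst A B U L) (g : M₂ →ₗ[B] Snd A B U L)
    (h : ∀ u x, g (φ (btmul A B u x)) = act A B U L (btmul A B u (f x))) :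
    OfTriple φ →ₗ[TriMat A B U] L where
  toFun z := (f z.1 : L) + g z.2
  map_add' z w := by
    change (f (z.1 + w.1) : L) + g (z.2 + w.2) = _
    rw [map_add, map_add, AddSubgroup.coe_add, AddSubgroup.coe_add]
    abel
  map_smul' t z := by
    change (f (t.a • z.1) : L) + g (φ (btmul A B t.u z.1) + t.b • z.2) = t • _
    rw [smul_fst_add_snd, map_smul, map_add, h, map_smul]

/-- A map to the module of a triple, given by its components. -/
def toTri (f : Fst A B U L →ₗ[A] M₁) (g : Snd A B U L →ₗ[B] M₂)
    (h : ∀ u x, g (act A B U L (btmul A B u x)) = φ (btmul A B u (f x))) :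
    L →ₗ[TriMat A B U] OfTriple φ where
  toFun x := OfTriple.mk φ (f (fstPr A B U L x)) (g (sndPr A B U L x))
  map_add' x y := by
    rw [map_add, map_add, map_add, map_add]; rfl
  map_smul' t x := by
    rw [RingHom.id_apply, OfTriple.smul_def, fstPr_smul, sndPr_smul, map_smul, map_add, h,
      map_smul]
    rfl

/-- A map of triples. -/
def triMap (f : M₁ →ₗ[A] N₁) (g : M₂ →ₗ[B] N₂) (h : ∀ u x, g (φ (btmul A B u x)) =
    ψ (btmul A B u (f x))) : OfTriple φ →ₗ[TriMat A B U] OfTriple ψ where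
  toFun z := OfTriple.mk ψ (f z.1) (g z.2)
  map_add' z w := Prod.ext (map_add f _ _) (map_add g _ _)
  map_smul' t z := by
    rw [RingHom.id_apply, OfTriple.smul_def, OfTriple.smul_def]
    simp only [OfTriple.mk, map_smul, map_add, h]
    rfl

end Triples

/-! ### The functor p and its adjunction -/

section PFunctor

variable {A B U : Type u} [Ring A] [Ring B]
  [AddCommGroup U] [Module B U] [Module Aᵐᵒᵖ U] [SMulCommClass B Aᵐᵒᵖ U]
  {X₁ X₂ Y₁ Y₂ Z₁ Z₂ : Type u} [AddCommGroup X₁] [Module A X₁] [AddCommGroup X₂] [Module B X₂]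
  [AddCommGroup Y₁] [Module A Y₁] [AddCommGroup Y₂] [Module B Y₂]
  [AddCommGroup Z₁] [Module A Z₁] [AddCommGroup Z₂] [Module B Z₂]
  {L L' : Type u} [AddCommGroup L] [Module (TriMat A B U) L]
  [AddCommGroup L'] [Module (TriMat A B U) L']

/-- The map `p(X₁, X₂) → L` with components `f` and `g`. -/
def pLift (f : X₁ →ₗ[A] Fst A B U L) (g : X₂ →ₗ[B] Snd A B U L) :
    pMod A B U X₁ X₂ →ₗ[TriMat A B U] L :=
  ofTri _ f ((act A B U L ∘ₗ bmap A B U f).coprod g) fun u x => by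
    simp [bmap_btmul]

/-- The first component of a map `p(X₁, X₂) → L`. -/
def pFst (h : pMod A B U X₁ X₂ →ₗ[TriMat A B U] L) : X₁ →ₗ[A] Fst A B U L :=
  fstMap h ∘ₗ (fstTriple _).toLinearMap

/-- The second component of a map `p(X₁, X₂) → L`. -/
def pSnd (h : pMod A B U X₁ X₂ →ₗ[TriMat A B U] L) : X₂ →ₗ[B] Snd A B U L :=
  sndMap h ∘ₗ (sndTriple _).toLinearMap ∘ₗ LinearMap.inr B _ _

theorem pFst_coe (h : pMod A B U X₁ X₂ →ₗ[TriMat A B U] L) (x : X₁) :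
    (pFst h x : L) = h (OfTriple.mk _ x 0) := rfl
theorem pSnd_coe (h : pMod A B U X₁ X₂ →ₗ[TriMat A B U] L) (y : X₂) :
    (pSnd h y : L) = h (OfTriple.mk _ 0 (0, y)) := rfl

/-- The summand U ⊗ X₁ is generated by the action of U on X₁, so T-linearity forces the values
there. -/
theorem pHom_ext {h k : pMod A B U X₁ X₂ →ₗ[TriMat A B U] L} (h₁ : pFst h = pFst k)
    (h₂ : pSnd h = pSnd k) : h = k := by
  have key : ∀ (h : pMod A B U X₁ X₂ →ₗ[TriMat A B U] L) t,
      sndMap h (sndTriple _ (t, 0)) = act A B U L (bmap A B U (pFst h) t) := fun h t => by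
    rw [pFst, ← bmap_bmap, act_bmap_fstMap, act_triple]; rfl
  refine triHom_ext ?_ ?_
  · ext1 x
    obtain ⟨x, rfl⟩ := (fstTriple _).surjective x
    exact LinearMap.congr_fun h₁ x
  · ext1 y
    obtain ⟨⟨t, y⟩, rfl⟩ := (sndTriple _).surjective y
    have : ((t, y) : BTensor A B U X₁ × X₂) = (t, 0) + (0, y) := by simp
    rw [this, map_add, map_add, map_add, key, key, h₁]
    exact congrArg _ (LinearMap.congr_fun h₂ y)

theorem pFst_pLift (f : X₁ →ₗ[A] Fst A B U L) (g : X₂ →ₗ[B] Snd A B U L) :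
    pFst (pLift f g) = f := by
  ext x
  rw [pFst_coe]
  change (f x : L) + ((act A B U L ∘ₗ bmap A B U f).coprod g 0 : Snd A B U L) = f x
  rw [map_zero, AddSubgroup.coe_zero, add_zero]

theorem pSnd_pLift (f : X₁ →ₗ[A] Fst A B U L) (g : X₂ →ₗ[B] Snd A B U L) :
    pSnd (pLift f g) = g := by
  ext x
  rw [pSnd_coe]
  change (f 0 : L) + ((act A B U L ∘ₗ bmap A B U f).coprod g (0, x) : Snd A B U L) = g x
  rw [map_zero, AddSubgroup.coe_zero, zero_add, LinearMap.coprod_apply, map_zero, zero_add]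

theorem pFst_comp (h : pMod A B U X₁ X₂ →ₗ[TriMat A B U] L) (k : L →ₗ[TriMat A B U] L') :
    pFst (k ∘ₗ h) = fstMap k ∘ₗ pFst h := rfl
theorem pSnd_comp (h : pMod A B U X₁ X₂ →ₗ[TriMat A B U] L) (k : L →ₗ[TriMat A B U] L') :
    pSnd (k ∘ₗ h) = sndMap k ∘ₗ pSnd h := rfl

/-- The functor `p` on morphisms. -/
def pMap (f : X₁ →ₗ[A] Y₁) (g : X₂ →ₗ[B] Y₂) :
    pMod A B U X₁ X₂ →ₗ[TriMat A B U] pMod A B U Y₁ Y₂ :=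
  triMap _ _ f ((bmap A B U f).prodMap g) fun u x => by simp [bmap_btmul]

theorem pMap_mk (f : X₁ →ₗ[A] Y₁) (g : X₂ →ₗ[B] Y₂) (x : X₁) (y : BTensor A B U X₁ × X₂) :
    pMap f g (OfTriple.mk _ x y) = OfTriple.mk _ (f x) (bmap A B U f y.1, g y.2) := rfl

theorem pFst_comp_pMap (f : X₁ →ₗ[A] Y₁) (g : X₂ →ₗ[B] Y₂)
    (h : pMod A B U Y₁ Y₂ →ₗ[TriMat A B U] L) : pFst (h ∘ₗ pMap f g) = pFst h ∘ₗ f := by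
  ext x
  change h (pMap f g (OfTriple.mk _ x 0)) = h (OfTriple.mk _ (f x) 0)
  rw [pMap_mk, Prod.fst_zero, Prod.snd_zero, map_zero, map_zero]
  rfl

theorem pSnd_comp_pMap (f : X₁ →ₗ[A] Y₁) (g : X₂ →ₗ[B] Y₂)
    (h : pMod A B U Y₁ Y₂ →ₗ[TriMat A B U] L) : pSnd (h ∘ₗ pMap f g) = pSnd h ∘ₗ g := by
  ext x
  change h (pMap f g (OfTriple.mk _ 0 (0, x))) = h (OfTriple.mk _ 0 (0, g x))
  rw [pMap_mk, map_zero, map_zero]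

theorem pMap_comp (f : X₁ →ₗ[A] Y₁) (g : X₂ →ₗ[B] Y₂) (f' : Y₁ →ₗ[A] Z₁) (g' : Y₂ →ₗ[B] Z₂) :
    (pMap (f' ∘ₗ f) (g' ∘ₗ g) : pMod A B U X₁ X₂ →ₗ[TriMat A B U] _) =
      pMap f' g' ∘ₗ pMap f g := by
  ext z
  exact Prod.ext rfl (Prod.ext (bmap_bmap f f' z.2.1).symm rfl)

theorem pMap_id : (pMap (LinearMap.id : X₁ →ₗ[A] X₁) (LinearMap.id : X₂ →ₗ[B] X₂) :
    pMod A B U X₁ X₂ →ₗ[TriMat A B U] _) = LinearMap.id := by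
  ext z
  exact Prod.ext rfl (Prod.ext (LinearMap.congr_fun bmap_id z.2.1) rfl)

theorem pMap_surjective {f : X₁ →ₗ[A] Y₁} {g : X₂ →ₗ[B] Y₂} (hf : Function.Surjective f)
    (hg : Function.Surjective g) :
    Function.Surjective (pMap f g : pMod A B U X₁ X₂ →ₗ[TriMat A B U] _) := by
  rintro ⟨x, t, y⟩
  obtain ⟨x, rfl⟩ := hf x
  obtain ⟨t, rfl⟩ := bmap_surjective (B := B) (U := U) hf t
  obtain ⟨y, rfl⟩ := hg y
  exact ⟨OfTriple.mk _ x (t, y), rfl⟩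

theorem pMap_injective {f : X₁ →ₗ[A] Y₁} {g : X₂ →ₗ[B] Y₂} (hf : Function.Injective f)
    (hf' : Function.Injective (bmap A B U f)) (hg : Function.Injective g) :
    Function.Injective (pMap f g : pMod A B U X₁ X₂ →ₗ[TriMat A B U] _) := by
  intro z w h
  exact Prod.ext (hf (congrArg Prod.fst h)) (Prod.ext
    (hf' (congrArg (fun z : Y₁ × BTensor A B U Y₁ × Y₂ => z.2.1) h))
    (hg (congrArg (fun z : Y₁ × BTensor A B U Y₁ × Y₂ => z.2.2) h)))

theorem pMap_exact {f : X₁ →ₗ[A] Y₁} {g : X₂ →ₗ[B] Y₂} {f' : Y₁ →ₗ[A] Z₁} {g' : Y₂ →ₗ[B] Z₂}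
    (hf : Function.Exact f f') (hf' : Function.Exact (bmap A B U f) (bmap A B U f'))
    (hg : Function.Exact g g') :
    Function.Exact (pMap f g : pMod A B U X₁ X₂ →ₗ[TriMat A B U] _) (pMap f' g') := by
  intro z
  constructor
  · intro h
    obtain ⟨x, hx⟩ := (hf z.1).1 (congrArg Prod.fst h)
    obtain ⟨t, ht⟩ := (hf' z.2.1).1
      (congrArg (fun z : Z₁ × BTensor A B U Z₁ × Z₂ => z.2.1) h)
    obtain ⟨y, hy⟩ := (hg z.2.2).1
      (congrArg (fun z : Z₁ × BTensor A B U Z₁ × Z₂ => z.2.2) h)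
    exact ⟨OfTriple.mk _ x (t, y), Prod.ext hx (Prod.ext ht hy)⟩
  · rintro ⟨w, rfl⟩
    exact Prod.ext (hf.apply_apply_eq_zero w.1) (Prod.ext (hf'.apply_apply_eq_zero w.2.1)
      (hg.apply_apply_eq_zero w.2.2))

variable (A B U X₁ X₂) in
/-- The map from the cokernel of the structure map of `p(X₁, X₂)` to `X₂`. -/
def cokPMap : Cok A B U (pMod A B U X₁ X₂) →ₗ[B] X₂ :=
  (LinearMap.range (act A B U (pMod A B U X₁ X₂))).liftQ
    (LinearMap.snd B _ _ ∘ₗ (sndTriple _).symm.toLinearMap) (by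
      rintro _ ⟨t, rfl⟩
      obtain ⟨t, rfl⟩ := (bmapEquiv (fstTriple _)).surjective t
      change LinearMap.snd B _ _ ((sndTriple (LinearMap.inl B (BTensor A B U X₁) X₂)).symm
        (act A B U _ (bmap A B U (fstTriple _).toLinearMap t))) = 0
      rw [act_triple, LinearEquiv.symm_apply_apply]
      rfl)

theorem cokPMap_bijective : Function.Bijective (cokPMap A B U X₁ X₂) := by
  refine ⟨?_, fun y => ⟨Submodule.Quotient.mk (sndTriple _ (0, y)), rfl⟩⟩
  rw [injective_iff_map_eq_zero]
  intro y hy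
  obtain ⟨y, rfl⟩ := Submodule.Quotient.mk_surjective _ y
  obtain ⟨⟨t, y⟩, rfl⟩ := (sndTriple _).surjective y
  obtain rfl : y = 0 := hy
  exact (Submodule.Quotient.mk_eq_zero _).2 ⟨_, act_triple _ t⟩

variable (A B U X₁ X₂) in
/-- The cokernel of the structure map of `p(X₁, X₂)` is `X₂`. -/
noncomputable def cokPMod : Cok A B U (pMod A B U X₁ X₂) ≃ₗ[B] X₂ :=
  LinearEquiv.ofBijective (cokPMap A B U X₁ X₂) cokPMap_bijective

end PFunctor

/-! ### Add(p(C₁, C₂)) and projective T-modules -/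

section Summands

variable {A B U : Type u} [Ring A] [Ring B]
  [AddCommGroup U] [Module B U] [Module Aᵐᵒᵖ U] [SMulCommClass B Aᵐᵒᵖ U]
  {C₁ C₂ X₁ X₂ : Type u} [AddCommGroup C₁] [Module A C₁] [AddCommGroup C₂] [Module B C₂]
  [AddCommGroup X₁] [Module A X₁] [AddCommGroup X₂] [Module B X₂]
  {L N : Type u} [AddCommGroup L] [Module (TriMat A B U) L]
  [AddCommGroup N] [Module (TriMat A B U) N]

variable (A B U C₁ C₂) in
/-- The functor `p` commutes with direct sums. -/
noncomputable def pFinsupp (I : Type u) : (I →₀ pMod A B U C₁ C₂) ≃ₗ[TriMat A B U]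
    pMod A B U (I →₀ C₁) (I →₀ C₂) :=
  LinearEquiv.ofLinearMap
    (Finsupp.lsum ℕ fun i => pMap (Finsupp.lsingle i) (Finsupp.lsingle i))
    (pLift (Finsupp.lsum ℕ fun i => pFst (Finsupp.lsingle i))
      (Finsupp.lsum ℕ fun i => pSnd (Finsupp.lsingle i)))
    (by
      refine pHom_ext ?_ ?_
      · rw [pFst_comp, pFst_pLift]
        ext i x : 2
        refine Subtype.ext ?_
        simp only [LinearMap.comp_apply, Finsupp.lsingle_apply, Finsupp.lsum_single, fstMap_coe,
          pFst_coe, LinearMap.id_apply, pMap_mk]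
        rw [Prod.fst_zero, Prod.snd_zero, map_zero, Finsupp.single_zero]
        rfl
      · rw [pSnd_comp, pSnd_pLift]
        ext i x : 2
        refine Subtype.ext ?_
        simp only [LinearMap.comp_apply, Finsupp.lsingle_apply, Finsupp.lsum_single, sndMap_coe,
          pSnd_coe, LinearMap.id_apply, pMap_mk]
        rw [map_zero, Finsupp.single_zero])
    (by
      refine Finsupp.lhom_ext' fun i => ?_
      have : (Finsupp.lsum ℕ fun i : I => (pMap (Finsupp.lsingle i) (Finsupp.lsingle i) :
          pMod A B U C₁ C₂ →ₗ[TriMat A B U] pMod A B U (I →₀ C₁) (I →₀ C₂))) ∘ₗ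
          Finsupp.lsingle i = pMap (Finsupp.lsingle i) (Finsupp.lsingle i) := by
        ext1 x; simp
      rw [LinearMap.comp_assoc, this, LinearMap.id_comp]
      refine pHom_ext ?_ ?_
      · rw [pFst_comp_pMap, pFst_pLift]; ext1 x; simp
      · rw [pSnd_comp_pMap, pSnd_pLift]; ext1 x; simp)

/-- The two index sets may differ, so both sums are taken over the disjoint union, with X₁ placed in
one half and X₂ in the other. -/
theorem isAdd_pMod (h₁ : IsAdd A C₁ X₁) (h₂ : IsAdd B C₂ X₂) :
    IsAdd (TriMat A B U) (pMod A B U C₁ C₂) (pMod A B U X₁ X₂) := by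
  obtain ⟨I, i, r, hr⟩ := isAdd_iff_retract.1 h₁
  obtain ⟨J, j, s, hs⟩ := isAdd_iff_retract.1 h₂
  let e₁ := Finsupp.sumFinsuppLEquivProdFinsupp (M := C₁) (α := I) (β := J) A
  let e₂ := Finsupp.sumFinsuppLEquivProdFinsupp (M := C₂) (α := I) (β := J) B
  refine ((isAdd_finsupp_self (I ⊕ J)).congr (pFinsupp A B U C₁ C₂ (I ⊕ J))).retract
    (pMap (e₁.symm.toLinearMap ∘ₗ LinearMap.inl A _ _ ∘ₗ i)
      (e₂.symm.toLinearMap ∘ₗ LinearMap.inr B _ _ ∘ₗ j))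
    (pMap (r ∘ₗ LinearMap.fst A _ _ ∘ₗ e₁.toLinearMap)
      (s ∘ₗ LinearMap.snd B _ _ ∘ₗ e₂.toLinearMap)) ?_
  rw [← pMap_comp, ← pMap_id]
  congr 1
  · ext x
    simpa using LinearMap.congr_fun hr x
  · ext x
    simpa using LinearMap.congr_fun hs x

theorem IsAdd.exists_pMod_retract (h : IsAdd (TriMat A B U) (pMod A B U C₁ C₂) L) :
    ∃ (I : Type u) (i : L →ₗ[TriMat A B U] pMod A B U (I →₀ C₁) (I →₀ C₂))
      (r : pMod A B U (I →₀ C₁) (I →₀ C₂) →ₗ[TriMat A B U] L), r ∘ₗ i = LinearMap.id := by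
  obtain ⟨I, i, r, hr⟩ := isAdd_iff_retract.1 h
  refine ⟨I, (pFinsupp A B U C₁ C₂ I).toLinearMap ∘ₗ i,
    r ∘ₗ (pFinsupp A B U C₁ C₂ I).symm.toLinearMap, ?_⟩
  ext1 x
  simpa using LinearMap.congr_fun hr x

theorem IsAdd.fst (h : IsAdd (TriMat A B U) (pMod A B U C₁ C₂) L) :
    IsAdd A C₁ (Fst A B U L) := by
  obtain ⟨I, i, r, hr⟩ := h.exists_pMod_retract
  exact ((isAdd_finsupp_self I).congr (fstTriple _)).retract (fstMap i) (fstMap r)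
    (by rw [← fstMap_comp, hr, fstMap_id])

theorem IsAdd.cok (h : IsAdd (TriMat A B U) (pMod A B U C₁ C₂) L) :
    IsAdd B C₂ (Cok A B U L) := by
  obtain ⟨I, i, r, hr⟩ := h.exists_pMod_retract
  exact ((isAdd_finsupp_self I).congr (cokPMod A B U (I →₀ C₁) (I →₀ C₂)).symm).retract
    (cokMap i) (cokMap r) (by rw [← cokMap_comp, hr, cokMap_id])

/-- The structure map `U ⊗_A e₁ M → e₂ M` is a split monomorphism. -/
def ActSplits (A B U L : Type u) [Ring A] [Ring B]
    [AddCommGroup U] [Module B U] [Module Aᵐᵒᵖ U] [SMulCommClass B Aᵐᵒᵖ U]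
    [AddCommGroup L] [Module (TriMat A B U) L] : Prop :=
  ∃ r : Snd A B U L →ₗ[B] BTensor A B U (Fst A B U L), ∀ t, r (act A B U L t) = t

theorem actSplits_pMod : ActSplits A B U (pMod A B U X₁ X₂) := by
  refine ⟨bmap A B U (fstTriple _).toLinearMap ∘ₗ LinearMap.fst B _ _ ∘ₗ
    (sndTriple _).symm.toLinearMap, fun t => ?_⟩
  obtain ⟨t, rfl⟩ := (bmapEquiv (fstTriple _)).surjective t
  change bmap A B U _ (LinearMap.fst B _ _ ((sndTriple (LinearMap.inl B (BTensor A B U X₁) X₂)).symm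
    (act A B U _ (bmap A B U (fstTriple _).toLinearMap t)))) = _
  rw [act_triple, LinearEquiv.symm_apply_apply]
  rfl

theorem ActSplits.retract (h : ActSplits A B U N) (i : L →ₗ[TriMat A B U] N)
    (r : N →ₗ[TriMat A B U] L) (hr : r ∘ₗ i = LinearMap.id) : ActSplits A B U L := by
  obtain ⟨s, hs⟩ := h
  refine ⟨bmap A B U (fstMap r) ∘ₗ s ∘ₗ sndMap i, fun t => ?_⟩
  simp only [LinearMap.comp_apply]
  rw [← act_bmap_fstMap, hs, bmap_bmap, ← fstMap_comp, hr, fstMap_id, bmap_id]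
  rfl

theorem IsAdd.actSplits (h : IsAdd (TriMat A B U) (pMod A B U C₁ C₂) L) : ActSplits A B U L := by
  obtain ⟨I, i, r, hr⟩ := h.exists_pMod_retract
  exact actSplits_pMod.retract i r hr

variable (A B U X₁) in
/-- The module `(X₁, 0)` over the triangular matrix ring. -/
abbrev qMod : Type u := OfTriple (0 : BTensor A B U X₁ →ₗ[B] PUnit.{u + 1})

/-- The functor `X₁ ↦ (X₁, 0)` on morphisms. -/
def qMap {Y₁ : Type u} [AddCommGroup Y₁] [Module A Y₁] (f : X₁ →ₗ[A] Y₁) :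
    qMod A B U X₁ →ₗ[TriMat A B U] qMod A B U Y₁ :=
  triMap _ _ f 0 fun _ _ => rfl

/-- The map `L → (X₁, 0)` with given first component. -/
def toQ (f : Fst A B U L →ₗ[A] X₁) : L →ₗ[TriMat A B U] qMod A B U X₁ :=
  toTri _ f 0 fun _ _ => rfl

theorem toQ_apply (f : Fst A B U L →ₗ[A] X₁) (x : L) :
    toQ f x = OfTriple.mk _ (f (fstPr A B U L x)) PUnit.unit := rfl

theorem qMap_surjective {Y₁ : Type u} [AddCommGroup Y₁] [Module A Y₁] {f : X₁ →ₗ[A] Y₁}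
    (hf : Function.Surjective f) :
    Function.Surjective (qMap f : qMod A B U X₁ →ₗ[TriMat A B U] _) := by
  rintro ⟨y, _⟩
  obtain ⟨x, rfl⟩ := hf y
  exact ⟨OfTriple.mk _ x PUnit.unit, rfl⟩

/-- Left adjoints of functors preserving surjections preserve projectives; here the right adjoint is
M ↦ (e₁M, e₂M). -/
theorem projective_pMod [Module.Projective A X₁] [Module.Projective B X₂] :
    Module.Projective (TriMat A B U) (pMod A B U X₁ X₂) := by
  refine Module.Projective.of_lifting_property'' fun f hf => ?_
  obtain ⟨l₁, h₁⟩ := Module.projective_lifting_property (fstMap f) (pFst LinearMap.id)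
    (fstMap_surjective hf)
  obtain ⟨l₂, h₂⟩ := Module.projective_lifting_property (sndMap f) (pSnd LinearMap.id)
    (sndMap_surjective hf)
  refine ⟨pLift l₁ l₂, pHom_ext ?_ ?_⟩
  · rw [pFst_comp, pFst_pLift, h₁]
  · rw [pSnd_comp, pSnd_pLift, h₂]

/-- The same principle for e₁, left adjoint to X ↦ (X, 0). -/
theorem projective_fst [Module.Projective (TriMat A B U) L] :
    Module.Projective A (Fst A B U L) := by
  refine Module.Projective.of_lifting_property'' fun f hf => ?_
  obtain ⟨l, hl⟩ := Module.projective_lifting_property (qMap f)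
    (toQ LinearMap.id : L →ₗ[TriMat A B U] _) (qMap_surjective hf)
  refine ⟨(fstTriple _).symm.toLinearMap ∘ₗ fstMap l, ?_⟩
  ext1 x
  exact (congrArg Prod.fst (LinearMap.congr_fun hl x)).trans (fstPr_fst x)

/-- The map `L → p(0, X₂)` given by a map from the cokernel of the structure map. -/
def toPZero (f : Cok A B U L →ₗ[B] X₂) : L →ₗ[TriMat A B U] pMod A B U PUnit.{u + 1} X₂ :=
  toTri _ 0 (LinearMap.inr B _ _ ∘ₗ f ∘ₗ Submodule.mkQ _) fun u x => by
    have : Submodule.mkQ (LinearMap.range (act A B U L)) (act A B U L (btmul A B u x)) = 0 :=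
      (Submodule.Quotient.mk_eq_zero _).2 ⟨_, rfl⟩
    rw [LinearMap.comp_apply, LinearMap.comp_apply, this, map_zero, map_zero]
    exact (congrArg _ (Subsingleton.elim _ _)).trans (map_zero (LinearMap.inl B _ _))|>.symm

theorem toPZero_apply (f : Cok A B U L →ₗ[B] X₂) (x : L) :
    toPZero f x = OfTriple.mk _ PUnit.unit
      (0, f (Submodule.Quotient.mk (sndPr A B U L x))) := rfl

/-- The same principle for Cok, left adjoint to Y ↦ p(0, Y). -/
theorem projective_cok [Module.Projective (TriMat A B U) L] :
    Module.Projective B (Cok A B U L) := by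
  refine Module.Projective.of_lifting_property'' fun f hf => ?_
  obtain ⟨l, hl⟩ := Module.projective_lifting_property
    (pMap (LinearMap.id : PUnit.{u + 1} →ₗ[A] _) f)
    (toPZero LinearMap.id : L →ₗ[TriMat A B U] _) (pMap_surjective Function.surjective_id hf)
  refine ⟨(cokPMod A B U _ _).toLinearMap ∘ₗ cokMap l, ?_⟩
  refine LinearMap.ext fun y => ?_
  obtain ⟨y, rfl⟩ := Submodule.Quotient.mk_surjective _ y
  have h := congrArg (fun z : PUnit × BTensor A B U PUnit.{u + 1} × Cok A B U L => z.2.2)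
    (LinearMap.congr_fun hl (y : L))
  refine h.trans ?_
  exact congrArg (Submodule.Quotient.mk) (sndPr_snd y)

/-- Lifting L → (e₁L, 0) through p(e₁L, 0) gives a map whose first component is the identity; by
naturality its second component retracts the structure map. -/
theorem actSplits_of_projective [Module.Projective (TriMat A B U) L] : ActSplits A B U L := by
  let π : pMod A B U (Fst A B U L) PUnit.{u + 1} →ₗ[TriMat A B U] qMod A B U (Fst A B U L) :=
    triMap _ _ LinearMap.id 0 fun _ _ => rfl
  have hπ : Function.Surjective π := fun z => ⟨OfTriple.mk _ z.1 0, rfl⟩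
  obtain ⟨l, hl⟩ := Module.projective_lifting_property π (toQ LinearMap.id) hπ
  have h1 : fstMap l = (fstTriple _).toLinearMap := by
    ext1 x
    obtain ⟨w, hw⟩ := (fstTriple _).surjective (fstMap l x)
    rw [← hw]
    refine congrArg _ ?_
    have h2 := congrArg Prod.fst (LinearMap.congr_fun hl (x : L))
    have h3 : w = (fstMap l x).1.1 := by rw [← hw]; rfl
    exact h3.trans (h2.trans (fstPr_fst x))
  refine ⟨LinearMap.fst B _ _ ∘ₗ (sndTriple _).symm.toLinearMap ∘ₗ sndMap l, fun t => ?_⟩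
  simp only [LinearMap.comp_apply]
  rw [← act_bmap_fstMap, h1, act_triple]
  rfl

end Summands

/-! ### Hom-exactness and factored forms of G_C-projectivity -/

section HomExact

variable {R : Type u} [Ring R] {S : LinSeq R} {F G : Type u} [AddCommGroup F] [Module R F]
  [AddCommGroup G] [Module R G]

theorem LinSeq.IsHomExact.retract (h : S.IsHomExact F) (i : G →ₗ[R] F) (r : F →ₗ[R] G)
    (hr : r ∘ₗ i = LinearMap.id) : S.IsHomExact G := by
  have hr' : ∀ x, r (i x) = x := LinearMap.congr_fun hr
  intro n g
  constructor
  · intro hg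
    obtain ⟨k, hk⟩ := (h n (i ∘ₗ g)).1 (by
      change (i ∘ₗ g) ∘ₗ S.d n = 0
      rw [LinearMap.comp_assoc, show g ∘ₗ S.d n = 0 from hg, LinearMap.comp_zero])
    refine ⟨r ∘ₗ k, ?_⟩
    ext x
    exact (congrArg r (LinearMap.congr_fun hk x)).trans (hr' _)
  · rintro ⟨k, rfl⟩
    ext x
    have := LinearMap.congr_fun ((h n _).2 ⟨i ∘ₗ k, rfl⟩) x
    refine (hr' _).symm.trans ((congrArg r this).trans (map_zero r))

theorem LinSeq.IsHomExact.prod (hF : S.IsHomExact F) (hG : S.IsHomExact G) :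
    S.IsHomExact (F × G) := by
  intro n g
  constructor
  · intro hg
    have hg' : ∀ x, g (S.d n x) = 0 := LinearMap.congr_fun hg
    obtain ⟨k, hk⟩ := (hF n (LinearMap.fst R F G ∘ₗ g)).1 (by ext x; simp [hg'])
    obtain ⟨l, hl⟩ := (hG n (LinearMap.snd R F G ∘ₗ g)).1 (by ext x; simp [hg'])
    exact ⟨k.prod l, LinearMap.ext fun x =>
      Prod.ext (LinearMap.congr_fun hk x) (LinearMap.congr_fun hl x)⟩
  · rintro ⟨k, rfl⟩
    have h1 := (hF n _).2 ⟨LinearMap.fst R F G ∘ₗ k, rfl⟩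
    have h2 := (hG n _).2 ⟨LinearMap.snd R F G ∘ₗ k, rfl⟩
    exact LinearMap.ext fun x => Prod.ext (LinearMap.congr_fun h1 x) (LinearMap.congr_fun h2 x)

theorem nonempty_equiv_range {X Y M : Type u} [AddCommGroup X] [Module R X] [AddCommGroup Y]
    [Module R Y] [AddCommGroup M] [Module R M] {p : X →ₗ[R] M} {i : M →ₗ[R] Y}
    (hp : Function.Surjective p) (hi : Function.Injective i) {d : X →ₗ[R] Y}
    (hd : i ∘ₗ p = d) : Nonempty (M ≃ₗ[R] LinearMap.range d) := by
  have : LinearMap.range d = LinearMap.range i := by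
    rw [← hd, LinearMap.range_comp, LinearMap.range_eq_top.2 hp, Submodule.map_top]
  rw [this]
  exact ⟨LinearEquiv.ofInjective i hi⟩

/-- Functors that do not preserve images can still be applied to the two factors of the middle map.
The form `m + 1` keeps the preceding map `S.d m` available. -/
theorem IsGProj.exists_factorization {C M : Type u} [AddCommGroup C] [Module R C]
    [AddCommGroup M] [Module R M] (h : IsGProj R C M) :
    ∃ (S : LinSeq R) (m : ℤ) (p : S.X (m + 1) →ₗ[R] M) (i : M →ₗ[R] S.X (m + 1 + 1)),
      m + 1 = -1 ∧ S.IsProjAdd C ∧ S.IsExact ∧ S.IsHomAddExact C ∧ Function.Surjective p ∧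
      Function.Injective i ∧ i ∘ₗ p = S.d (m + 1) := by
  obtain ⟨S, hP, hS, hH, he⟩ := h
  obtain ⟨m, hm⟩ : ∃ m : ℤ, m + 1 = -1 := ⟨-2, rfl⟩
  rw [← hm] at he
  obtain ⟨e⟩ := he
  exact ⟨S, m, e.symm.toLinearMap ∘ₗ (S.d (m + 1)).rangeRestrict,
    (LinearMap.range (S.d (m + 1))).subtype ∘ₗ e.toLinearMap, hm, hP, hS, hH,
    e.symm.surjective.comp (LinearMap.surjective_rangeRestrict _),
    Subtype.val_injective.comp e.injective, by ext x; simp⟩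

theorem isGProj_of_factorization {C M : Type u} [AddCommGroup C] [Module R C]
    [AddCommGroup M] [Module R M] (S : LinSeq R) (m : ℤ) (p : S.X (m + 1) →ₗ[R] M)
    (i : M →ₗ[R] S.X (m + 1 + 1)) (hm : m + 1 = -1) (hP : S.IsProjAdd C) (hS : S.IsExact)
    (hH : S.IsHomAddExact C) (hp : Function.Surjective p) (hi : Function.Injective i)
    (hd : i ∘ₗ p = S.d (m + 1)) : IsGProj R C M := by
  refine ⟨S, hP, hS, hH, ?_⟩
  have := nonempty_equiv_range hp hi hd
  rwa [hm] at this

end HomExact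

/-! ### G-projectivity under p, e₁ and Cok -/

section Transfer

variable {A B U : Type u} [Ring A] [Ring B]
  [AddCommGroup U] [Module B U] [Module Aᵐᵒᵖ U] [SMulCommClass B Aᵐᵒᵖ U]
  {C₁ C₂ : Type u} [AddCommGroup C₁] [Module A C₁] [AddCommGroup C₂] [Module B C₂]

/-- The module e₂F is a summand of (U ⊗ C₁^(I)) ⊕ C₂^(I): condition (b) handles the first term, the
hypothesis on S the second. -/
theorem IsCompatible.isHomExact_snd (hU : IsCompatible A B U C₁ C₂) {S : LinSeq B}
    (hP : S.IsProjAdd C₂) (hS : S.IsExact) (hH : S.IsHomAddExact C₂) {F : Type u}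
    [AddCommGroup F] [Module (TriMat A B U) F]
    (hF : IsAdd (TriMat A B U) (pMod A B U C₁ C₂) F) : S.IsHomExact (Snd A B U F) := by
  obtain ⟨I, i, r, hr⟩ := hF.exists_pMod_retract
  have h1 : S.IsHomExact (BTensor A B U (I →₀ C₁)) :=
    hU.hom_exact S hP hS hH (ModuleCat.of A (I →₀ C₁)) (isAdd_finsupp_self I)
  have h2 : S.IsHomExact (I →₀ C₂) := hH (ModuleCat.of B (I →₀ C₂)) (isAdd_finsupp_self I)
  let e := sndTriple (LinearMap.inl B (BTensor A B U (I →₀ C₁)) (I →₀ C₂))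
  refine (h1.prod h2).retract (e.symm.toLinearMap ∘ₗ sndMap i) (sndMap r ∘ₗ e.toLinearMap) ?_
  ext1 x
  have : sndMap r (sndMap i x) = x := LinearMap.congr_fun (congrArg sndMap hr) x
  simpa using this

/-- The sequence `p(S, S')`. -/
abbrev pSeq (S : LinSeq A) (S' : LinSeq B) : LinSeq (TriMat A B U) where
  X n := ModuleCat.of (TriMat A B U) (pMod A B U (S.X n) (S'.X n))
  d n := pMap (S.d n) (S'.d n)

/-- Applying p to the two defining sequences preserves exactness by condition (a). By adjunction,
Hom into F splits into Hom into e₁F and Hom into e₂F, both exact. -/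
theorem IsCompatible.isGProj_pMod (hU : IsCompatible A B U C₁ C₂) {G₁ G₂ : Type u}
    [AddCommGroup G₁] [Module A G₁] [AddCommGroup G₂] [Module B G₂]
    (h₁ : IsGProj A C₁ G₁) (h₂ : IsGProj B C₂ G₂) :
    IsGProj (TriMat A B U) (pMod A B U C₁ C₂) (pMod A B U G₁ G₂) := by
  obtain ⟨S, m, p, i, hm, hP, hS, hH, hp, hi, hd⟩ := h₁.exists_factorization
  obtain ⟨S', m', p', i', hm', hP', hS', hH', hp', hi', hd'⟩ := h₂.exists_factorization
  obtain rfl : m' = m := by omega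
  have hT := hU.tensor_exact S hP hS
  refine isGProj_of_factorization (pSeq S S') m' (pMap p p') (pMap i i') hm ⟨?_, ?_⟩ ?_ ?_
    (pMap_surjective hp hp') (pMap_injective hi ?_ hi') ?_
  · intro n hn
    have := hP.1 n hn
    have := hP'.1 n hn
    exact projective_pMod (X₁ := S.X n) (X₂ := S'.X n)
  · intro n hn
    exact isAdd_pMod (hP.2 n hn) (hP'.2 n hn)
  · intro n
    exact pMap_exact (hS n) (hT n) (hS' n)
  · intro F hF n (g : pMod A B U (S.X (n + 1)) (S'.X (n + 1)) →ₗ[TriMat A B U] F)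
    have hF₁ := hH (ModuleCat.of A (Fst A B U F)) hF.fst n
    have hF₂ := hU.isHomExact_snd hP' hS' hH' hF n
    constructor
    · intro hg
      have hg' : g ∘ₗ pMap (S.d n) (S'.d n) = 0 := hg
      obtain ⟨k, hk⟩ := (hF₁ (pFst g)).1 (by
        change pFst g ∘ₗ S.d n = 0
        rw [← pFst_comp_pMap _ (S'.d n), hg']; rfl)
      obtain ⟨l, hl⟩ := (hF₂ (pSnd g)).1 (by
        change pSnd g ∘ₗ S'.d n = 0
        rw [← pSnd_comp_pMap (S.d n), hg']; rfl)
      refine ⟨pLift k l, pHom_ext ?_ ?_⟩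
      · exact (pFst_comp_pMap _ _ _).trans (by rw [pFst_pLift]; exact hk)
      · exact (pSnd_comp_pMap _ _ _).trans (by rw [pSnd_pLift]; exact hl)
    · rintro ⟨k, rfl⟩
      let k' : pMod A B U (S.X (n + 1 + 1)) (S'.X (n + 1 + 1)) →ₗ[TriMat A B U] F := k
      change (k' ∘ₗ pMap (S.d (n + 1)) (S'.d (n + 1))) ∘ₗ pMap (S.d n) (S'.d n) = 0
      rw [LinearMap.comp_assoc, (pMap_exact (hS n) (hT n) (hS' n)).linearMap_comp_eq_zero,
        LinearMap.comp_zero]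
  · refine bmap_injective_of_exact (f := S.d m') hp hi ?_ ?_
    · rw [hd]; exact hS m'
    · rw [hd]; exact hT m'
  · exact (pMap_comp _ _ _ _).symm.trans (by rw [hd, hd'])

section Components

variable (S : LinSeq (TriMat A B U))

/-- The sequence of first components. -/
abbrev fstSeq : LinSeq A where
  X n := ModuleCat.of A (Fst A B U (S.X n))
  d n := fstMap (S.d n)

/-- The sequence of cokernels of the structure maps. -/
abbrev cokSeq : LinSeq B where
  X n := ModuleCat.of B (Cok A B U (S.X n))
  d n := cokMap (S.d n)

variable {S}

theorem fstSeq_isProjAdd (hP : S.IsProjAdd (pMod A B U C₁ C₂)) : (fstSeq S).IsProjAdd C₁ :=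
  ⟨fun n hn => by
    have := hP.1 n hn
    exact projective_fst (L := S.X n), fun n hn => (hP.2 n hn).fst⟩

theorem cokSeq_isProjAdd (hP : S.IsProjAdd (pMod A B U C₁ C₂)) : (cokSeq S).IsProjAdd C₂ :=
  ⟨fun n hn => by
    have := hP.1 n hn
    exact projective_cok (L := S.X n), fun n hn => (hP.2 n hn).cok⟩

theorem actSplits_of_isProjAdd (hP : S.IsProjAdd (pMod A B U C₁ C₂)) (n : ℤ) :
    ActSplits A B U (S.X n) := by
  rcases lt_or_ge n 0 with hn | hn
  · have := hP.1 n hn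
    exact actSplits_of_projective
  · exact (hP.2 n hn).actSplits

theorem ActSplits.injective {L : Type u} [AddCommGroup L] [Module (TriMat A B U) L]
    (h : ActSplits A B U L) : Function.Injective (act A B U L) := by
  obtain ⟨r, hr⟩ := h
  exact Function.LeftInverse.injective hr

theorem fstSeq_isExact (hS : S.IsExact) : (fstSeq S).IsExact := fun n => fstMap_exact (hS n)

theorem IsCompatible.bmap_fstMap_exact (hU : IsCompatible A B U C₁ C₂)
    (hP : S.IsProjAdd (pMod A B U C₁ C₂)) (hS : S.IsExact) (n : ℤ) :
    Function.Exact (bmap A B U (fstMap (S.d n))) (bmap A B U (fstMap (S.d (n + 1)))) :=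
  hU.tensor_exact (fstSeq S) (fstSeq_isProjAdd hP) (fstSeq_isExact hS) n

theorem cok_mk_act {L : Type u} [AddCommGroup L] [Module (TriMat A B U) L]
    (t : BTensor A B U (Fst A B U L)) :
    (Submodule.Quotient.mk (act A B U L t) : Cok A B U L) = 0 :=
  (Submodule.Quotient.mk_eq_zero _).2 ⟨t, rfl⟩

/-- The structure maps are injective and U ⊗ e₁S is exact, so a cycle in the image of the structure
map bounds within that image. -/
theorem IsCompatible.exists_act_eq (hU : IsCompatible A B U C₁ C₂)
    (hP : S.IsProjAdd (pMod A B U C₁ C₂)) (hS : S.IsExact) (n : ℤ)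
    (t : BTensor A B U (Fst A B U (S.X (n + 1))))
    (ht : sndMap (S.d (n + 1)) (act A B U _ t) = 0) :
    ∃ s, act A B U _ t = sndMap (S.d n) (act A B U (S.X n) s) := by
  rw [← act_bmap_fstMap] at ht
  have := (injective_iff_map_eq_zero _).1 (actSplits_of_isProjAdd hP (n + 1 + 1)).injective _ ht
  obtain ⟨s, rfl⟩ := (hU.bmap_fstMap_exact hP hS n t).1 this
  exact ⟨s, act_bmap_fstMap _ _⟩

/-- Two-out-of-three for 0 → U ⊗ e₁S → e₂S → Cok S → 0, carried out on elements. -/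
theorem IsCompatible.cokSeq_isExact (hU : IsCompatible A B U C₁ C₂)
    (hP : S.IsProjAdd (pMod A B U C₁ C₂)) (hS : S.IsExact) : (cokSeq S).IsExact := by
  intro n y
  obtain ⟨y, rfl⟩ := Submodule.Quotient.mk_surjective _ y
  constructor
  · intro hy
    obtain ⟨t, ht⟩ := (Submodule.Quotient.mk_eq_zero _).1
      (show Submodule.Quotient.mk (sndMap (S.d (n + 1)) y) = (0 : Cok A B U _) from hy)
    obtain ⟨s, hs⟩ := hU.exists_act_eq hP hS (n + 1) t (by
      rw [ht]
      exact (sndMap_exact (hS (n + 1))).apply_apply_eq_zero y)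
    obtain ⟨x, hx⟩ := (sndMap_exact (hS n) (y - act A B U _ s)).1 (by
      rw [map_sub, ← ht, hs, sub_self])
    refine ⟨Submodule.Quotient.mk x, ?_⟩
    change (Submodule.Quotient.mk (sndMap (S.d n) x) : Cok A B U _) = _
    rw [hx, Submodule.Quotient.mk_sub, cok_mk_act, sub_zero]
  · rintro ⟨x, hx⟩
    obtain ⟨x, rfl⟩ := Submodule.Quotient.mk_surjective _ x
    rw [← hx]
    change (Submodule.Quotient.mk (sndMap (S.d (n + 1)) (sndMap (S.d n) x)) : Cok A B U _) = 0
    rw [(sndMap_exact (hS n)).apply_apply_eq_zero, Submodule.Quotient.mk_zero]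

/-- By adjunction, Hom(Cok S, F) is Hom(S, p(0, F)), and p(0, F) lies in Add(C). -/
theorem IsCompatible.cokSeq_isHomAddExact (hU : IsCompatible A B U C₁ C₂)
    (hP : S.IsProjAdd (pMod A B U C₁ C₂)) (hS : S.IsExact)
    (hH : S.IsHomAddExact (pMod A B U C₁ C₂)) : (cokSeq S).IsHomAddExact C₂ := by
  intro F hF n (g : Cok A B U (S.X (n + 1)) →ₗ[B] F)
  constructor
  · intro hg
    have hg' : g ∘ₗ cokMap (S.d n) = 0 := hg
    have hF' : IsAdd (TriMat A B U) (pMod A B U C₁ C₂) (pMod A B U PUnit.{u + 1} F) :=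
      isAdd_pMod isAdd_of_subsingleton hF
    obtain ⟨k, hk⟩ := (hH (ModuleCat.of _ (pMod A B U PUnit.{u + 1} F)) hF' n (toPZero g)).1 (by
      ext x
      change toPZero g (S.d n x) = 0
      rw [toPZero_apply, sndPr_apply, ← cokMap_mk]
      have := LinearMap.congr_fun hg' (Submodule.Quotient.mk (sndPr A B U _ x))
      rw [LinearMap.comp_apply] at this
      rw [this]
      rfl)
    refine ⟨(cokPMod A B U PUnit.{u + 1} F).toLinearMap ∘ₗ cokMap k, ?_⟩
    refine LinearMap.ext fun y => ?_
    obtain ⟨y, rfl⟩ := Submodule.Quotient.mk_surjective _ y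
    have h := congrArg (fun z : PUnit × BTensor A B U PUnit.{u + 1} × F => z.2.2)
      (LinearMap.congr_fun hk (y : S.X (n + 1)))
    refine h.trans ?_
    change g (Submodule.Quotient.mk (sndPr A B U _ _)) = _
    rw [sndPr_snd]
  · rintro ⟨k, rfl⟩
    refine LinearMap.ext fun y => ?_
    change k ((cokSeq S).d (n + 1) ((cokSeq S).d n y)) = 0
    rw [(hU.cokSeq_isExact hP hS n).apply_apply_eq_zero, map_zero]

/-- A cocycle g on e₁S must be lifted to a cocycle S → p(F, 0). Splitness supplies a second
component, and condition (b), applied to the cokernel sequence, corrects it. -/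
theorem IsCompatible.fstSeq_isHomAddExact (hU : IsCompatible A B U C₁ C₂)
    (hP : S.IsProjAdd (pMod A B U C₁ C₂)) (hS : S.IsExact)
    (hH : S.IsHomAddExact (pMod A B U C₁ C₂)) : (fstSeq S).IsHomAddExact C₁ := by
  intro F hF n (g : Fst A B U (S.X (n + 1)) →ₗ[A] F)
  constructor
  swap
  · rintro ⟨k, rfl⟩
    refine LinearMap.ext fun y => ?_
    change k ((fstSeq S).d (n + 1) ((fstSeq S).d n y)) = 0
    rw [(fstSeq_isExact hS n).apply_apply_eq_zero, map_zero]
  intro hg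
  obtain ⟨m, rfl⟩ : ∃ m, n = m + 1 := ⟨n - 1, by ring⟩
  have hg1 : g ∘ₗ fstMap (S.d (m + 1)) = 0 := hg
  obtain ⟨r, hr⟩ := actSplits_of_isProjAdd hP (m + 1 + 1)
  -- `(g, c)` is already T-linear, but `c` need not vanish on boundaries. Its restriction to
  -- boundaries factors through Cok as `q`, and `q` is a coboundary.
  let c : Snd A B U (S.X (m + 1 + 1)) →ₗ[B] BTensor A B U F := bmap A B U g ∘ₗ r
  have hc : ∀ t, c (act A B U _ t) = bmap A B U g t := fun t => congrArg _ (hr t)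
  obtain ⟨q, hq⟩ : ∃ q : Cok A B U (S.X (m + 1)) →ₗ[B] BTensor A B U F,
      ∀ y, q (Submodule.Quotient.mk y) = c (sndMap (S.d (m + 1)) y) := by
    refine ⟨Submodule.liftQ _ (c ∘ₗ sndMap (S.d (m + 1))) ?_, fun y => rfl⟩
    rintro _ ⟨t, rfl⟩
    rw [LinearMap.mem_ker, LinearMap.comp_apply, ← act_bmap_fstMap, hc, bmap_bmap, hg1, bmap_zero,
      LinearMap.zero_apply]
  obtain ⟨(q' : Cok A B U (S.X (m + 1 + 1)) →ₗ[B] BTensor A B U F), hq'⟩ := (hU.hom_exact (cokSeq S) (cokSeq_isProjAdd hP) (hU.cokSeq_isExact hP hS)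
    (hU.cokSeq_isHomAddExact hP hS hH) F hF m q).1 (by
      refine LinearMap.ext fun y => ?_
      obtain ⟨y, rfl⟩ := Submodule.Quotient.mk_surjective _ y
      change q (Submodule.Quotient.mk (sndMap (S.d m) y)) = 0
      rw [hq, (sndMap_exact (hS m)).apply_apply_eq_zero, map_zero])
  have hq1 : ∀ y, q' (Submodule.Quotient.mk (sndMap (S.d (m + 1)) y)) =
      c (sndMap (S.d (m + 1)) y) := fun y =>
    (LinearMap.congr_fun hq' (Submodule.Quotient.mk y)).trans (hq y)
  -- The correction factors through Cok, so T-linearity is kept, and the new component now vanishes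
  -- on boundaries.
  let c' : Snd A B U (S.X (m + 1 + 1)) →ₗ[B] BTensor A B U F :=
    c - q' ∘ₗ Submodule.mkQ (LinearMap.range (act A B U (S.X (m + 1 + 1))))
  have hc' : ∀ y, c' y = c y - q' (Submodule.Quotient.mk y) := fun _ => rfl
  let G : S.X (m + 1 + 1) →ₗ[TriMat A B U] pMod A B U F PUnit.{u + 1} :=
    toTri _ g (LinearMap.inl B _ _ ∘ₗ c') (fun u x => by
      rw [LinearMap.comp_apply, hc', hc, cok_mk_act, map_zero, sub_zero, bmap_btmul])
  have hG : ∀ x, G x = OfTriple.mk _ (g (fstPr A B U _ x)) (c' (sndPr A B U _ x), 0) :=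
    fun _ => rfl
  have hF' : IsAdd (TriMat A B U) (pMod A B U C₁ C₂) (pMod A B U F PUnit.{u + 1}) :=
    isAdd_pMod hF isAdd_of_subsingleton
  obtain ⟨k, hk⟩ := (hH (ModuleCat.of _ (pMod A B U F PUnit.{u + 1})) hF' (m + 1) G).1 (by
    ext x
    change G (S.d (m + 1) x) = 0
    rw [hG, fstPr_apply, sndPr_apply, hc', hq1, sub_self]
    have := LinearMap.congr_fun hg1 (fstPr A B U _ x)
    rw [LinearMap.comp_apply] at this
    rw [this]
    rfl)
  refine ⟨(fstTriple _).symm.toLinearMap ∘ₗ fstMap k, ?_⟩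
  refine LinearMap.ext fun (x : Fst A B U (S.X (m + 1 + 1))) => ?_
  have h := congrArg Prod.fst (LinearMap.congr_fun hk (x : S.X (m + 1 + 1)))
  refine h.trans ?_
  change g (fstPr A B U _ _) = _
  rw [fstPr_fst]

end Components

theorem IsCompatible.isGProj_fst (hU : IsCompatible A B U C₁ C₂) {M : Type u} [AddCommGroup M]
    [Module (TriMat A B U) M] (h : IsGProj (TriMat A B U) (pMod A B U C₁ C₂) M) :
    IsGProj A C₁ (Fst A B U M) := by
  obtain ⟨S, m, p, i, hm, hP, hS, hH, hp, hi, hd⟩ := h.exists_factorization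
  exact isGProj_of_factorization (fstSeq S) m (fstMap p) (fstMap i) hm (fstSeq_isProjAdd hP)
    (fstSeq_isExact hS) (hU.fstSeq_isHomAddExact hP hS hH) (fstMap_surjective hp)
    (fun x y hxy => Subtype.ext (hi (congrArg Subtype.val hxy)))
    ((fstMap_comp p i).symm.trans (congrArg fstMap hd))

/-- Cok is only right exact, so injectivity of Cok(i) needs its own argument: a cycle in the image
of the structure map bounds there, and its bounding element is pushed to M by p. -/
theorem IsCompatible.isGProj_cok (hU : IsCompatible A B U C₁ C₂) {M : Type u} [AddCommGroup M]
    [Module (TriMat A B U) M] (h : IsGProj (TriMat A B U) (pMod A B U C₁ C₂) M) :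
    IsGProj B C₂ (Cok A B U M) := by
  obtain ⟨S, m, p, i, hm, hP, hS, hH, hp, hi, hd⟩ := h.exists_factorization
  refine isGProj_of_factorization (cokSeq S) m (cokMap p) (cokMap i) hm (cokSeq_isProjAdd hP)
    (hU.cokSeq_isExact hP hS) (hU.cokSeq_isHomAddExact hP hS hH) (cokMap_surjective hp) ?_
    ((cokMap_comp p i).symm.trans (congrArg cokMap hd))
  change Function.Injective (cokMap i : Cok A B U M →ₗ[B] Cok A B U (S.X (m + 1 + 1)))
  rw [injective_iff_map_eq_zero]
  intro y hy
  obtain ⟨y, rfl⟩ := Submodule.Quotient.mk_surjective _ y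
  obtain ⟨t, ht⟩ := (Submodule.Quotient.mk_eq_zero _).1
    (show Submodule.Quotient.mk (sndMap i y) = (0 : Cok A B U _) from hy)
  have hdi : S.d (m + 1 + 1) ∘ₗ i = 0 := by
    ext x
    obtain ⟨w, rfl⟩ := hp x
    have := (hS (m + 1)).apply_apply_eq_zero w
    rwa [← hd] at this
  obtain ⟨s, hs⟩ := hU.exists_act_eq hP hS (m + 1) t (by
    rw [ht]
    exact Subtype.ext (LinearMap.congr_fun hdi (y : M)))
  refine (Submodule.Quotient.mk_eq_zero _).2 ⟨bmap A B U (fstMap p) s, ?_⟩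
  rw [act_bmap_fstMap]
  refine Subtype.ext (hi ?_)
  have h1 := congrArg Subtype.val (hs.symm.trans ht)
  rw [← hd] at h1
  exact h1

end Transfer

/-! ### Dimension estimates for (0, N), (X, 0) and general T-modules -/

section Bounds

variable {A B U : Type u} [Ring A] [Ring B]
  [AddCommGroup U] [Module B U] [Module Aᵐᵒᵖ U] [SMulCommClass B Aᵐᵒᵖ U]
  {C₁ C₂ : Type u} [AddCommGroup C₁] [Module A C₁] [AddCommGroup C₂] [Module B C₂]

theorem exact_of_subsingleton {X Y Z : Type u} [Subsingleton X] [Nonempty X] [Subsingleton Y]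
    [Subsingleton Z] [Zero Z] (f : X → Y) (g : Y → Z) : Function.Exact f g := fun _ =>
  ⟨fun _ => ⟨Classical.arbitrary X, Subsingleton.elim _ _⟩, fun _ => Subsingleton.elim _ _⟩

theorem IsSES.pZero {X Y Z : Type u} [AddCommGroup X] [Module B X] [AddCommGroup Y] [Module B Y]
    [AddCommGroup Z] [Module B Z] {i : X →ₗ[B] Y} {p : Y →ₗ[B] Z} (h : IsSES i p) :
    IsSES (pMap (LinearMap.id : PUnit.{u + 1} →ₗ[A] PUnit.{u + 1}) i :
      pMod A B U _ _ →ₗ[TriMat A B U] _)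
      (pMap (LinearMap.id : PUnit.{u + 1} →ₗ[A] PUnit.{u + 1}) p) :=
  ⟨pMap_injective Function.injective_id (Function.injective_of_subsingleton _) h.inj,
    pMap_exact (exact_of_subsingleton _ _) (exact_of_subsingleton _ _) h.exact,
    pMap_surjective Function.surjective_id h.surj⟩

theorem IsSES.qMap {X Y Z : Type u} [AddCommGroup X] [Module A X] [AddCommGroup Y] [Module A Y]
    [AddCommGroup Z] [Module A Z] {i : X →ₗ[A] Y} {p : Y →ₗ[A] Z} (h : IsSES i p) :
    IsSES (qMap i : qMod A B U _ →ₗ[TriMat A B U] _) (qMap p) := by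
  refine ⟨fun x y hxy => Prod.ext (h.inj (congrArg Prod.fst hxy)) rfl, fun z => ⟨fun hz => ?_, ?_⟩,
    qMap_surjective h.surj⟩
  · obtain ⟨x, hx⟩ := (h.exact z.1).1 (congrArg Prod.fst hz)
    exact ⟨OfTriple.mk _ x PUnit.unit, Prod.ext hx rfl⟩
  · rintro ⟨x, rfl⟩
    exact Prod.ext (h.apply_apply x.1) rfl

/-- The sequence `0 → (0, e₂ M) → M → (e₁ M, 0) → 0`. -/
theorem isSES_components (M : Type u) [AddCommGroup M] [Module (TriMat A B U) M] :
    IsSES (pLift 0 LinearMap.id : pMod A B U PUnit.{u + 1} (Snd A B U M) →ₗ[TriMat A B U] M)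
      (toQ LinearMap.id : M →ₗ[TriMat A B U] qMod A B U (Fst A B U M)) := by
  have key : ∀ y : Snd A B U M, (pLift 0 LinearMap.id : pMod A B U PUnit.{u + 1} (Snd A B U M)
      →ₗ[TriMat A B U] M) (OfTriple.mk _ 0 (0, y)) = y := fun y => by
    rw [← pSnd_coe, pSnd_pLift]; rfl
  have hz : ∀ z : pMod A B U PUnit.{u + 1} (Snd A B U M), z = OfTriple.mk _ 0 (0, z.2.2) :=
    fun z => Prod.ext rfl (Prod.ext (Subsingleton.elim _ _) rfl)
  refine ⟨fun z w h => ?_, fun x => ⟨fun hx => ?_, ?_⟩, fun z => ?_⟩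
  · rw [hz z, hz w, key, key] at h
    rw [hz z, hz w, Subtype.ext h]
  · have hx' : fstPr A B U M x = 0 := congrArg Prod.fst hx
    refine ⟨OfTriple.mk _ 0 (0, sndPr A B U M x), ?_⟩
    rw [key, ← fstPr_add_sndPr (A := A) (B := B) (U := U) x, hx', AddSubgroup.coe_zero, zero_add,
      sndPr_snd]
  · rintro ⟨z, rfl⟩
    rw [hz z, key, toQ_apply, fstPr_snd]
    rfl
  · refine ⟨(z.1 : M), ?_⟩
    rw [toQ_apply, fstPr_fst]
    rfl

/-- An isomorphism induces an isomorphism of modules `(X, 0)`. -/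
def qEquiv {X Y : Type u} [AddCommGroup X] [Module A X] [AddCommGroup Y] [Module A Y]
    (e : X ≃ₗ[A] Y) : qMod A B U X ≃ₗ[TriMat A B U] qMod A B U Y :=
  LinearEquiv.ofLinearMap (qMap e.toLinearMap) (qMap e.symm.toLinearMap)
    (LinearMap.ext fun z => Prod.ext (e.apply_symm_apply z.1) rfl)
    (LinearMap.ext fun z => Prod.ext (e.symm_apply_apply z.1) rfl)

variable (hC : IsWTilting (TriMat A B U) (pMod A B U C₁ C₂)) (hU : IsCompatible A B U C₁ C₂)

include hU in
theorem IsCompatible.gpdLE_fst {M : Type u} [AddCommGroup M] [Module (TriMat A B U) M] {n : ℕ}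
    (h : GpdLE (TriMat A B U) (pMod A B U C₁ C₂) M n) : GpdLE A C₁ (Fst A B U M) n := by
  obtain ⟨G, d, ε, hε, h0, hd, hG, hz⟩ := h
  refine ⟨fun i => ModuleCat.of A (Fst A B U (G i)), fun i => fstMap (d i), fstMap ε,
    fstMap_surjective hε, fstMap_exact h0, fun i => fstMap_exact (hd i),
    fun i hi => hU.isGProj_fst (hG i hi), fun i hi => ?_⟩
  have := hz i hi
  exact inferInstanceAs (Subsingleton (Fst A B U (G i)))

-- Cok does not preserve arbitrary resolutions, so p(0, N) is resolved by the projectives p(0, Q);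
-- its syzygies are again of the form p(0, K). At the last stage Cok returns a G-projective
-- B-module.
include hC hU in
theorem gpdLE_of_dimLE_pZero {n : ℕ} : ∀ {N : Type u} [AddCommGroup N] [Module B N],
    DimLE (TriMat A B U) (pMod A B U C₁ C₂) n (pMod A B U PUnit.{u + 1} N) →
    GpdLE B C₂ N n := by
  induction n with
  | zero =>
    intro N _ _ h
    exact gpdLE_zero ((hU.isGProj_cok h).congr (cokPMod A B U _ N))
  | succ n ih =>
    intro N _ _ h
    obtain ⟨Q, f, hQ, hf⟩ := exists_free_cover B N
    have hQp : Module.Projective B Q := Module.Projective.of_free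
    have hs := isSES_ker hf
    have hPp : Module.Projective A PUnit.{u + 1} := Module.Projective.of_free
    have hT : Module.Projective (TriMat A B U) (pMod A B U PUnit.{u + 1} Q) := projective_pMod
    have hQG : IsGProj (TriMat A B U) (pMod A B U C₁ C₂) (pMod A B U PUnit.{u + 1} Q) :=
      hC.isGProj_of_projective
    exact GpdLE.cons hs (ih (DimLE.ker hC hs.pZero h))
      ((hU.isGProj_cok hQG).congr (cokPMod A B U _ Q))

-- The functor p(0, -) is exact and preserves relative G-projectivity, so a resolution of N
-- transfers term by term.
include hC hU in
theorem GpdLE.dimLE_pZero {n : ℕ} : ∀ {N : Type u} [AddCommGroup N] [Module B N],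
    GpdLE B C₂ N n →
    DimLE (TriMat A B U) (pMod A B U C₁ C₂) n (pMod A B U PUnit.{u + 1} N) := by
  have key : ∀ (N : Type u) [AddCommGroup N] [Module B N], IsGProj B C₂ N →
      DimLE (TriMat A B U) (pMod A B U C₁ C₂) 0 (pMod A B U PUnit.{u + 1} N) := fun N _ _ h =>
    hU.isGProj_pMod isGProj_of_subsingleton h
  induction n with
  | zero => intro N _ _ h; exact key N h.isGProj
  | succ n ih =>
    intro N _ _ h
    obtain ⟨K, G, i, p, hs, hG, hK⟩ := h.uncons
    exact DimLE.right hs.pZero (ih hK) (DimLE.mono hC (Nat.zero_le _) (key G hG))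

-- In 0 → (0, U ⊗ G) → p(G, 0) → (G, 0) → 0 the middle term is G-projective; passing to the cokernel
-- accounts for the extra 1.
include hC hU in
theorem IsGProj.dimLE_qMod {k : ℕ} {G : Type u} [AddCommGroup G] [Module A G]
    (hG : IsGProj A C₁ G) (hk : gpd B C₂ (BTensor A B U G) ≤ k) :
    DimLE (TriMat A B U) (pMod A B U C₁ C₂) (k + 1) (qMod A B U G) := by
  obtain ⟨l, hl, h⟩ := exists_gpdLE_of_gpd_le hk
  let M := pMod A B U G PUnit.{u + 1}
  have hM : DimLE (TriMat A B U) (pMod A B U C₁ C₂) 0 M :=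
    hU.isGProj_pMod hG isGProj_of_subsingleton
  have e : BTensor A B U G ≃ₗ[B] Snd A B U M :=
    (LinearEquiv.prodUnique (R := B) (M := BTensor A B U G) (M₂ := PUnit.{u + 1})).symm.trans
      (sndTriple _)
  have h1 := DimLE.mono hC hl ((h.congr e).dimLE_pZero hC hU)
  exact (DimLE.right (isSES_components M) h1 (DimLE.mono hC (Nat.zero_le _) hM)).congr
    (qEquiv (fstTriple _).symm)

-- Each G-projective term of a resolution of X gives dimension at most k + 1 after X ↦ (X, 0), and
-- each further step of the resolution adds one.
include hC hU in
theorem GpdLE.dimLE_qMod {k n : ℕ} (hk : sgPD A B U C₁ C₂ ≤ k) : ∀ {X : Type u}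
    [AddCommGroup X] [Module A X], GpdLE A C₁ X n →
    DimLE (TriMat A B U) (pMod A B U C₁ C₂) (n + k + 1) (qMod A B U X) := by
  have key : ∀ (G : Type u) [AddCommGroup G] [Module A G], IsGProj A C₁ G →
      DimLE (TriMat A B U) (pMod A B U C₁ C₂) (k + 1) (qMod A B U G) := fun G _ _ hG =>
    hG.dimLE_qMod hC hU ((le_iSup₂ (f := fun (G : ModuleCat.{u} A) (_ : IsGProj A C₁ G) =>
      gpd B C₂ (BTensor A B U G)) (ModuleCat.of A G) hG).trans hk)
  induction n with
  | zero =>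
    intro X _ _ h
    exact DimLE.mono hC (by omega) (key X h.isGProj)
  | succ n ih =>
    intro X _ _ h
    obtain ⟨K, G, i, p, hs, hG, hK⟩ := h.uncons
    exact DimLE.mono hC (by omega) (DimLE.right (n := n + k + 1) hs.qMap (ih hK)
      (DimLE.mono hC (by omega) (key G hG)))

end Bounds

end RelGor

theorem mainTheorem3 (A B U C₁ C₂ : Type u) [Ring A] [Ring B]
    [AddCommGroup U] [Module B U] [Module Aᵐᵒᵖ U] [SMulCommClass B Aᵐᵒᵖ U]
    [AddCommGroup C₁] [Module A C₁] [AddCommGroup C₂] [Module B C₂]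
    (hC : RelGor.IsWTilting (RelGor.TriMat A B U) (RelGor.pMod A B U C₁ C₂))
    (hU : RelGor.IsCompatible A B U C₁ C₂) :
    max (RelGor.gPD A C₁) (RelGor.gPD B C₂)
        ≤ RelGor.gPD (RelGor.TriMat A B U) (RelGor.pMod A B U C₁ C₂) ∧
      RelGor.gPD (RelGor.TriMat A B U) (RelGor.pMod A B U C₁ C₂)
        ≤ max (RelGor.gPD A C₁ + RelGor.sgPD A B U C₁ C₂ + 1) (RelGor.gPD B C₂) := by
  open RelGor in
  refine ⟨max_le (iSup_le fun X => ?_) (iSup_le fun N => ?_), ?_⟩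
  -- p(X, 0) is a test module: its first component is X.
  · refine le_trans (le_iInf₂ fun n hn => ?_)
      (le_iSup (fun M : ModuleCat.{u} (TriMat A B U) => gpd _ (pMod A B U C₁ C₂) M)
        (ModuleCat.of _ (pMod A B U X PUnit.{u + 1})))
    exact gpd_le_of_gpdLE ((hU.gpdLE_fst hn).congr (fstTriple _).symm)
  · refine le_trans (le_iInf₂ fun n hn => ?_)
      (le_iSup (fun M : ModuleCat.{u} (TriMat A B U) => gpd _ (pMod A B U C₁ C₂) M)
        (ModuleCat.of _ (pMod A B U PUnit.{u + 1} N)))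
    exact gpd_le_of_gpdLE (gpdLE_of_dimLE_pZero hC hU (hn.dimLE hC))
  -- If any of the three quantities is infinite the bound is trivial; otherwise everything takes
  -- place in ℕ.
  · generalize hn : gPD A C₁ = n
    generalize hk : sgPD A B U C₁ C₂ = k
    generalize hm : gPD B C₂ = m
    cases n with
    | top => simp
    | coe n =>
    cases k with
    | top => simp
    | coe k =>
    cases m with
    | top => simp
    | coe m =>
    have hmax : (max ((n : ℕ∞) + k + 1) m) = ((max (n + k + 1) m : ℕ) : ℕ∞) := by
      rfl
    rw [hmax]
    refine iSup_le fun M => ?_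
    obtain ⟨m', hm', h₂⟩ := exists_gpdLE_of_gpd_le
      ((le_iSup (fun N : ModuleCat.{u} B => gpd B C₂ N) (ModuleCat.of B (Snd A B U M))).trans hm.le)
    obtain ⟨n', hn', h₁⟩ := exists_gpdLE_of_gpd_le
      ((le_iSup (fun X : ModuleCat.{u} A => gpd A C₁ X) (ModuleCat.of A (Fst A B U M))).trans hn.le)
    -- Both ends of the component sequence are raised to the common bound before the extension
    -- estimate is applied.
    have hN := DimLE.mid (isSES_components (M : Type u))
      (DimLE.mono hC (n := max (n + k + 1) m) (by omega) (h₂.dimLE_pZero hC hU))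
      (DimLE.mono hC (by omega) (h₁.dimLE_qMod hC hU hk.le))
    exact gpd_le_of_gpdLE (hN.gpdLE hC)
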